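/- Work in the smooth category. Let $D^m\subset\mathbb R^m$ be the unit disk, $S^{m-1}=\partial D^m$, and regard $\mathbb R^a\subset\mathbb R^b$ ($a\le b$) as the subspace where the last $b-a$ coordinates vanish. Embeddings of manifolds with boundary and corners are smooth up to the boundary and map the interior into the interior and each face into the corresponding face, with no other points mapped to that face. A framing of an embedding is an ordered tuple of smooth vector fields along it which, at every point, form a basis of a complement of its tangent space in the ambient tangent space. A framed embedding into an ambient manifold contained in $\mathbb R^{n+q+1}$ (or in $\mathbb R^{n+q+1}\times\mathbb R$) is suspended by enlarging $\mathbb R^{n+q+1}$ to $\mathbb R^{n+N+1}$ and appending the standard basis vectors $e_{n+q+2},\dots,e_{n+N+1}$ to the framing, as last vectors. Let $n\ge 0$, $q\ge 3$, $N\ge q$. A framed disked embedding $(f,\alpha):(S^n,D^{n+1})\hookrightarrow(S^{n+q},D^{n+N+1})$ consists of a framed embedding $f:S^n\hookrightarrow S^{n+q}$ and a framed embedding $\alpha:D^{n+1}\hookrightarrow D^{n+N+1}$, such that $\alpha|_{S^n}$ with its framing is the suspension of $f$ with its framing, and such that the framing respects orientations (the orientation of $D^{n+1}$ followed by the framing of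 $\alpha$ is the standard orientation of $\mathbb R^{n+N+1}$). The trivial one, $(\mathrm{id},\mathrm{id})$, consists of the standard inclusions with the standard framings $e_{n+2},e_{n+3},\dots$. Two framed disked embeddings $(f_i,\alpha_i):(S^n,D^{n+1})\hookrightarrow(S^{n+q},D^{n+N_i+1})$, $i=0,1$, are concordant if for some $M\ge\max(N_0,N_1)$ there is a framed embedding $F:D^{n+1}\times[0,1]\hookrightarrow D^{n+M+1}\times[0,1]$ whose restriction to $D^{n+1}\times\{i\}$ is, with its framing, the suspension of $\alpha_i$ in $D^{n+M+1}\times\{i\}$ for $i=0,1$, and whose restriction to $S^n\times[0,1]$ is, with its framing, the suspension of a framed embedding in $S^{n+q}\times[0,1]$. For the notion of slice, regard $D^{m+1}$ as a manifold with two boundary faces $\partial_-D^{m+1}$ and $\partial_+D^{m+1}$ meeting in a corner along the equator $S^{m-1}$, by taking as model the half disk $\{(x,s)\in\mathbb R^m\times\mathbb R:\ |x|^2+s^2\le 1,\ s\ge 0\}$; then $\partial_-D^{m+1}=D^m\times 0$ is the flat face and $\partial_+D^{m+1}=D^m_+$ is the round face, a hemisphere. A framed disked embedding $(f,\alpha)$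 as above is slice if for some $N'\ge N$ there is a framed embedding $H:D^{n+2}\hookrightarrow D^{n+N'+2}$ whose restriction to $\partial_-D^{n+2}=D^{n+1}$ is, with its framing, the suspension of $\alpha$ in $\partial_-D^{n+N'+2}=D^{n+N'+1}$, and whose restriction to $\partial_+D^{n+2}$ is, with its framing, the suspension of a framed embedding in the hemisphere $D^{n+q+1}_+\subset\partial_+D^{n+N'+2}=D^{n+N'+1}_+$. **Lemma.** A framed disked embedding $(f,\alpha):(S^n,D^{n+1})\hookrightarrow(S^{n+q},D^{n+N+1})$ is concordant to the trivial one $(\mathrm{id},\mathrm{id}):(S^n,D^{n+1})\subset(S^{n+q},D^{n+N+1})$ if and only if it is slice. -/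

import Mathlib

open scoped ContDiff

noncomputable section

namespace DiskedEmbedding

/-- The Euclidean space `ℝ^m`. -/
abbrev Eucl (m : ℕ) : Type := EuclideanSpace ℝ (Fin m)

/-- The standard inclusion `ℝ^a ⊂ ℝ^b` for `a ≤ b`, which appends zero coordinates. -/
def incl (a b : ℕ) : Eucl a →L[ℝ] Eucl b :=
  LinearMap.toContinuousLinearMap
    { toFun := fun y => WithLp.toLp 2 fun i : Fin b => if h : i.1 < a then y ⟨i.1, h⟩ else 0
      map_add' := by
        intro x y
        ext i
        by_cases h : i.1 < a <;> simp [h]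
      map_smul' := by
        intro c x
        ext i
        by_cases h : i.1 < a <;> simp [h] }

/-- The standard inclusion `ℝ^a × ℝ ⊂ ℝ^b × ℝ` for `a ≤ b`. -/
def inclProd (a b : ℕ) : Eucl a × ℝ → Eucl b × ℝ := fun y => (incl a b y.1, y.2)

/-- The standard basis vector of `ℝ^(m+N)` that follows the first `m + i` ones. These vectors,
for `i < N`, are the standard framing of `ℝ^m ⊂ ℝ^(m+N)`. -/
def stdVec (m N : ℕ) (i : Fin N) : Eucl (m + N) := EuclideanSpace.single (Fin.natAdd m i) 1

/-- The suspension of a framing `w` with `q` vectors in `ℝ^(m+q)` to a framing with `N ≥ q` vectors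
in `ℝ^(m+N)`: the missing standard basis vectors of `ℝ^(m+N)` are appended as last vectors. -/
def suspFrame {X : Type} (m q N : ℕ) (w : Fin q → X → Eucl (m + q)) : Fin N → X → Eucl (m + N) :=
  fun i x => if h : i.1 < q then incl (m + q) (m + N) (w ⟨i.1, h⟩ x) else stdVec m N i

/-- The suspension of a framing with `q` vectors in `ℝ^(m+q) × ℝ` to a framing with `N ≥ q` vectors
in `ℝ^(m+N) × ℝ`. -/
def suspFrameProd {X : Type} (m q N : ℕ) (w : Fin q → X → Eucl (m + q) × ℝ) :
    Fin N → X → Eucl (m + N) × ℝ :=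
  fun i x => if h : i.1 < q then inclProd (m + q) (m + N) (w ⟨i.1, h⟩ x) else (stdVec m N i, 0)

/-- `g`, restricted to the (compact, convex, full-dimensional) set `M`, is a smooth embedding, and
`v` is a framing of it: at each point of `M`, the vectors `v i x` are a basis of a complement of the
tangent space of the image of `g` (in particular `g` is an immersion). Smoothness is up to the
boundary and the corners of `M`. -/
structure IsFramedEmbedding {E E' : Type} [NormedAddCommGroup E] [NormedSpace ℝ E]
    [NormedAddCommGroup E'] [NormedSpace ℝ E'] {k : ℕ}
    (M : Set E) (g : E → E') (v : Fin k → E → E') : Prop where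
  smooth : ContDiffOn ℝ ∞ g M
  injOn : Set.InjOn g M
  smooth_frame : ∀ i, ContDiffOn ℝ ∞ (v i) M
  complement : ∀ x ∈ M, Function.Bijective
    (fun p : E × (Fin k → ℝ) => fderivWithin ℝ g M x p.1 + ∑ i, p.2 i • v i x)

/-- The closed unit disk `D^m`. -/
def disk (m : ℕ) : Set (Eucl m) := Metric.closedBall 0 1

/-- The unit sphere `S^(m-1)`, the boundary of `D^m`. -/
def sph (m : ℕ) : Set (Eucl m) := Metric.sphere 0 1

/-- The cylinder `D^m × [0,1]`. -/
def cylinder (m : ℕ) : Set (Eucl m × ℝ) := disk m ×ˢ Set.Icc 0 1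

/-- The disk `D^(m+1)` as a manifold whose boundary is the union of two faces `∂₋` and `∂₊` meeting
in a corner along the equator `S^(m-1)`: it is the half disk in `ℝ^m × ℝ`, the face `∂₋` is the
flat disk `D^m × 0`, and the face `∂₊` is the hemisphere `roundFace m`. -/
def halfDisk (m : ℕ) : Set (Eucl m × ℝ) := {p | ‖p.1‖ ^ 2 + p.2 ^ 2 ≤ 1 ∧ 0 ≤ p.2}

/-- The face `∂₊` of `halfDisk m`: the closed hemisphere `D^m_+ ⊂ S^m`. -/
def roundFace (m : ℕ) : Set (Eucl m × ℝ) := {p | ‖p.1‖ ^ 2 + p.2 ^ 2 = 1 ∧ 0 ≤ p.2}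

/-- The matrix of a map `g` from the disk `D^m` to `ℝ^(m+N)` with `N` vector fields `v` along it:
its columns are the partial derivatives of `g` at `x`, followed by the vectors `v i x`. -/
def frameMatrix {m N : ℕ} (g : Eucl m → Eucl (m + N)) (v : Fin N → Eucl m → Eucl (m + N))
    (x : Eucl m) : Matrix (Fin (m + N)) (Fin (m + N)) ℝ :=
  Matrix.of fun i j =>
    (Fin.append (fun a : Fin m => fderivWithin ℝ g (disk m) x (EuclideanSpace.single a 1))
      (fun b : Fin N => v b x) j) i

/-- A framed disked embedding `(f, α) : (S^n, D^(n+1)) ↪ (S^(n+q), D^(n+N+1))`, for `q ≤ N`.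
Only the values of `knot` and `knotFrame` on the sphere and those of `map` and `frame` on the disk
matter. The framed embedding `f = knot` of `S^n` is the restriction of `α = map`, so that its
smoothness, its injectivity and the fact that `knotFrame` is a framing of it in `S^(n+q)` follow
from `isFramedEmbedding` and the four boundary conditions. -/
structure FramedDisked (n q N : ℕ) where
  /-- The embedding `f` of `S^n` in `S^(n+q)`. -/
  knot : Eucl (n + 1) → Eucl (n + 1 + q)
  /-- The framing of `f` in `S^(n+q)`. -/
  knotFrame : Fin q → Eucl (n + 1) → Eucl (n + 1 + q)
  /-- The embedding `α` of `D^(n+1)` in `D^(n+N+1)`. -/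
  map : Eucl (n + 1) → Eucl (n + 1 + N)
  /-- The framing of `α` in `D^(n+N+1)`. -/
  frame : Fin N → Eucl (n + 1) → Eucl (n + 1 + N)
  isFramedEmbedding : IsFramedEmbedding (disk (n + 1)) map frame
  /-- The interior of the disk goes to the interior of the disk. -/
  map_interior : ∀ x, ‖x‖ < 1 → ‖map x‖ < 1
  /-- The framing respects the orientations. -/
  oriented : ∀ x ∈ disk (n + 1), 0 < (frameMatrix map frame x).det
  knot_mem : ∀ x ∈ sph (n + 1), knot x ∈ sph (n + 1 + q)
  knotFrame_tangent : ∀ x ∈ sph (n + 1), ∀ i, inner ℝ (knotFrame i x) (knot x) = 0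
  map_boundary : ∀ x ∈ sph (n + 1), map x = incl (n + 1 + q) (n + 1 + N) (knot x)
  /-- On the boundary the framing of `α` is the suspension of the framing of `f`. -/
  frame_boundary : ∀ x ∈ sph (n + 1), ∀ i, frame i x = suspFrame (n + 1) q N knotFrame i x

/-- A concordance between two framed disked embeddings, in `D^(n+M+1) × [0,1]`: a framed embedding
`F` of `D^(n+1) × [0,1]` with framing `V`, whose restriction to `S^n × [0,1]` is the suspension of
`G` with framing `W` in `S^(n+q) × [0,1]`. -/
structure IsConcordance {n q N₀ N₁ M : ℕ} (A : FramedDisked n q N₀) (B : FramedDisked n q N₁)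
    (F : Eucl (n + 1) × ℝ → Eucl (n + 1 + M) × ℝ)
    (V : Fin M → Eucl (n + 1) × ℝ → Eucl (n + 1 + M) × ℝ)
    (G : Eucl (n + 1) × ℝ → Eucl (n + 1 + q) × ℝ)
    (W : Fin q → Eucl (n + 1) × ℝ → Eucl (n + 1 + q) × ℝ) : Prop where
  isFramedEmbedding : IsFramedEmbedding (cylinder (n + 1)) F V
  /-- Each face of `D^(n+1) × [0,1]` is the preimage of the corresponding face of the target. -/
  norm_lt : ∀ p ∈ cylinder (n + 1), ‖p.1‖ < 1 → ‖(F p).1‖ < 1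
  height_mem : ∀ p ∈ cylinder (n + 1), p.2 ∈ Set.Ioo (0 : ℝ) 1 → (F p).2 ∈ Set.Ioo (0 : ℝ) 1
  map_zero : ∀ x ∈ disk (n + 1), F (x, 0) = (incl (n + 1 + N₀) (n + 1 + M) (A.map x), 0)
  frame_zero : ∀ x ∈ disk (n + 1), ∀ i, V i (x, 0) = (suspFrame (n + 1) N₀ M A.frame i x, 0)
  map_one : ∀ x ∈ disk (n + 1), F (x, 1) = (incl (n + 1 + N₁) (n + 1 + M) (B.map x), 1)
  frame_one : ∀ x ∈ disk (n + 1), ∀ i, V i (x, 1) = (suspFrame (n + 1) N₁ M B.frame i x, 0)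
  side_mem : ∀ p ∈ sph (n + 1) ×ˢ Set.Icc (0 : ℝ) 1, G p ∈ sph (n + 1 + q) ×ˢ Set.Icc (0 : ℝ) 1
  side_tangent : ∀ p ∈ sph (n + 1) ×ˢ Set.Icc (0 : ℝ) 1, ∀ i, inner ℝ (W i p).1 (G p).1 = 0
  map_side : ∀ p ∈ sph (n + 1) ×ˢ Set.Icc (0 : ℝ) 1, F p = inclProd (n + 1 + q) (n + 1 + M) (G p)
  frame_side : ∀ p ∈ sph (n + 1) ×ˢ Set.Icc (0 : ℝ) 1, ∀ i,
    V i p = suspFrameProd (n + 1) q M W i p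

/-- Two framed disked embeddings are concordant if there is a concordance between them in
`D^(n+M+1) × [0,1]` for some `M ≥ max N₀ N₁`. -/
def Concordant {n q N₀ N₁ : ℕ} (A : FramedDisked n q N₀) (B : FramedDisked n q N₁) : Prop :=
  ∃ M : ℕ, max N₀ N₁ ≤ M ∧ ∃ F V G W, IsConcordance (M := M) A B F V G W

/-- `H`, with framing `V`, is a slice disk of `A` in `D^(n+M+2)`: a framed embedding of `D^(n+2)`
which is `A` on `∂₋`, and whose restriction to `∂₊` is the suspension of `G` with framing `W` in
the hemisphere `D^(n+q+1)_+` of `∂₊ D^(n+M+2)`. -/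
structure IsSliceDisk {n q N M : ℕ} (A : FramedDisked n q N)
    (H : Eucl (n + 1) × ℝ → Eucl (n + 1 + M) × ℝ)
    (V : Fin M → Eucl (n + 1) × ℝ → Eucl (n + 1 + M) × ℝ)
    (G : Eucl (n + 1) × ℝ → Eucl (n + 1 + q) × ℝ)
    (W : Fin q → Eucl (n + 1) × ℝ → Eucl (n + 1 + q) × ℝ) : Prop where
  isFramedEmbedding : IsFramedEmbedding (halfDisk (n + 1)) H V
  /-- Each face of `D^(n+2)` is the preimage of the corresponding face of the target. -/
  norm_lt : ∀ p ∈ halfDisk (n + 1), ‖p.1‖ ^ 2 + p.2 ^ 2 < 1 → ‖(H p).1‖ ^ 2 + (H p).2 ^ 2 < 1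
  height_pos : ∀ p ∈ halfDisk (n + 1), 0 < p.2 → 0 < (H p).2
  map_flat : ∀ x ∈ disk (n + 1), H (x, 0) = (incl (n + 1 + N) (n + 1 + M) (A.map x), 0)
  frame_flat : ∀ x ∈ disk (n + 1), ∀ i, V i (x, 0) = (suspFrame (n + 1) N M A.frame i x, 0)
  round_mem : ∀ p ∈ roundFace (n + 1), G p ∈ roundFace (n + 1 + q)
  round_tangent : ∀ p ∈ roundFace (n + 1), ∀ i,
    inner ℝ (W i p).1 (G p).1 + (W i p).2 * (G p).2 = 0
  map_round : ∀ p ∈ roundFace (n + 1), H p = inclProd (n + 1 + q) (n + 1 + M) (G p)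
  frame_round : ∀ p ∈ roundFace (n + 1), ∀ i, V i p = suspFrameProd (n + 1) q M W i p

/-- A framed disked embedding is slice if it has a slice disk in `D^(n+M+2)` for some `M ≥ N`. -/
def IsSlice {n q N : ℕ} (A : FramedDisked n q N) : Prop :=
  ∃ M : ℕ, N ≤ M ∧ ∃ H V G W, IsSliceDisk (M := M) A H V G W

theorem incl_apply (a b : ℕ) (y : Eucl a) (i : Fin b) :
    incl a b y i = if h : i.1 < a then y ⟨i.1, h⟩ else 0 := rfl

theorem norm_incl {a b : ℕ} (h : a ≤ b) (y : Eucl a) : ‖incl a b y‖ = ‖y‖ := by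
  obtain ⟨c, rfl⟩ := Nat.exists_eq_add_of_le h
  rw [EuclideanSpace.norm_eq, EuclideanSpace.norm_eq, Fin.sum_univ_add]
  simp [incl_apply]

theorem incl_incl {a b c : ℕ} (h : a ≤ b) (y : Eucl a) : incl b c (incl a b y) = incl a c y := by
  ext i
  simp only [incl_apply]
  split_ifs <;> first | rfl | omega

theorem incl_stdVec (m : ℕ) {q N : ℕ} (i : Fin N) (h : i.1 < q) :
    incl (m + q) (m + N) (stdVec m q ⟨i.1, h⟩) = stdVec m N i := by
  ext j
  have hi := i.2
  simp only [incl_apply, stdVec, PiLp.single_apply, Fin.ext_iff, Fin.val_natAdd]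
  split_ifs <;> first | rfl | omega

theorem uniqueDiffOn_disk (m : ℕ) : UniqueDiffOn ℝ (disk m) := by
  refine uniqueDiffOn_convex (convex_closedBall _ _) ⟨0, ?_⟩
  exact Metric.ball_subset_interior_closedBall (Metric.mem_ball_self one_pos)

theorem frameMatrix_incl (m N : ℕ) (x : Eucl m) (hx : x ∈ disk m) :
    frameMatrix (incl m (m + N)) (fun i _ => stdVec m N i) x = 1 := by
  ext i j
  rw [frameMatrix, (incl m (m + N)).fderivWithin (uniqueDiffOn_disk m x hx)]
  refine Fin.addCases (fun a => ?_) (fun b => ?_) j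
  · simp only [Matrix.of_apply, Fin.append_left, incl_apply, PiLp.single_apply,
      Matrix.one_apply, Fin.ext_iff, Fin.val_castAdd]
    have ha := a.2
    split_ifs <;> first | rfl | omega
  · simp only [Matrix.of_apply, Fin.append_right, stdVec, PiLp.single_apply,
      Matrix.one_apply]

theorem bijective_incl (m N : ℕ) : Function.Bijective
    (fun p : Eucl m × (Fin N → ℝ) => incl m (m + N) p.1 + ∑ i, p.2 i • stdVec m N i) := by
  have key : ∀ p : Eucl m × (Fin N → ℝ),
      (∀ a : Fin m, (incl m (m + N) p.1 + ∑ i, p.2 i • stdVec m N i) (Fin.castAdd N a) = p.1 a) ∧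
      ∀ b : Fin N, (incl m (m + N) p.1 + ∑ i, p.2 i • stdVec m N i) (Fin.natAdd m b) = p.2 b := by
    intro p
    refine ⟨fun a => ?_, fun b => ?_⟩
    · have ha := a.2
      have : ∀ i : Fin N, ¬ (a.1 = m + i.1) := fun i => by omega
      simp [incl_apply, stdVec, Fin.ext_iff, this]
    · simp [incl_apply, stdVec, Pi.single_apply]
  constructor
  · intro p p' h
    simp only at h
    refine Prod.ext ?_ ?_
    · ext a
      rw [← (key p).1 a, ← (key p').1 a, h]
    · funext b
      rw [← (key p).2 b, ← (key p').2 b, h]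
  · intro y
    refine ⟨(WithLp.toLp 2 fun a => y (Fin.castAdd N a), fun b => y (Fin.natAdd m b)), ?_⟩
    ext j
    refine Fin.addCases (fun a => ?_) (fun b => ?_) j
    · exact (key _).1 a
    · exact (key _).2 b

theorem isFramedEmbedding_incl (m N : ℕ) :
    IsFramedEmbedding (disk m) (incl m (m + N)) (fun i _ => stdVec m N i) where
  smooth := (incl m (m + N)).contDiff.contDiffOn
  injOn := by
    intro x _ y _ h
    have h0 : ‖incl m (m + N) (x - y)‖ = 0 := by rw [map_sub, h, sub_self, norm_zero]
    rw [norm_incl (Nat.le_add_right m N)] at h0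
    exact sub_eq_zero.1 (norm_eq_zero.1 h0)
  smooth_frame := fun _ => contDiffOn_const
  complement := by
    intro x hx
    rw [(incl m (m + N)).fderivWithin (uniqueDiffOn_disk m x hx)]
    exact bijective_incl m N

/-- The trivial framed disked embedding `(id, id) : (S^n, D^(n+1)) ⊂ (S^(n+q), D^(n+N+1))`: the
standard inclusions with the standard framings. -/
def trivialDisked (n q N : ℕ) : FramedDisked n q N where
  knot := incl (n + 1) (n + 1 + q)
  knotFrame := fun i _ => stdVec (n + 1) q i
  map := incl (n + 1) (n + 1 + N)
  frame := fun i _ => stdVec (n + 1) N i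
  isFramedEmbedding := isFramedEmbedding_incl (n + 1) N
  map_interior := fun x hx => by rwa [norm_incl (Nat.le_add_right _ _)]
  oriented := fun x hx => by rw [frameMatrix_incl _ _ x hx, Matrix.det_one]; exact one_pos
  knot_mem := fun x hx => by
    simpa [sph, norm_incl (Nat.le_add_right (n + 1) q)] using hx
  knotFrame_tangent := fun x _ i => by
    have h : ¬ (n + 1 + i.1 < n + 1) := by omega
    simp only [stdVec, EuclideanSpace.inner_single_left, incl_apply, Fin.val_natAdd, dif_neg h,
      mul_zero]
  map_boundary := fun x _ => (incl_incl (Nat.le_add_right _ _) x).symm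
  frame_boundary := fun x _ i => by
    by_cases h : i.1 < q
    · simp [suspFrame, h, incl_stdVec]
    · simp [suspFrame, h]

end DiskedEmbedding

end

/-! A concordance from the standard disk and a slice disk are one picture before and after
collapsing an end. The map sending `(y, s)` in `D^m × [0,1]` to `s • hemi y`, with `hemi` inverse
stereographic projection, collapses the bottom to the origin of the half disk, sends the top to the
round face, and the side to the flat face. So a concordance with the standard disk at the bottom
should blow down to a slice disk, and a slice disk should blow up at the origin to a concordance.
Both notions are brought into this position beforehand: `concordant_iff_revConc` turns the cylinder
upside down, and `isSlice_iff_swapSlice` exchanges the faces of the half disk by an inversion.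

Blowing down, the difficulty is smoothness at the origin. The concordance is conjugated with the
height change `s ↦ exp (1 - 1/s)`. A height function `s β` then becomes `s / (1 - s log β)`, which
is smooth again, and after two conjugations the concordance is the product of the standard disk with
the interval up to an error `exp (1 - 1/s)` times a smooth function (`RevConc.exists_flat`). In
polar coordinates such an error is smooth at the origin, since differentiation costs only powers of
`1/r` (`contDiffOn_flatCone`). This gives `RevConc.exists_swapSlice`.

Blowing up, `H (ρ • hemi x) = H 0 + ρ • K (x, ρ)` with `K` smooth, by Hadamard's lemma. The new
height is the radius in the target ball measured by its gauge around `H 0`, and the new position is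
a direction. At the bottom this shows the derivative of `H` at the origin, which need not be
standard. A path of invertible operators, depending on the radius, makes it standard at the bottom
and is trivial at the top. As invertible operators form two components, the path may have to end at
a reflection instead of the identity (`hasLinearPath_of_isUnit`, `exists_straightening`). The result
is a concordance from the standard disk to the given disk or to its mirror image
(`SliceOrigin.revConc`). A concordance from the standard disk preserves orientations
(`RevConc.det_pos`) and the given framing is oriented, so the mirror image is excluded
(`SwapSlice.exists_revConc`).

Framings are carried by the derivatives of these maps and rescaled by functions that undo the
conformal factors, so that the appended standard vectors remain exactly standard. -/

open scoped ContDiff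

noncomputable section

namespace DiskedEmbedding

open Set Filter Topology

/-! ### Parameter integrals, Hadamard's lemma, and framings under changes of coordinates -/

section Calculus

variable {E G : Type} [NormedAddCommGroup E] [NormedSpace ℝ E] [NormedAddCommGroup G]
  [NormedSpace ℝ G]

/-- Differentiation under the integral sign, up to the boundary of a compact convex set. -/
theorem hasFDerivWithinAt_integral_Icc {K : Set E} (hK : IsCompact K)
    (hc : Convex ℝ K) {h : ℝ × E → G} {h' : ℝ × E → E →L[ℝ] G}
    (hcont : ContinuousOn h (Icc (0 : ℝ) 1 ×ˢ K)) (hcont' : ContinuousOn h' (Icc (0 : ℝ) 1 ×ˢ K))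
    (hd : ∀ t ∈ Icc (0 : ℝ) 1, ∀ x ∈ K, HasFDerivWithinAt (fun y => h (t, y)) (h' (t, x)) K x)
    {x : E} (hx : x ∈ K) :
    HasFDerivWithinAt (fun y => ∫ t in (0 : ℝ)..1, h (t, y)) (∫ t in (0 : ℝ)..1, h' (t, x)) K x := by
  have hi : ∀ y ∈ K, IntervalIntegrable (fun t => h (t, y)) MeasureTheory.volume 0 1 := by
    intro y hy
    refine ContinuousOn.intervalIntegrable_of_Icc zero_le_one ?_
    exact hcont.comp (by fun_prop) (fun t ht => ⟨ht, hy⟩)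
  have hi' : IntervalIntegrable (fun t => h' (t, x)) MeasureTheory.volume 0 1 := by
    refine ContinuousOn.intervalIntegrable_of_Icc zero_le_one ?_
    exact hcont'.comp (by fun_prop) (fun t ht => ⟨ht, hx⟩)
  have huc := (isCompact_Icc.prod hK).uniformContinuousOn_of_continuous hcont'
  rw [Metric.uniformContinuousOn_iff_le] at huc
  refine HasFDerivWithinAt.of_isLittleO (Asymptotics.isLittleO_iff.2 fun ε hε => ?_)
  obtain ⟨δ, hδ, H⟩ := huc ε hε
  filter_upwards [self_mem_nhdsWithin, mem_nhdsWithin_of_mem_nhds (Metric.closedBall_mem_nhds x hδ)]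
    with y hy hyx
  -- Mean value inequality along the segment from `x` to `y`; uniform continuity of `h'` on the
  -- compact product lets one `δ` serve all `t`.
  have hb : ∀ t ∈ Icc (0 : ℝ) 1, ‖h (t, y) - h (t, x) - h' (t, x) (y - x)‖ ≤ ε * ‖y - x‖ := by
    intro t ht
    have hs : segment ℝ x y ⊆ K := hc.segment_subset hx hy
    refine (convex_segment x y).norm_image_sub_le_of_norm_hasFDerivWithin_le'
      (f' := fun z => h' (t, z)) (fun z hz => (hd t ht z (hs hz)).mono hs) (fun z hz => ?_)
      (left_mem_segment ℝ x y) (right_mem_segment ℝ x y)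
    rw [← dist_eq_norm]
    refine H (t, z) ⟨ht, hs hz⟩ (t, x) ⟨ht, hx⟩ ?_
    rw [Prod.dist_eq, dist_self]
    refine max_le hδ.le ?_
    have : z ∈ Metric.closedBall x δ :=
      (convex_closedBall x δ).segment_subset (Metric.mem_closedBall_self hδ.le) hyx hz
    exact this
  have h1 : (∫ t in (0 : ℝ)..1, h' (t, x)) (y - x) = ∫ t in (0 : ℝ)..1, h' (t, x) (y - x) :=
    ContinuousLinearMap.intervalIntegral_apply hi' _
  rw [h1, ← intervalIntegral.integral_sub (hi y hy) (hi x hx), ← intervalIntegral.integral_sub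
    ((hi y hy).sub (hi x hx))]
  · refine (intervalIntegral.norm_integral_le_of_norm_le_const (C := ε * ‖y - x‖)
      fun t ht => hb t ?_).trans (by simp)
    rw [uIoc_of_le zero_le_one] at ht
    exact ⟨ht.1.le, ht.2⟩
  · refine ContinuousOn.intervalIntegrable_of_Icc zero_le_one ?_
    have : ContinuousOn (fun t => h' (t, x)) (Icc (0 : ℝ) 1) :=
      hcont'.comp (by fun_prop) (fun t ht => ⟨ht, hx⟩)
    exact this.clm_apply continuousOn_const

/-- One derivative passes under the integral and leaves an integral of the same kind with values in
a space of operators, so the induction has to run over all target spaces at once. -/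
theorem contDiffOn_integral_Icc_nat {K : Set E} (hK : IsCompact K)
    (hc : Convex ℝ K) (hu : UniqueDiffOn ℝ K) (n : ℕ) :
    ∀ (G : Type) [NormedAddCommGroup G] [NormedSpace ℝ G] {h : ℝ × E → G}
      (_ : ContDiffOn ℝ ∞ h (Icc (0 : ℝ) 1 ×ˢ K)),
      ContDiffOn ℝ n (fun y => ∫ t in (0 : ℝ)..1, h (t, y)) K := by
  have huK : UniqueDiffOn ℝ (Icc (0 : ℝ) 1 ×ˢ K) := (uniqueDiffOn_Icc zero_lt_one).prod hu
  have key : ∀ (G : Type) [NormedAddCommGroup G] [NormedSpace ℝ G] {h : ℝ × E → G}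
      (_ : ContDiffOn ℝ ∞ h (Icc (0 : ℝ) 1 ×ˢ K)), ∃ h' : ℝ × E → E →L[ℝ] G,
      ContDiffOn ℝ ∞ h' (Icc (0 : ℝ) 1 ×ˢ K) ∧ ∀ x ∈ K,
      HasFDerivWithinAt (fun y => ∫ t in (0 : ℝ)..1, h (t, y)) (∫ t in (0 : ℝ)..1, h' (t, x)) K x := by
    intro G _ _ h hh
    have hsm : ContDiffOn ℝ ∞ (fun p => (fderivWithin ℝ h (Icc (0 : ℝ) 1 ×ˢ K) p).comp
        (ContinuousLinearMap.inr ℝ ℝ E)) (Icc (0 : ℝ) 1 ×ˢ K) :=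
      (hh.fderivWithin huK (by simp)).clm_comp contDiffOn_const
    refine ⟨_, hsm, fun x hx => hasFDerivWithinAt_integral_Icc hK hc hh.continuousOn
      hsm.continuousOn (fun t ht y hy => ?_) hx⟩
    have h1 := (hh.differentiableOn (by simp) (t, y) ⟨ht, hy⟩).hasFDerivWithinAt
    have h2 : HasFDerivWithinAt (fun y : E => (t, y)) (ContinuousLinearMap.inr ℝ ℝ E) K y :=
      (hasFDerivAt_prodMk_right t y).hasFDerivWithinAt
    exact h1.comp y h2 (fun z hz => ⟨ht, hz⟩)
  induction n with
  | zero =>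
    intro G _ _ h hh
    obtain ⟨h', -, hd⟩ := key G hh
    exact contDiffOn_zero.2 fun x hx => (hd x hx).continuousWithinAt
  | succ n ih =>
    intro G _ _ h hh
    obtain ⟨h', hs, hd⟩ := key G hh
    rw [Nat.cast_succ, contDiffOn_succ_iff_hasFDerivWithinAt_of_uniqueDiffOn hu]
    exact ⟨by simp, _, ih _ hs, hd⟩

theorem contDiffOn_integral_Icc {K : Set E} (hK : IsCompact K)
    (hc : Convex ℝ K) (hu : UniqueDiffOn ℝ K) {h : ℝ × E → G}
    (hh : ContDiffOn ℝ ∞ h (Icc (0 : ℝ) 1 ×ˢ K)) :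
    ContDiffOn ℝ ∞ (fun y => ∫ t in (0 : ℝ)..1, h (t, y)) K :=
  contDiffOn_infty.2 fun n => contDiffOn_integral_Icc_nat hK hc hu n G hh

/-- Hadamard's lemma on `D × [0,1]`: the difference quotient of a smooth function in the last
variable is smooth. -/
theorem exists_hadamard [CompleteSpace G] {D : Set E} (hD : IsCompact D) (hc : Convex ℝ D)
    (hu : UniqueDiffOn ℝ D) {f : E × ℝ → G} (hf : ContDiffOn ℝ ∞ f (D ×ˢ Icc (0 : ℝ) 1)) :
    ∃ g : E × ℝ → G, ContDiffOn ℝ ∞ g (D ×ˢ Icc (0 : ℝ) 1) ∧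
      (∀ x ∈ D, ∀ s ∈ Icc (0 : ℝ) 1, f (x, s) = f (x, 0) + s • g (x, s)) ∧
      ∀ x ∈ D, g (x, 0) = fderivWithin ℝ f (D ×ˢ Icc (0 : ℝ) 1) (x, 0) (0, 1) := by
  set K := D ×ˢ Icc (0 : ℝ) 1 with hKdef
  have huK : UniqueDiffOn ℝ K := hu.prod (uniqueDiffOn_Icc zero_lt_one)
  have hf' : ContDiffOn ℝ ∞ (fun p => fderivWithin ℝ f K p (0, 1)) K :=
    (hf.fderivWithin huK (by simp)).clm_apply contDiffOn_const
  have hmem : ∀ t ∈ Icc (0 : ℝ) 1, ∀ p ∈ K, (p.1, t * p.2) ∈ K := fun t ht p hp =>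
    ⟨hp.1, mul_nonneg ht.1 hp.2.1, mul_le_one₀ ht.2 hp.2.1 hp.2.2⟩
  -- The quotient is the average over `t` of the last partial derivative at `(x, t * s)`; the
  -- fundamental theorem of calculus along this segment identifies it.
  have hh : ContDiffOn ℝ ∞ (fun q : ℝ × (E × ℝ) => fderivWithin ℝ f K (q.2.1, q.1 * q.2.2) (0, 1))
      (Icc (0 : ℝ) 1 ×ˢ K) := by
    refine hf'.comp (t := K) (f := fun q : ℝ × (E × ℝ) => (q.2.1, q.1 * q.2.2)) ?_ ?_
    · exact ContDiff.contDiffOn (by fun_prop)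
    · exact fun q hq => hmem q.1 hq.1 q.2 hq.2
  refine ⟨_, contDiffOn_integral_Icc (hD.prod isCompact_Icc) (hc.prod (convex_Icc 0 1)) huK hh,
    fun x hx s hs => ?_, fun x hx => by simp⟩
  have hline : ∀ t ∈ Icc (0 : ℝ) 1, HasDerivWithinAt (fun t : ℝ => f (x, t * s))
      (s • fderivWithin ℝ f K (x, t * s) (0, 1)) (Icc 0 1) t := by
    intro t ht
    have h1 := (hf.differentiableOn (by simp) (x, t * s) (hmem t ht (x, s) ⟨hx, hs⟩)).hasFDerivWithinAt
    have h2 : HasDerivWithinAt (fun t : ℝ => ((x, t * s) : E × ℝ)) (0, s) (Icc 0 1) t := by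
      refine (hasDerivWithinAt_const _ _ _).prodMk ?_
      simpa using (hasDerivWithinAt_id t (Icc (0 : ℝ) 1)).mul_const s
    have h3 := h1.comp_hasDerivWithinAt t h2 (fun z hz => hmem z hz (x, s) ⟨hx, hs⟩)
    rw [← map_smul]
    simpa [Function.comp_def] using h3
  have hcont : ContinuousOn (fun t : ℝ => fderivWithin ℝ f K (x, t * s) (0, 1)) (Icc 0 1) :=
    hh.continuousOn.comp (f := fun t : ℝ => ((t, (x, s)) : ℝ × (E × ℝ))) (by fun_prop)
      (fun t ht => ⟨ht, hx, hs⟩)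
  have := intervalIntegral.integral_eq_sub_of_hasDeriv_right_of_le zero_le_one
    (f := fun t : ℝ => f (x, t * s)) (f' := fun t => s • fderivWithin ℝ f K (x, t * s) (0, 1))
    (fun t ht => (hline t ht).continuousWithinAt)
    (fun t ht => ((hline t ⟨ht.1.le, ht.2.le⟩).hasDerivAt
      (Icc_mem_nhds ht.1 ht.2)).hasDerivWithinAt)
    ((hcont.const_smul s).intervalIntegrable_of_Icc zero_le_one)
  rw [intervalIntegral.integral_smul] at this
  simp only [one_mul, zero_mul] at this
  rw [this]
  abel

/-- A differentiable left inverse makes the derivative injective. -/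
theorem fderiv_injective_of_leftInverse {f : E → G} {g : G → E} {f' : E →L[ℝ] G} {x : E}
    (hf : HasFDerivAt f f' x) (hg : DifferentiableAt ℝ g (f x))
    (h : ∀ᶠ y in 𝓝 x, g (f y) = y) : Function.Injective f' := by
  have h1 := (hg.hasFDerivAt.comp x hf).unique ((hasFDerivAt_id x).congr_of_eventuallyEq h)
  refine Function.LeftInverse.injective (g := fderiv ℝ g (f x)) fun v => ?_
  exact congrArg (fun L : E →L[ℝ] E => L v) h1

theorem fderiv_bijective_of_leftInverse [FiniteDimensional ℝ E] {f : E → E} {g : E → E}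
    {f' : E →L[ℝ] E} {x : E} (hf : HasFDerivAt f f' x) (hg : DifferentiableAt ℝ g (f x))
    (h : ∀ᶠ y in 𝓝 x, g (f y) = y) : Function.Bijective f' := by
  have hi := fderiv_injective_of_leftInverse hf hg h
  exact ⟨hi, (LinearMap.injective_iff_surjective (f := (f' : E →ₗ[ℝ] E))).1 hi⟩

variable {E' : Type} [NormedAddCommGroup E'] [NormedSpace ℝ E']

/-- The factor `c` can be moved from the frame into the coefficients, which exhibits the map as a
composite of three bijections. -/
theorem bijective_frame_comp {k : ℕ} {g' : E →L[ℝ] E'} {v : Fin k → E'}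
    (h : Function.Bijective (fun p : E × (Fin k → ℝ) => g' p.1 + ∑ i, p.2 i • v i))
    {A : E' →L[ℝ] E'} (hA : Function.Bijective A) {B : E →L[ℝ] E} (hB : Function.Bijective B)
    {c : ℝ} (hc : c ≠ 0) :
    Function.Bijective
      (fun p : E × (Fin k → ℝ) => (A.comp (g'.comp B)) p.1 + ∑ i, p.2 i • (c • A (v i))) := by
  have hs : Function.Bijective (fun p : E × (Fin k → ℝ) => ((B p.1, c • p.2) : E × (Fin k → ℝ))) :=
    Function.Bijective.prodMap hB (MulAction.bijective (Units.mk0 c hc))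
  convert hA.comp (h.comp hs) using 1
  funext p
  simp [map_sum, smul_smul, mul_comm]

/-- The framing condition is preserved by a reparametrization of the source and a local
diffeomorphism of the target. -/
theorem bijective_frame_push {k : ℕ} {M M' : Set E} {g F : E → E'} {Φ : E → E} {Ψ : E' → E'}
    {Φ' : E →L[ℝ] E} {Ψ' : E' →L[ℝ] E'} {v w : Fin k → E'} {x : E} {c : ℝ}
    (hu : UniqueDiffWithinAt ℝ M' x) (hx : x ∈ M') (hΦ : HasFDerivAt Φ Φ' x)
    (hmaps : ∀ᶠ y in 𝓝[M'] x, Φ y ∈ M) (hg : DifferentiableWithinAt ℝ g M (Φ x))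
    (hΨ : HasFDerivAt Ψ Ψ' (g (Φ x))) (hF : ∀ᶠ y in 𝓝[M'] x, F y = Ψ (g (Φ y)))
    (hΦb : Function.Bijective Φ') (hΨb : Function.Bijective Ψ') (hc : c ≠ 0)
    (hw : ∀ i, w i = c • Ψ' (v i))
    (h : Function.Bijective
      (fun p : E × (Fin k → ℝ) => fderivWithin ℝ g M (Φ x) p.1 + ∑ i, p.2 i • v i)) :
    Function.Bijective
      (fun p : E × (Fin k → ℝ) => fderivWithin ℝ F M' x p.1 + ∑ i, p.2 i • w i) := by
  have h1 : HasFDerivWithinAt (g ∘ Φ) ((fderivWithin ℝ g M (Φ x)).comp Φ') M' x :=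
    hg.hasFDerivWithinAt.comp_of_tendsto x hΦ.hasFDerivWithinAt
      (tendsto_nhdsWithin_iff.2 ⟨hΦ.continuousAt.continuousWithinAt, hmaps⟩)
  have h2 : HasFDerivWithinAt F (Ψ'.comp ((fderivWithin ℝ g M (Φ x)).comp Φ')) M' x :=
    (HasFDerivAt.comp_hasFDerivWithinAt x hΨ h1).congr_of_eventuallyEq hF (hF.self_of_nhdsWithin hx)
  rw [h2.fderivWithin hu]
  simp only [hw]
  exact bijective_frame_comp h hΨb hΦb hc

end Calculus

/-! ### Convexity and unique differentiability of the model domains -/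

section Sets

variable {m : ℕ}

theorem convex_disk : Convex ℝ (disk m) := convex_closedBall _ _

theorem isCompact_disk : IsCompact (disk m) := isCompact_closedBall _ _

theorem mem_disk {x : Eucl m} : x ∈ disk m ↔ ‖x‖ ≤ 1 := by simp [disk]

theorem mem_sph {x : Eucl m} : x ∈ sph m ↔ ‖x‖ = 1 := by simp [sph]

theorem sph_subset_disk : sph m ⊆ disk m := Metric.sphere_subset_closedBall

theorem uniqueDiffOn_cylinder : UniqueDiffOn ℝ (cylinder m) :=
  (uniqueDiffOn_disk m).prod (uniqueDiffOn_Icc zero_lt_one)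

theorem isCompact_cylinder : IsCompact (cylinder m) := isCompact_disk.prod isCompact_Icc

theorem convex_cylinder : Convex ℝ (cylinder m) := convex_disk.prod (convex_Icc 0 1)

theorem mem_cylinder {p : Eucl m × ℝ} : p ∈ cylinder m ↔ ‖p.1‖ ≤ 1 ∧ 0 ≤ p.2 ∧ p.2 ≤ 1 := by
  simp [cylinder, mem_disk]

theorem convex_halfDisk : Convex ℝ (halfDisk m) := by
  have h1 : ConvexOn ℝ univ (fun p : Eucl m × ℝ => ‖p.1‖ ^ 2 + p.2 ^ 2) := by
    refine ConvexOn.add ?_ ?_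
    · have : ConvexOn ℝ univ (fun y : Eucl m => ‖y‖ ^ 2) :=
        (convexOn_norm convex_univ).pow (fun _ _ => norm_nonneg _) 2
      exact this.comp_linearMap (LinearMap.fst ℝ (Eucl m) ℝ)
    · have : ConvexOn ℝ univ (fun y : ℝ => y ^ 2) := even_two.convexOn_pow
      exact this.comp_linearMap (LinearMap.snd ℝ (Eucl m) ℝ)
  have h2 := h1.convex_le 1
  have h3 : Convex ℝ {p : Eucl m × ℝ | 0 ≤ p.2} :=
    (convex_Ici (0 : ℝ)).linear_preimage (LinearMap.snd ℝ (Eucl m) ℝ)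
  convert h2.inter h3 using 1
  ext p
  simp [halfDisk]

theorem uniqueDiffOn_halfDisk : UniqueDiffOn ℝ (halfDisk m) := by
  refine uniqueDiffOn_convex convex_halfDisk ⟨(0, 1 / 2), ?_⟩
  have ho : IsOpen {p : Eucl m × ℝ | ‖p.1‖ ^ 2 + p.2 ^ 2 < 1 ∧ 0 < p.2} := by
    rw [ofPred_and]
    exact (isOpen_lt (by fun_prop) (by fun_prop)).inter (isOpen_lt (by fun_prop) (by fun_prop))
  refine interior_maximal (fun p hp => ?_) ho ?_
  · exact ⟨hp.1.le, hp.2.le⟩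
  · norm_num

end Sets

/-! ### The framing condition at an end where the map is standard -/

section StandardEnd

variable {m M : ℕ}

/-- The operator is block triangular for the splitting into horizontal and vertical parts:
`bijective_incl` handles the horizontal block, and the vertical block is the nonzero number `(L (0,
1)).2`. -/
theorem bijective_frame_standard {L : Eucl m × ℝ →L[ℝ] Eucl (m + M) × ℝ}
    {v : Fin M → Eucl (m + M) × ℝ} (h1 : ∀ y, L (y, 0) = (incl m (m + M) y, 0))
    (h2 : (L (0, 1)).2 ≠ 0) (hv : ∀ i, v i = (stdVec m M i, 0)) :
    Function.Bijective
      (fun p : (Eucl m × ℝ) × (Fin M → ℝ) => L p.1 + ∑ i, p.2 i • v i) := by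
  obtain ⟨u, hu⟩ : ∃ u, L (0, 1) = u := ⟨_, rfl⟩
  rw [hu] at h2
  have hL : ∀ q : Eucl m × ℝ, L q = (incl m (m + M) q.1 + q.2 • (u).1, q.2 * (u).2) := by
    intro q
    have : q = (q.1, 0) + q.2 • (0, 1) := by apply Prod.ext <;> simp
    conv_lhs => rw [this, map_add, map_smul, h1, hu]
    exact Prod.ext rfl (zero_add _)
  have hsum : ∀ c : Fin M → ℝ, ∑ i, c i • v i = (∑ i, c i • stdVec m M i, 0) := by
    intro c
    refine Prod.ext ?_ ?_
    · rw [Prod.fst_sum]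
      exact Finset.sum_congr rfl fun i _ => by rw [hv]; rfl
    · rw [Prod.snd_sum]
      exact Finset.sum_eq_zero fun i _ => by rw [hv]; exact mul_zero _
  obtain ⟨hi, hs⟩ := bijective_incl m M
  constructor
  · rintro ⟨⟨y, s⟩, c⟩ ⟨⟨y', s'⟩, c'⟩ h
    replace h : L (y, s) + ∑ i, c i • v i = L (y', s') + ∑ i, c' i • v i := h
    rw [hL, hL, hsum, hsum, Prod.mk_add_mk, Prod.mk_add_mk, Prod.mk.injEq, add_zero, add_zero] at h
    obtain ⟨ha, hb⟩ := h
    have hss : s = s' := mul_right_cancel₀ h2 hb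
    subst hss
    have := @hi (y, c) (y', c') (by
      rw [add_right_comm, add_right_comm (incl m (m + M) y')] at ha
      exact add_right_cancel ha)
    rw [Prod.mk.injEq] at this
    rw [this.1, this.2]
  · rintro ⟨y, s⟩
    obtain ⟨⟨y0, c⟩, h0⟩ := hs (y - (s / (u).2) • (u).1)
    refine ⟨((y0, s / (u).2), c), ?_⟩
    change L (y0, s / (u).2) + ∑ i, c i • v i = (y, s)
    rw [hL, hsum, Prod.mk_add_mk, Prod.mk.injEq, add_zero]
    refine ⟨?_, div_mul_cancel₀ _ h2⟩
    rw [add_right_comm]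
    exact (congrArg (· + _) h0).trans (sub_add_cancel _ _)

/-- The derivative along the end `D × 0` of a map which is standard there. -/
theorem fderivWithin_end {a : Eucl m → Eucl (m + M)} {F : Eucl m × ℝ → Eucl (m + M) × ℝ} {r s : ℝ}
    (hr : r ∈ Icc (0 : ℝ) 1)
    (hF : DifferentiableOn ℝ F (cylinder m)) (h0 : ∀ x ∈ disk m, F (x, r) = (a x, s))
    (ha : DifferentiableOn ℝ a (disk m)) {x : Eucl m} (hx : x ∈ disk m) (y : Eucl m) :
    fderivWithin ℝ F (cylinder m) (x, r) (y, 0) = (fderivWithin ℝ a (disk m) x y, 0) := by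
  have h1 := (hF (x, r) ⟨hx, hr⟩).hasFDerivWithinAt
  have h2 : HasFDerivWithinAt (fun z : Eucl m => (z, r)) (ContinuousLinearMap.inl ℝ _ ℝ) (disk m) x :=
    (hasFDerivAt_prodMk_left x r).hasFDerivWithinAt
  have h3 := h1.comp x h2 (t := cylinder m) (fun z hz => mk_mem_prod hz hr)
  have h4 : HasFDerivWithinAt (fun z => (a z, s)) ((fderivWithin ℝ a (disk m) x).prod 0) (disk m) x :=
    (ha x hx).hasFDerivWithinAt.prodMk (hasFDerivWithinAt_const _ _ _)
  have h5 := (uniqueDiffOn_disk m x hx).eq (h3.congr (fun z hz => (h0 z hz).symm) (h0 x hx).symm) h4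
  simpa using congrArg (fun L : Eucl m →L[ℝ] Eucl (m + M) × ℝ => L y) h5

theorem fderivWithin_standard_end {F : Eucl m × ℝ → Eucl (m + M) × ℝ}
    (hF : DifferentiableOn ℝ F (cylinder m)) (h0 : ∀ x ∈ disk m, F (x, 0) = (incl m (m + M) x, 0))
    {x : Eucl m} (hx : x ∈ disk m) (y : Eucl m) :
    fderivWithin ℝ F (cylinder m) (x, 0) (y, 0) = (incl m (m + M) y, 0) := by
  rw [fderivWithin_end (a := incl m (m + M)) (left_mem_Icc.2 zero_le_one) hF h0
    (incl m (m + M)).differentiableOn hx y,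
    (incl m (m + M)).fderivWithin (uniqueDiffOn_disk m x hx)]

end StandardEnd

/-! ### Stereographic projection and the inversion exchanging the two faces -/

section Maps

variable {m : ℕ}

/-- The Euclidean norm on `ℝ^m × ℝ`. -/
def nrm (z : Eucl m × ℝ) : ℝ := √(‖z.1‖ ^ 2 + z.2 ^ 2)

/-- The Euclidean inner product on `ℝ^m × ℝ`. -/
def ip (z w : Eucl m × ℝ) : ℝ := inner ℝ z.1 w.1 + z.2 * w.2

/-- Inverse stereographic projection, a diffeomorphism from the disk to the upper hemisphere. -/
def hemi (y : Eucl m) : Eucl m × ℝ :=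
  ((2 / (1 + ‖y‖ ^ 2)) • y, (1 - ‖y‖ ^ 2) / (1 + ‖y‖ ^ 2))

/-- Stereographic projection of the direction of a vector. -/
def dir (z : Eucl m × ℝ) : Eucl m := (nrm z + z.2)⁻¹ • z.1

/-- The squared distance to the south pole. -/
def poleDist (z : Eucl m × ℝ) : ℝ := ‖z.1‖ ^ 2 + (1 + z.2) ^ 2

/-- The inversion which exchanges the two faces of the half disk. -/
def swap (z : Eucl m × ℝ) : Eucl m × ℝ :=
  ((2 / poleDist z) • z.1, (1 - ‖z.1‖ ^ 2 - z.2 ^ 2) / poleDist z)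

theorem nrm_sq (z : Eucl m × ℝ) : nrm z ^ 2 = ‖z.1‖ ^ 2 + z.2 ^ 2 := Real.sq_sqrt (by positivity)

theorem nrm_nonneg (z : Eucl m × ℝ) : 0 ≤ nrm z := Real.sqrt_nonneg _

theorem norm_le_nrm (z : Eucl m × ℝ) : ‖z.1‖ ≤ nrm z := by
  apply Real.le_sqrt_of_sq_le
  nlinarith

theorem abs_le_nrm (z : Eucl m × ℝ) : |z.2| ≤ nrm z := by
  apply Real.le_sqrt_of_sq_le
  rw [sq_abs]
  nlinarith [norm_nonneg z.1]

theorem nrm_eq_zero {z : Eucl m × ℝ} : nrm z = 0 ↔ z = 0 := by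
  constructor
  · intro h
    have h1 := norm_le_nrm z
    have h2 := abs_le_nrm z
    rw [h] at h1 h2
    exact Prod.ext (norm_le_zero_iff.1 h1) (abs_nonpos_iff.1 h2)
  · rintro rfl
    simp [nrm]

theorem nrm_pos {z : Eucl m × ℝ} : 0 < nrm z ↔ z ≠ 0 := by
  rw [(nrm_nonneg z).lt_iff_ne, ne_comm, Ne, nrm_eq_zero]

theorem nrm_smul {c : ℝ} (hc : 0 ≤ c) (z : Eucl m × ℝ) : nrm (c • z) = c * nrm z := by
  unfold nrm
  rw [Prod.smul_fst, Prod.smul_snd, norm_smul, smul_eq_mul, mul_pow, mul_pow,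
    Real.norm_of_nonneg hc, ← mul_add, Real.sqrt_mul (sq_nonneg c), Real.sqrt_sq hc]

theorem mem_halfDisk {z : Eucl m × ℝ} : z ∈ halfDisk m ↔ nrm z ≤ 1 ∧ 0 ≤ z.2 := by
  rw [← sq_le_one_iff₀ (nrm_nonneg z), nrm_sq]
  rfl

theorem nrm_hemi (y : Eucl m) : nrm (hemi y) = 1 := by
  rw [← sq_eq_sq₀ (nrm_nonneg _) zero_le_one, nrm_sq]
  have : 1 + ‖y‖ ^ 2 ≠ 0 := by positivity
  simp only [hemi, norm_smul, mul_pow, Real.norm_eq_abs, sq_abs]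
  field_simp
  ring

theorem one_add_hemi_snd (y : Eucl m) : 1 + (hemi y).2 = 2 / (1 + ‖y‖ ^ 2) := by
  have : 1 + ‖y‖ ^ 2 ≠ 0 := by positivity
  simp only [hemi]
  field_simp
  ring

theorem hemi_ne_zero (y : Eucl m) : hemi y ≠ 0 := by
  rw [← nrm_pos, nrm_hemi]
  exact one_pos

theorem hemi_snd_pos {y : Eucl m} : 0 < (hemi y).2 ↔ ‖y‖ < 1 := by
  simp only [hemi]
  rw [div_pos_iff_of_pos_right (by positivity), sub_pos, sq_lt_one_iff₀ (norm_nonneg y)]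

theorem hemi_snd_eq_zero {y : Eucl m} : (hemi y).2 = 0 ↔ ‖y‖ = 1 := by
  have : 1 + ‖y‖ ^ 2 ≠ 0 := by positivity
  simp only [hemi]
  rw [div_eq_zero_iff, or_iff_left this, sub_eq_zero, eq_comm,
    pow_eq_one_iff_of_nonneg (norm_nonneg y) two_ne_zero]

theorem hemi_snd_nonneg {y : Eucl m} (h : ‖y‖ ≤ 1) : 0 ≤ (hemi y).2 := by
  rcases h.lt_or_eq with h | h
  · exact (hemi_snd_pos.2 h).le
  · exact (hemi_snd_eq_zero.2 h).ge

theorem contDiff_hemi : ContDiff ℝ ∞ (hemi (m := m)) := by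
  have h : ∀ y : Eucl m, 1 + ‖y‖ ^ 2 ≠ 0 := fun y => by positivity
  unfold hemi
  have h2 : ContDiff ℝ ∞ (fun y : Eucl m => ‖y‖ ^ 2) := contDiff_norm_sq ℝ
  refine ContDiff.prodMk ?_ ?_
  · exact (contDiff_const.div (contDiff_const.add h2) h).smul contDiff_id
  · exact (contDiff_const.sub h2).div (contDiff_const.add h2) h

theorem contDiffAt_nrm {z : Eucl m × ℝ} (hz : z ≠ 0) : ContDiffAt ℝ ∞ (nrm (m := m)) z := by
  unfold nrm
  have h2 : ContDiff ℝ ∞ (fun y : Eucl m => ‖y‖ ^ 2) := contDiff_norm_sq ℝ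
  refine ContDiffAt.sqrt ?_ ?_
  · exact ((h2.comp contDiff_fst).add (contDiff_snd.pow 2)).contDiffAt
  · rw [← nrm_sq]
    exact pow_ne_zero 2 (nrm_pos.2 hz).ne'

theorem continuous_nrm : Continuous (nrm (m := m)) := by
  unfold nrm
  fun_prop

theorem contDiffAt_dir {z : Eucl m × ℝ} (hz : 0 < nrm z + z.2) :
    ContDiffAt ℝ ∞ (dir (m := m)) z := by
  have h0 : z ≠ 0 := by
    rintro rfl
    simp [nrm] at hz
  unfold dir
  exact (((contDiffAt_nrm h0).add contDiffAt_snd).inv hz.ne').smul contDiffAt_fst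

theorem nrm_add_snd_pos {z : Eucl m × ℝ} (hz : z ≠ 0) (h : 0 ≤ z.2) : 0 < nrm z + z.2 :=
  add_pos_of_pos_of_nonneg (nrm_pos.2 hz) h

theorem nrm_add_snd_hemi_pos (y : Eucl m) : 0 < nrm (hemi y) + (hemi y).2 := by
  rw [nrm_hemi, one_add_hemi_snd]
  positivity

theorem dir_hemi (y : Eucl m) : dir (hemi y) = y := by
  unfold dir
  rw [nrm_hemi, one_add_hemi_snd]
  have : (1 + ‖y‖ ^ 2) ≠ 0 := by positivity
  simp only [hemi, smul_smul]
  rw [inv_mul_cancel₀ (by positivity), one_smul]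

theorem dir_smul {c : ℝ} (hc : 0 < c) (z : Eucl m × ℝ) : dir (c • z) = dir z := by
  unfold dir
  rw [nrm_smul hc.le, Prod.smul_fst, Prod.smul_snd, smul_eq_mul, ← mul_add, smul_smul, mul_inv,
    mul_comm c⁻¹, mul_assoc, inv_mul_cancel₀ hc.ne', mul_one]

theorem norm_dir_sq {z : Eucl m × ℝ} (hz : 0 < nrm z + z.2) :
    ‖dir z‖ ^ 2 = (nrm z - z.2) / (nrm z + z.2) := by
  have h : ‖z.1‖ ^ 2 = (nrm z - z.2) * (nrm z + z.2) := by
    have := nrm_sq z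
    linarith
  unfold dir
  rw [norm_smul, mul_pow, h, norm_inv, Real.norm_of_nonneg hz.le]
  field_simp

theorem hemi_dir {z : Eucl m × ℝ} (hz : 0 < nrm z + z.2) : hemi (dir z) = (nrm z)⁻¹ • z := by
  have h0 : 0 < nrm z := by
    refine nrm_pos.2 ?_
    rintro rfl
    simp [nrm] at hz
  have h1 : 1 + ‖dir z‖ ^ 2 = 2 * nrm z / (nrm z + z.2) := by
    rw [norm_dir_sq hz]
    field_simp
    ring
  have h2 : 1 - ‖dir z‖ ^ 2 = 2 * z.2 / (nrm z + z.2) := by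
    rw [norm_dir_sq hz]
    field_simp
    ring
  refine Prod.ext ?_ ?_
  · simp only [hemi, h1, Prod.smul_fst]
    rw [dir, smul_smul]
    congr 1
    field_simp
  · simp only [hemi, h1, h2, Prod.smul_snd, smul_eq_mul]
    field_simp

theorem norm_dir_lt_one {z : Eucl m × ℝ} (hz : 0 < z.2) : ‖dir z‖ < 1 := by
  have h : 0 < nrm z + z.2 := by linarith [nrm_nonneg z]
  rw [← sq_lt_one_iff₀ (norm_nonneg _), norm_dir_sq h, div_lt_one h]
  linarith

theorem norm_dir_eq_one {z : Eucl m × ℝ} (hz : z ≠ 0) (h0 : z.2 = 0) : ‖dir z‖ = 1 := by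
  have h : 0 < nrm z + z.2 := nrm_add_snd_pos hz h0.ge
  rw [← sq_eq_sq₀ (norm_nonneg _) zero_le_one, norm_dir_sq h, h0, sub_zero, add_zero,
    div_self (nrm_pos.2 hz).ne', one_pow]

theorem norm_dir_le_one {z : Eucl m × ℝ} (hz : z ≠ 0) (h0 : 0 ≤ z.2) : ‖dir z‖ ≤ 1 := by
  rcases h0.eq_or_lt with h | h
  · exact (norm_dir_eq_one hz h.symm).le
  · exact (norm_dir_lt_one h).le

theorem poleDist_pos {z : Eucl m × ℝ} (h : 0 ≤ z.2) : 0 < poleDist z := by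
  unfold poleDist
  positivity

theorem swap_snd {z : Eucl m × ℝ} : (swap z).2 = (1 - nrm z ^ 2) / poleDist z := by
  rw [nrm_sq, swap, sub_sub]

/-- `swap` is the inversion in the sphere of radius `√2` about the south pole `(0, -1)`, so the
squared distances of a point and its image from the pole have product 4. -/
theorem poleDist_swap {z : Eucl m × ℝ} (h : poleDist z ≠ 0) : poleDist (swap z) = 4 / poleDist z := by
  have h1 : 1 + (swap z).2 = 2 * (1 + z.2) / poleDist z := by
    simp only [swap]
    field_simp
    unfold poleDist
    ring
  rw [poleDist, h1]
  simp only [swap, norm_smul, mul_pow, Real.norm_eq_abs, sq_abs]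
  field_simp
  unfold poleDist
  ring

/-- Together with `swap_snd` this is the exchange of the faces: height zero corresponds to norm one
of the image, and norm one to height zero of the image. -/
theorem nrm_swap_sq {z : Eucl m × ℝ} (h : poleDist z ≠ 0) :
    nrm (swap z) ^ 2 = 1 - 4 * z.2 / poleDist z := by
  have h2 := poleDist_swap h
  have h3 : nrm (swap z) ^ 2 = poleDist (swap z) - 1 - 2 * (swap z).2 := by
    rw [nrm_sq, poleDist]; ring
  rw [h3, h2]
  simp only [swap]
  field_simp
  unfold poleDist
  ring

theorem swap_swap {z : Eucl m × ℝ} (h : poleDist z ≠ 0) : swap (swap z) = z := by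
  refine Prod.ext ?_ ?_
  · change (2 / poleDist (swap z)) • (2 / poleDist z) • z.1 = z.1
    rw [poleDist_swap h, smul_smul]
    convert one_smul ℝ z.1
    field_simp
    norm_num
  · rw [swap_snd, poleDist_swap h, nrm_swap_sq h]
    field_simp
    ring

theorem nrm_swap_lt_one {z : Eucl m × ℝ} (h : 0 < z.2) : nrm (swap z) < 1 := by
  have hp := poleDist_pos h.le
  rw [← sq_lt_one_iff₀ (nrm_nonneg _), nrm_swap_sq hp.ne']
  have : 0 < 4 * z.2 / poleDist z := by positivity
  linarith

theorem nrm_swap_eq_one {z : Eucl m × ℝ} (h : z.2 = 0) : nrm (swap z) = 1 := by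
  have hp := poleDist_pos h.ge
  rw [← sq_eq_sq₀ (nrm_nonneg _) zero_le_one, nrm_swap_sq hp.ne', h]
  simp

theorem swap_snd_pos {z : Eucl m × ℝ} (h : nrm z < 1) (h0 : 0 ≤ z.2) : 0 < (swap z).2 := by
  have hp := poleDist_pos h0
  rw [swap_snd]
  refine div_pos ?_ hp
  rw [sub_pos, sq_lt_one_iff₀ (nrm_nonneg _)]
  exact h

theorem swap_snd_eq_zero {z : Eucl m × ℝ} (h : nrm z = 1) : (swap z).2 = 0 := by
  rw [swap_snd, h]
  simp

theorem swap_mem_halfDisk {z : Eucl m × ℝ} (h : z ∈ halfDisk m) : swap z ∈ halfDisk m := by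
  rw [mem_halfDisk] at h ⊢
  constructor
  · rcases h.2.eq_or_lt with h2 | h2
    · exact (nrm_swap_eq_one h2.symm).le
    · exact (nrm_swap_lt_one h2).le
  · rcases h.1.eq_or_lt with h1 | h1
    · exact (swap_snd_eq_zero h1).ge
    · exact (swap_snd_pos h1 h.2).le

/-- This is what singles out the inversion: between the faces it restricts to the same `hemi` that
is used for the cone coordinates. -/
theorem swap_flat (y : Eucl m) : swap (y, 0) = hemi y := by
  simp [swap, hemi, poleDist, add_comm]

theorem poleDist_flat (y : Eucl m) : poleDist (y, 0) = 1 + ‖y‖ ^ 2 := by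
  simp [poleDist, add_comm]

theorem poleDist_hemi (y : Eucl m) : poleDist (hemi y) = 4 / (1 + ‖y‖ ^ 2) := by
  rw [← swap_flat, poleDist_swap (poleDist_pos le_rfl).ne', poleDist_flat]

theorem swap_hemi (y : Eucl m) : swap (hemi y) = (y, 0) := by
  rw [← swap_flat, swap_swap (poleDist_pos le_rfl).ne']

theorem contDiff_poleDist : ContDiff ℝ ∞ (poleDist (m := m)) := by
  have h2 : ContDiff ℝ ∞ (fun y : Eucl m => ‖y‖ ^ 2) := contDiff_norm_sq ℝ
  unfold poleDist
  exact (h2.comp contDiff_fst).add ((contDiff_const.add contDiff_snd).pow 2)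

theorem contDiffAt_swap {z : Eucl m × ℝ} (h : poleDist z ≠ 0) :
    ContDiffAt ℝ ∞ (swap (m := m)) z := by
  have h2 : ContDiff ℝ ∞ (fun y : Eucl m => ‖y‖ ^ 2) := contDiff_norm_sq ℝ
  unfold swap
  refine ContDiffAt.prodMk ?_ ?_
  · exact (contDiffAt_const.div contDiff_poleDist.contDiffAt h).smul contDiffAt_fst
  · exact (ContDiff.contDiffAt ((contDiff_const.sub (h2.comp contDiff_fst)).sub
      (contDiff_snd.pow 2))).div contDiff_poleDist.contDiffAt h

end Maps

/-! ### First derivatives of these maps in orthogonal and tangential directions -/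

section Derivatives

variable {E G : Type} [NormedAddCommGroup E] [NormedSpace ℝ E] [NormedAddCommGroup G]
  [NormedSpace ℝ G] {m : ℕ}

theorem fderiv_apply_eq_of_line {f : E → G} {z v : E} {w : G} (hf : DifferentiableAt ℝ f z)
    (h : HasDerivAt (fun t : ℝ => f (z + t • v)) w 0) : fderiv ℝ f z v = w := by
  have h1 : HasDerivAt (fun t : ℝ => z + t • v) v 0 := by
    simpa using ((hasDerivAt_id (0 : ℝ)).smul_const v).const_add z
  have h2 : HasFDerivAt f (fderiv ℝ f z) (z + (0 : ℝ) • v) := by simpa using hf.hasFDerivAt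
  exact (h2.comp_hasDerivAt 0 h1).unique h

theorem hasDerivAt_fst_comp {f : ℝ → E × G} {v : E × G} {t : ℝ} (h : HasDerivAt f v t) :
    HasDerivAt (fun s => (f s).1) v.1 t :=
  (hasFDerivAt_fst (𝕜 := ℝ) (p := f t)).comp_hasDerivAt t h

theorem hasDerivAt_snd_comp {f : ℝ → E × G} {v : E × G} {t : ℝ} (h : HasDerivAt f v t) :
    HasDerivAt (fun s => (f s).2) v.2 t :=
  (hasFDerivAt_snd (𝕜 := ℝ) (p := f t)).comp_hasDerivAt t h

theorem hasDerivAt_norm_sq_line {y e : Eucl m} (h : inner ℝ y e = 0) :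
    HasDerivAt (fun t : ℝ => ‖y + t • e‖ ^ 2) 0 0 := by
  have : (fun t : ℝ => ‖y + t • e‖ ^ 2) = fun t => ‖y‖ ^ 2 + t ^ 2 * ‖e‖ ^ 2 := by
    funext t
    rw [norm_add_sq_real, inner_smul_right, h, norm_smul, mul_pow, Real.norm_eq_abs, sq_abs]
    ring
  rw [this]
  simpa using (((hasDerivAt_id (0 : ℝ)).pow 2).mul_const (‖e‖ ^ 2)).const_add (‖y‖ ^ 2)

theorem hasDerivAt_line (y e : Eucl m) : HasDerivAt (fun t : ℝ => y + t • e) e 0 := by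
  simpa using ((hasDerivAt_id (0 : ℝ)).smul_const e).const_add y

/-- In a direction orthogonal to `y` the squared norm is stationary, so only the conformal factor
survives. The appended standard vectors are orthogonal to the suspended part, hence pass through
`hemi`, and likewise through `swap` and `dir`, up to a scalar. -/
theorem fderiv_hemi_orthogonal {y e : Eucl m} (h : inner ℝ y e = 0) :
    fderiv ℝ hemi y e = (2 / (1 + ‖y‖ ^ 2)) • (e, 0) := by
  have hne : 1 + ‖y + (0 : ℝ) • e‖ ^ 2 ≠ 0 := by positivity
  refine fderiv_apply_eq_of_line (contDiff_hemi.differentiable (by simp)).differentiableAt ?_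
  have h1 := hasDerivAt_norm_sq_line h
  have h2 := ((hasDerivAt_const (0 : ℝ) (2 : ℝ)).div (h1.const_add 1) hne).smul (hasDerivAt_line y e)
  have h3 := (h1.const_sub 1).div (h1.const_add 1) hne
  refine ((h2.prodMk h3).congr_deriv ?_).congr_of_eventuallyEq (Eventually.of_forall fun t => ?_)
  · refine Prod.ext ?_ ?_ <;> simp
  · rfl

theorem fderiv_swap_orthogonal {z : Eucl m × ℝ} {e : Eucl m} (hz : poleDist z ≠ 0)
    (h : inner ℝ z.1 e = 0) : fderiv ℝ swap z (e, 0) = (2 / poleDist z) • (e, 0) := by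
  refine fderiv_apply_eq_of_line ((contDiffAt_swap hz).differentiableAt (by simp)) ?_
  have h1 := hasDerivAt_norm_sq_line h
  have h0 : HasDerivAt (fun t : ℝ => poleDist (z + t • ((e, 0) : Eucl m × ℝ))) 0 0 := by
    simpa [poleDist] using h1.add_const ((1 + z.2) ^ 2)
  have hne : poleDist (z + (0 : ℝ) • ((e, 0) : Eucl m × ℝ)) ≠ 0 := by simpa using hz
  have h2 := ((hasDerivAt_const (0 : ℝ) (2 : ℝ)).div h0 hne).smul (hasDerivAt_line z.1 e)
  have h3 := ((h1.const_sub 1).sub_const (z.2 ^ 2)).div h0 hne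
  refine ((h2.prodMk h3).congr_deriv ?_).congr_of_eventuallyEq (Eventually.of_forall fun t => ?_)
  · refine Prod.ext ?_ ?_ <;> simp [← Prod.zero_eq_mk]
  · simp [swap]

theorem fderiv_dir_orthogonal {z : Eucl m × ℝ} {e : Eucl m} (hz : 0 < nrm z + z.2)
    (h : inner ℝ z.1 e = 0) : fderiv ℝ dir z (e, 0) = (nrm z + z.2)⁻¹ • e := by
  have hz0 : z ≠ 0 := by
    rintro rfl
    simp [nrm] at hz
  refine fderiv_apply_eq_of_line ((contDiffAt_dir hz).differentiableAt (by simp)) ?_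
  have h1 := hasDerivAt_norm_sq_line h
  have h0 : HasDerivAt (fun t : ℝ => nrm (z + t • ((e, 0) : Eucl m × ℝ))) 0 0 := by
    have := (h1.add_const (z.2 ^ 2)).sqrt (by
      rw [zero_smul, add_zero, ← nrm_sq]
      exact pow_ne_zero 2 (nrm_pos.2 hz0).ne')
    simpa [nrm] using this
  have h2 := ((h0.add_const z.2).inv (by simpa using hz.ne')).smul (hasDerivAt_line z.1 e)
  convert h2 using 1
  · funext t
    simp [dir]
  · simp [← Prod.zero_eq_mk]

/-- On the unit sphere, `swap` maps tangent vectors of the sphere to horizontal vectors. -/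
theorem fderiv_swap_snd_of_tangent {z v : Eucl m × ℝ} (hz : poleDist z ≠ 0) (h1 : nrm z = 1)
    (h : ip v z = 0) : (fderiv ℝ swap z v).2 = 0 := by
  have hP : DifferentiableAt ℝ (poleDist (m := m)) z :=
    (contDiff_poleDist.differentiable (by simp)).differentiableAt
  have hs := ((contDiffAt_swap hz).differentiableAt (by simp)).hasFDerivAt
  have hl : HasDerivAt (fun t : ℝ => z + t • v) v 0 := by
    simpa using ((hasDerivAt_id (0 : ℝ)).smul_const v).const_add z
  have hs' : HasFDerivAt swap (fderiv ℝ swap z) (z + (0 : ℝ) • v) := by simpa using hs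
  have h2 := hasDerivAt_snd_comp (hs'.comp_hasDerivAt 0 hl)
  have e1 : HasDerivAt (fun t : ℝ => ‖z.1 + t • v.1‖ ^ 2) (2 * inner ℝ z.1 v.1) 0 := by
    simpa using (hasDerivAt_line z.1 v.1).norm_sq
  have e2 : HasDerivAt (fun t : ℝ => (z.2 + t * v.2) ^ 2) (2 * (z.2 * v.2)) 0 := by
    have := (((hasDerivAt_id (0 : ℝ)).mul_const v.2).const_add z.2).pow 2
    simp only [id, one_mul, zero_mul, add_zero, Nat.cast_ofNat, Nat.add_one_sub_one, pow_one] at this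
    refine this.congr_deriv ?_
    ring
  have e3 : HasDerivAt (fun t : ℝ => poleDist (z + t • v)) (fderiv ℝ poleDist z v) 0 := by
    have hP' : HasFDerivAt poleDist (fderiv ℝ poleDist z) (z + (0 : ℝ) • v) := by
      simpa using hP.hasFDerivAt
    exact hP'.comp_hasDerivAt 0 hl
  have hne : poleDist (z + (0 : ℝ) • v) ≠ 0 := by simpa using hz
  have h3 := (((e1.const_sub 1).sub e2).div e3 hne)
  have h4 := h2.unique (h3.congr_of_eventuallyEq (Eventually.of_forall fun t => by
    simp [swap]))
  rw [h4]
  have h5 : ‖z.1‖ ^ 2 + z.2 ^ 2 = 1 := by rw [← nrm_sq, h1, one_pow]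
  rw [ip, real_inner_comm] at h
  have h6 : 1 - ‖z.1‖ ^ 2 - z.2 ^ 2 = 0 := by linarith
  have h7 : inner ℝ z.1 v.1 = - (z.2 * v.2) := by linarith
  simp only [zero_smul, add_zero, zero_mul, Pi.sub_apply, h6, h7]
  ring

/-- A curve on the unit sphere has tangent velocity; here in terms of the derivative of a map. -/
theorem ip_fderiv_eq_zero {f : E → Eucl m × ℝ} {x : E} {v : E} (hf : DifferentiableAt ℝ f x)
    (h : ∀ t : ℝ, nrm (f (x + t • v)) = 1) : ip (fderiv ℝ f x v) (f x) = 0 := by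
  have hl : HasDerivAt (fun t : ℝ => x + t • v) v 0 := by
    simpa using ((hasDerivAt_id (0 : ℝ)).smul_const v).const_add x
  have hf' : HasFDerivAt f (fderiv ℝ f x) (x + (0 : ℝ) • v) := by simpa using hf.hasFDerivAt
  have h1 := hf'.comp_hasDerivAt 0 hl
  have h2 := (hasDerivAt_fst_comp h1).norm_sq.add ((hasDerivAt_snd_comp h1).pow 2)
  have h3 : ((fun t : ℝ => ‖(f (x + t • v)).1‖ ^ 2) + (fun t : ℝ => (f (x + t • v)).2) ^ 2) =
      fun _ : ℝ => (1 : ℝ) := by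
    funext t
    simp only [Pi.add_apply, Pi.pow_apply]
    rw [← nrm_sq, h t, one_pow]
  have h4 := h2.unique (h3 ▸ hasDerivAt_const (0 : ℝ) (1 : ℝ))
  simp only [Function.comp_def, zero_smul, add_zero, Nat.cast_ofNat, Nat.add_one_sub_one,
    pow_one] at h4
  rw [ip, real_inner_comm]
  linarith

end Derivatives

/-! ### Locality of the framing condition -/

section Germ

variable {E E' : Type} [NormedAddCommGroup E] [NormedSpace ℝ E] [NormedAddCommGroup E']
  [NormedSpace ℝ E'] {k : ℕ}

/-- The framing condition at a point only depends on the germ there. -/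
theorem IsFramedEmbedding.complement_congr {K O : Set E} (hO : IsOpen O) {g F : E → E'}
    {v w : Fin k → E → E'} (h : IsFramedEmbedding (K ∩ O) g v) (hF : ∀ x ∈ K ∩ O, F x = g x)
    (hw : ∀ x ∈ K ∩ O, ∀ i, w i x = v i x) {x : E} (hx : x ∈ K ∩ O) : Function.Bijective
      (fun p : E × (Fin k → ℝ) => fderivWithin ℝ F K x p.1 + ∑ i, p.2 i • w i x) := by
  have h1 : fderivWithin ℝ F K x = fderivWithin ℝ g (K ∩ O) x := by
    rw [← fderivWithin_inter (hO.mem_nhds hx.2)]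
    exact fderivWithin_congr hF (hF x hx)
  rw [h1]
  simp only [hw x hx]
  exact h.complement x hx

end Germ

/-! ### Transport of framed embeddings -/

section Push

variable {E E' : Type} [NormedAddCommGroup E] [NormedSpace ℝ E] [NormedAddCommGroup E']
  [NormedSpace ℝ E'] [FiniteDimensional ℝ E] [FiniteDimensional ℝ E'] {k : ℕ}

/-- A framed embedding stays one under a reparametrization `Φ` of the source and a local
diffeomorphism `Ψ` of the target, both with smooth left inverses. -/
theorem IsFramedEmbedding.push {M M' : Set E} {g : E → E'} {v : Fin k → E → E'}
    (h : IsFramedEmbedding M g v) (hu : UniqueDiffOn ℝ M') {Φ Φi : E → E} {Ψ Ψi : E' → E'}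
    {c : E → ℝ} (hmaps : MapsTo Φ M' M) (hΦ : ∀ x ∈ M', ContDiffAt ℝ ∞ Φ x)
    (hΦi : ∀ x ∈ M', DifferentiableAt ℝ Φi (Φ x)) (hΦl : ∀ x ∈ M', ∀ᶠ y in 𝓝 x, Φi (Φ y) = y)
    (hΨ : ∀ x ∈ M', ContDiffAt ℝ ∞ Ψ (g (Φ x)))
    (hΨi : ∀ x ∈ M', DifferentiableAt ℝ Ψi (Ψ (g (Φ x))))
    (hΨl : ∀ x ∈ M', ∀ᶠ y in 𝓝 (g (Φ x)), Ψi (Ψ y) = y)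
    (hc : ContDiffOn ℝ ∞ c M') (hc0 : ∀ x ∈ M', c x ≠ 0) :
    IsFramedEmbedding M' (fun x => Ψ (g (Φ x)))
      (fun i x => c x • fderiv ℝ Ψ (g (Φ x)) (v i (Φ x))) where
  smooth := by
    intro x hx
    have h1 : ContDiffWithinAt ℝ ∞ (fun x => g (Φ x)) M' x :=
      (h.smooth (Φ x) (hmaps hx)).comp x (hΦ x hx).contDiffWithinAt hmaps
    exact (hΨ x hx).comp_contDiffWithinAt x h1
  injOn := by
    intro x hx y hy hxy
    have h1 := h.injOn (hmaps hx) (hmaps hy) (by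
      rw [← (hΨl x hx).self_of_nhds, ← (hΨl y hy).self_of_nhds]
      exact congrArg Ψi hxy)
    rw [← (hΦl x hx).self_of_nhds, ← (hΦl y hy).self_of_nhds, h1]
  smooth_frame := by
    intro i x hx
    have h1 : ContDiffWithinAt ℝ ∞ (fun x => g (Φ x)) M' x :=
      (h.smooth (Φ x) (hmaps hx)).comp x (hΦ x hx).contDiffWithinAt hmaps
    have h2 : ContDiffWithinAt ℝ ∞ (fun x => v i (Φ x)) M' x :=
      (h.smooth_frame i (Φ x) (hmaps hx)).comp x (hΦ x hx).contDiffWithinAt hmaps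
    have h3 : ContDiffAt ℝ ∞ (fderiv ℝ Ψ) (g (Φ x)) := (hΨ x hx).fderiv_right (by simp)
    exact (hc x hx).smul ((h3.comp_contDiffWithinAt x h1).clm_apply h2)
  complement := by
    intro x hx
    have hΦd := ((hΦ x hx).differentiableAt (by simp)).hasFDerivAt
    have hΨd := ((hΨ x hx).differentiableAt (by simp)).hasFDerivAt
    exact bijective_frame_push (hu x hx) hx hΦd (eventually_mem_nhdsWithin.mono fun y hy => hmaps hy)
      (h.smooth.differentiableOn (by simp) _ (hmaps hx)) hΨd (Eventually.of_forall fun _ => rfl)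
      (fderiv_bijective_of_leftInverse hΦd (hΦi x hx) (hΦl x hx))
      (fderiv_bijective_of_leftInverse hΨd (hΨi x hx) (hΨl x hx)) (hc0 x hx) (fun _ => rfl)
      (h.complement (Φ x) (hmaps hx))

end Push

/-! ### Coordinate subspaces and the vectors orthogonal to them -/

section Sub

/-- The subspace `ℝ^k` of `ℝ^b`, where the coordinates from the `k`-th on vanish. -/
def inclRange (k b : ℕ) : Submodule ℝ (Eucl b) where
  carrier := {y | ∀ j : Fin b, k ≤ j.1 → y j = 0}
  add_mem' := fun hx hy j hj => by simp [hx j hj, hy j hj]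
  zero_mem' := fun j hj => rfl
  smul_mem' := fun c x hx j hj => by simp [hx j hj]

variable {m q M k b : ℕ}

theorem incl_mem (y : Eucl k) : incl k b y ∈ inclRange k b := fun j hj => by
  rw [incl_apply, dif_neg (by omega)]

theorem incl_incl_of_mem {y : Eucl b} (hy : y ∈ inclRange k b) : incl k b (incl b k y) = y := by
  ext j
  rw [incl_apply]
  split_ifs with h
  · rw [incl_apply, dif_pos j.2]
  · exact (hy j (by omega)).symm

theorem inner_incl (h : k ≤ b) (x y : Eucl k) :
    inner ℝ (incl k b x) (incl k b y) = (inner ℝ x y : ℝ) :=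
  LinearIsometry.inner_map_map
    ({ toLinearMap := (incl k b).toLinearMap, norm_map' := norm_incl h } :
      Eucl k →ₗᵢ[ℝ] Eucl b) x y

theorem norm_incl_of_mem (h : k ≤ b) {y : Eucl b} (hy : y ∈ inclRange k b) :
    ‖incl b k y‖ = ‖y‖ := by
  rw [← norm_incl h, incl_incl_of_mem hy]

theorem inner_incl_of_mem (h : k ≤ b) {x y : Eucl b} (hx : x ∈ inclRange k b)
    (hy : y ∈ inclRange k b) : inner ℝ (incl b k x) (incl b k y) = (inner ℝ x y : ℝ) := by
  rw [← inner_incl h, incl_incl_of_mem hx, incl_incl_of_mem hy]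

theorem inner_stdVec {y : Eucl (m + M)} (hy : y ∈ inclRange (m + q) (m + M)) {i : Fin M}
    (hi : q ≤ i.1) : inner ℝ y (stdVec m M i) = 0 := by
  rw [stdVec, EuclideanSpace.inner_single_right, hy _ (by simpa using hi)]
  simp

theorem inner_incl_stdVec (y : Eucl m) (i : Fin M) :
    inner ℝ (incl m (m + M) y) (stdVec m M i) = 0 :=
  inner_stdVec (q := 0) (incl_mem y) (Nat.zero_le _)

theorem suspFrame_std {X : Type} (m : ℕ) {N M : ℕ} (i : Fin M) (x : X) :
    suspFrame m N M (fun i _ => stdVec m N i) i x = stdVec m M i := by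
  unfold suspFrame
  split_ifs with h
  · exact incl_stdVec m i h
  · rfl

/-- A map which stays in a subspace has derivatives in that subspace. -/
theorem fderiv_fst_mem {E : Type} [NormedAddCommGroup E] [NormedSpace ℝ E]
    {f : E → Eucl b × ℝ} {x v : E} (hf : DifferentiableAt ℝ f x)
    (h : ∀ t : ℝ, (f (x + t • v)).1 ∈ inclRange k b) : (fderiv ℝ f x v).1 ∈ inclRange k b := by
  intro j hj
  have hl : HasDerivAt (fun t : ℝ => x + t • v) v 0 := by
    simpa using ((hasDerivAt_id (0 : ℝ)).smul_const v).const_add x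
  have hf' : HasFDerivAt f (fderiv ℝ f x) (x + (0 : ℝ) • v) := by simpa using hf.hasFDerivAt
  have h1 := hasDerivAt_fst_comp (hf'.comp_hasDerivAt 0 hl)
  have h2 := ((EuclideanSpace.proj j : Eucl b →L[ℝ] ℝ).hasFDerivAt).comp_hasDerivAt 0 h1
  refine h2.unique ((hasDerivAt_const (0 : ℝ) (0 : ℝ)).congr_of_eventuallyEq
    (Eventually.of_forall fun t => ?_))
  exact h t j hj

end Sub

/-! ### Normal forms of concordances and slice disks -/

section Predicates

variable {m q M : ℕ}

/-- A concordance from the standard disk, at height `0`, to the disk `a` with framing `w`, at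
height `1`. -/
structure RevConc (m q M : ℕ) (a : Eucl m → Eucl (m + M)) (w : Fin M → Eucl m → Eucl (m + M))
    (F : Eucl m × ℝ → Eucl (m + M) × ℝ) (V : Fin M → Eucl m × ℝ → Eucl (m + M) × ℝ) : Prop where
  emb : IsFramedEmbedding (cylinder m) F V
  norm_lt : ∀ p ∈ cylinder m, ‖p.1‖ < 1 → ‖(F p).1‖ < 1
  height_mem : ∀ p ∈ cylinder m, p.2 ∈ Ioo (0 : ℝ) 1 → (F p).2 ∈ Ioo (0 : ℝ) 1
  map_zero : ∀ x ∈ disk m, F (x, 0) = (incl m (m + M) x, 0)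
  frame_zero : ∀ x ∈ disk m, ∀ i, V i (x, 0) = (stdVec m M i, 0)
  map_one : ∀ x ∈ disk m, F (x, 1) = (a x, 1)
  frame_one : ∀ x ∈ disk m, ∀ i, V i (x, 1) = (w i x, 0)
  side_norm : ∀ p ∈ cylinder m, ‖p.1‖ = 1 → ‖(F p).1‖ = 1
  side_mem : ∀ p ∈ cylinder m, ‖p.1‖ = 1 → (F p).1 ∈ inclRange (m + q) (m + M)
  side_tangent : ∀ p ∈ cylinder m, ‖p.1‖ = 1 → ∀ i, inner ℝ (V i p).1 (F p).1 = 0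
  side_frame_mem : ∀ p ∈ cylinder m, ‖p.1‖ = 1 → ∀ i : Fin M, i.1 < q →
    (V i p).1 ∈ inclRange (m + q) (m + M)
  side_frame_std : ∀ p ∈ cylinder m, ‖p.1‖ = 1 → ∀ i : Fin M, q ≤ i.1 → V i p = (stdVec m M i, 0)

/-- A slice disk in the half disk with its two faces exchanged: the disk `a` with framing `w` is
found on the round face, and the flat face is mapped to the suspended part of the flat face. -/
structure SwapSlice (m q M : ℕ) (a : Eucl m → Eucl (m + M)) (w : Fin M → Eucl m → Eucl (m + M))
    (H : Eucl m × ℝ → Eucl (m + M) × ℝ) (V : Fin M → Eucl m × ℝ → Eucl (m + M) × ℝ) : Prop where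
  emb : IsFramedEmbedding (halfDisk m) H V
  nrm_lt : ∀ z ∈ halfDisk m, nrm z < 1 → nrm (H z) < 1
  height_pos : ∀ z ∈ halfDisk m, 0 < z.2 → 0 < (H z).2
  map_round : ∀ x ∈ disk m, H (hemi x) = hemi (a x)
  frame_round : ∀ x ∈ disk m, ∀ i,
    V i (hemi x) = ((1 + ‖a x‖ ^ 2) / 2) • fderiv ℝ hemi (a x) (w i x)
  flat_height : ∀ z ∈ halfDisk m, z.2 = 0 → (H z).2 = 0
  flat_mem : ∀ z ∈ halfDisk m, z.2 = 0 → (H z).1 ∈ inclRange (m + q) (m + M)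
  flat_frame_height : ∀ z ∈ halfDisk m, z.2 = 0 → ∀ i, (V i z).2 = 0
  flat_frame_mem : ∀ z ∈ halfDisk m, z.2 = 0 → ∀ i : Fin M, i.1 < q →
    (V i z).1 ∈ inclRange (m + q) (m + M)
  flat_frame_std : ∀ z ∈ halfDisk m, z.2 = 0 → ∀ i : Fin M, q ≤ i.1 → V i z = (stdVec m M i, 0)

end Predicates

/-! ### Turning the cylinder upside down -/

section Flip

/-- The reflection `(y, s) ↦ (y, 1 - s)`. -/
def flip {m : ℕ} (p : Eucl m × ℝ) : Eucl m × ℝ := (p.1, 1 - p.2)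

variable {m M : ℕ}

theorem flip_flip (p : Eucl m × ℝ) : flip (flip p) = p := by simp [flip]

theorem contDiff_flip : ContDiff ℝ ∞ (flip (m := m)) := by
  unfold flip
  fun_prop

theorem fderiv_flip (p v : Eucl m × ℝ) : fderiv ℝ flip p v = (v.1, -v.2) := by
  have h : HasFDerivAt (flip (m := m)) ((ContinuousLinearMap.fst ℝ (Eucl m) ℝ).prod
      (-(ContinuousLinearMap.snd ℝ (Eucl m) ℝ))) p :=
    hasFDerivAt_fst.prodMk (hasFDerivAt_snd.const_sub 1)
  rw [h.fderiv]
  rfl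

theorem flip_mem_cylinder {p : Eucl m × ℝ} (hp : p ∈ cylinder m) : flip p ∈ cylinder m := by
  rw [mem_cylinder] at hp ⊢
  exact ⟨hp.1, by simp only [flip]; linarith, by simp only [flip]; linarith⟩

theorem IsFramedEmbedding.flip {F : Eucl m × ℝ → Eucl (m + M) × ℝ}
    {V : Fin M → Eucl m × ℝ → Eucl (m + M) × ℝ} (h : IsFramedEmbedding (cylinder m) F V) :
    IsFramedEmbedding (cylinder m) (fun p => flip (F (flip p)))
      (fun i p => ((V i (DiskedEmbedding.flip p)).1, -(V i (DiskedEmbedding.flip p)).2)) := by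
  have hd := fun (k : ℕ) (x : Eucl k × ℝ) => (contDiff_flip (m := k)).contDiffAt (x := x)
  have := h.push uniqueDiffOn_cylinder (Φ := DiskedEmbedding.flip) (Φi := DiskedEmbedding.flip)
    (Ψ := DiskedEmbedding.flip) (Ψi := DiskedEmbedding.flip)
    (c := fun _ => 1) (fun _ => flip_mem_cylinder) (fun x _ => hd _ x)
    (fun x _ => (hd _ _).differentiableAt (by simp)) (fun x _ => Eventually.of_forall flip_flip)
    (fun x _ => hd _ _) (fun x _ => (hd _ _).differentiableAt (by simp))
    (fun x _ => Eventually.of_forall flip_flip) contDiffOn_const (fun _ _ => one_ne_zero)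
  simpa only [one_smul, fderiv_flip] using this

variable {n q N : ℕ}

/-- Besides the reversal of heights, the auxiliary side data `G` and `W` are eliminated: being
suspended amounts to the vanishing of the last coordinates, and truncation by `incl` recovers the
data from their suspension. -/
theorem concordant_iff_revConc (hN : q ≤ N) (A : FramedDisked n q N) :
    Concordant A (trivialDisked n q N) ↔ ∃ M, N ≤ M ∧ ∃ F V,
      RevConc (n + 1) q M (fun x => incl (n + 1 + N) (n + 1 + M) (A.map x))
        (suspFrame (n + 1) N M A.frame) F V := by
  constructor
  · rintro ⟨M, hM, F, V, G, W, h⟩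
    rw [max_self] at hM
    have hqM : n + 1 + q ≤ n + 1 + M := by omega
    have hside : ∀ p ∈ cylinder (n + 1), ‖p.1‖ = 1 → flip p ∈ sph (n + 1) ×ˢ Icc (0 : ℝ) 1 :=
      fun p hp h1 => ⟨mem_sph.2 h1, (flip_mem_cylinder hp).2⟩
    refine ⟨M, hM, fun p => flip (F (flip p)), fun i p => ((V i (flip p)).1, -(V i (flip p)).2),
      h.isFramedEmbedding.flip, fun p hp h1 => h.norm_lt _ (flip_mem_cylinder hp) h1, ?_, ?_, ?_,
      ?_, ?_, ?_, ?_, ?_, ?_, ?_⟩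
    · intro p hp h1
      have := h.height_mem _ (flip_mem_cylinder hp) (by
        simp only [flip, mem_Ioo] at h1 ⊢
        constructor <;> linarith)
      simp only [flip, mem_Ioo] at this ⊢
      constructor <;> linarith
    · intro x hx
      simp [flip, h.map_one x hx, trivialDisked, incl_incl]
    · intro x hx i
      simp [flip, h.frame_one x hx, trivialDisked, suspFrame_std]
    · intro x hx
      simp [flip, h.map_zero x hx]
    · intro x hx i
      simp [flip, h.frame_zero x hx]
    · intro p hp h1
      have h2 := h.map_side _ (hside p hp h1)
      change ‖(F (flip p)).1‖ = 1
      rw [h2, inclProd, norm_incl hqM]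
      exact mem_sph.1 (h.side_mem _ (hside p hp h1)).1
    · intro p hp h1
      have h2 := h.map_side _ (hside p hp h1)
      change (F (flip p)).1 ∈ _
      rw [h2]
      exact incl_mem _
    · intro p hp h1 i
      have h2 := h.map_side _ (hside p hp h1)
      have h3 := h.frame_side _ (hside p hp h1) i
      change inner ℝ (V i (flip p)).1 (F (flip p)).1 = 0
      rw [h2, h3, suspFrameProd]
      split_ifs with hi
      · exact (inner_incl hqM _ _).trans (h.side_tangent _ (hside p hp h1) _)
      · rw [real_inner_comm]
        exact inner_stdVec (incl_mem _) (not_lt.1 hi)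
    · intro p hp h1 i hi
      have h3 := h.frame_side _ (hside p hp h1) i
      change (V i (flip p)).1 ∈ _
      rw [h3, suspFrameProd, dif_pos hi]
      exact incl_mem _
    · intro p hp h1 i hi
      have h3 := h.frame_side _ (hside p hp h1) i
      simp only [h3]
      rw [suspFrameProd, dif_neg (not_lt.2 hi), neg_zero]
  · rintro ⟨M, hM, F, V, h⟩
    have hqM : n + 1 + q ≤ n + 1 + M := by omega
    have hside : ∀ p ∈ sph (n + 1) ×ˢ Icc (0 : ℝ) 1, flip p ∈ cylinder (n + 1) ∧ ‖(flip p).1‖ = 1 :=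
      fun p hp => ⟨flip_mem_cylinder ⟨sph_subset_disk hp.1, hp.2⟩, mem_sph.1 hp.1⟩
    refine ⟨M, by rwa [max_self], fun p => flip (F (flip p)),
      fun i p => ((V i (flip p)).1, -(V i (flip p)).2),
      fun p => (incl _ _ (F (flip p)).1, 1 - (F (flip p)).2),
      -- Indices below `q` are below `M`, so the default value is never reached.
      fun i p => if hi : i.1 < M then
        (incl _ _ (V ⟨i.1, hi⟩ (flip p)).1, -(V ⟨i.1, hi⟩ (flip p)).2) else 0,
      h.emb.flip, fun p hp h1 => h.norm_lt _ (flip_mem_cylinder hp) h1, ?_, ?_, ?_,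
      ?_, ?_, ?_, ?_, ?_, ?_⟩
    · intro p hp h1
      have := h.height_mem _ (flip_mem_cylinder hp) (by
        simp only [flip, mem_Ioo] at h1 ⊢
        constructor <;> linarith)
      simp only [flip, mem_Ioo] at this ⊢
      constructor <;> linarith
    · intro x hx
      simp [flip, h.map_one x hx]
    · intro x hx i
      simp [flip, h.frame_one x hx]
    · intro x hx
      simp [flip, h.map_zero x hx, trivialDisked, incl_incl]
    · intro x hx i
      simp [flip, h.frame_zero x hx, trivialDisked, suspFrame_std]
    · intro p hp
      obtain ⟨h1, h2⟩ := hside p hp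
      refine ⟨mem_sph.2 ?_, ?_⟩
      · rw [norm_incl_of_mem hqM (h.side_mem _ h1 h2)]
        exact h.side_norm _ h1 h2
      -- `height_mem` speaks of interior heights only; at the two ends the height comes from the
      -- boundary values.
      · have h3 := h.height_mem _ h1
        rw [mem_cylinder] at h1
        rcases h1.2.1.eq_or_lt with h4 | h4
        · have h5 := h.map_zero _ (sph_subset_disk hp.1)
          have h6 : flip p = (p.1, 0) := Prod.ext rfl h4.symm
          simp [h6, h5]
        rcases h1.2.2.eq_or_lt with h5 | h5
        · have h7 := h.map_one _ (sph_subset_disk hp.1)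
          have h6 : flip p = (p.1, 1) := Prod.ext rfl h5
          simp [h6, h7]
        have := h3 ⟨h4, h5⟩
        simp only [mem_Ioo] at this
        simp only [mem_Icc]
        constructor <;> linarith
    · intro p hp i
      obtain ⟨h1, h2⟩ := hside p hp
      have hi : i.1 < M := by omega
      simp only [dif_pos hi]
      rw [inner_incl_of_mem hqM (h.side_frame_mem _ h1 h2 ⟨i.1, hi⟩ i.2) (h.side_mem _ h1 h2)]
      exact h.side_tangent _ h1 h2 _
    · intro p hp
      obtain ⟨h1, h2⟩ := hside p hp
      rw [inclProd, incl_incl_of_mem (h.side_mem _ h1 h2)]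
      rfl
    · intro p hp i
      obtain ⟨h1, h2⟩ := hside p hp
      rw [suspFrameProd]
      by_cases hi : i.1 < q
      · rw [dif_pos hi]
        simp only [dif_pos i.2]
        rw [inclProd, incl_incl_of_mem (h.side_frame_mem _ h1 h2 _ hi)]
      · rw [dif_neg hi, h.side_frame_std _ h1 h2 i (not_lt.1 hi), neg_zero]

end Flip

/-! ### Exchanging the faces of slice disks -/

section Swap

variable {m M q : ℕ}

/-- Away from the pole `swap` is an involution and serves as its own left inverse, in the source and
in the target. The framing is multiplied by `poleDist / 2`, the inverse of the conformal factor, so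
that horizontal vectors orthogonal to the position come out unchanged. -/
theorem IsFramedEmbedding.swap {H : Eucl m × ℝ → Eucl (m + M) × ℝ}
    {V : Fin M → Eucl m × ℝ → Eucl (m + M) × ℝ} (h : IsFramedEmbedding (halfDisk m) H V)
    (hH : ∀ z ∈ halfDisk m, 0 ≤ (H z).2) :
    IsFramedEmbedding (halfDisk m) (fun z => swap (H (swap z)))
      (fun i z => (poleDist (H (DiskedEmbedding.swap z)) / 2) •
        fderiv ℝ DiskedEmbedding.swap (H (DiskedEmbedding.swap z))
          (V i (DiskedEmbedding.swap z))) := by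
  have hev : ∀ (k : ℕ) (z : Eucl k × ℝ), 0 ≤ z.2 →
      ∀ᶠ y in 𝓝 z, DiskedEmbedding.swap (DiskedEmbedding.swap y) = y := fun k z hz =>
    (contDiff_poleDist.continuous.continuousAt.eventually_ne (poleDist_pos hz).ne').mono
      fun y hy => swap_swap hy
  have hsm : ∀ (k : ℕ) (z : Eucl k × ℝ), 0 ≤ z.2 → ContDiffAt ℝ ∞ DiskedEmbedding.swap z :=
    fun k z hz => contDiffAt_swap (poleDist_pos hz).ne'
  have hsw : ∀ (k : ℕ) (z : Eucl k × ℝ), 0 ≤ z.2 →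
      DifferentiableAt ℝ DiskedEmbedding.swap (DiskedEmbedding.swap z) := fun k z hz => by
    refine (contDiffAt_swap ?_).differentiableAt (by simp)
    rw [poleDist_swap (poleDist_pos hz).ne']
    exact div_ne_zero four_ne_zero (poleDist_pos hz).ne'
  have hm : MapsTo DiskedEmbedding.swap (halfDisk m) (halfDisk m) := fun _ => swap_mem_halfDisk
  refine h.push uniqueDiffOn_halfDisk (Φi := DiskedEmbedding.swap) (Ψi := DiskedEmbedding.swap)
    (c := fun z => poleDist (H (DiskedEmbedding.swap z)) / 2) hm
    (fun z hz => hsm _ _ hz.2) (fun z hz => hsw _ _ hz.2) (fun z hz => hev _ _ hz.2)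
    (fun z hz => hsm _ _ (hH _ (hm hz))) (fun z hz => hsw _ _ (hH _ (hm hz)))
    (fun z hz => hev _ _ (hH _ (hm hz))) ?_
    (fun z hz => div_ne_zero (poleDist_pos (hH _ (hm hz))).ne' two_ne_zero)
  have h1 : ContDiffOn ℝ ∞ (fun z => H (DiskedEmbedding.swap z)) (halfDisk m) :=
    h.smooth.comp (fun z hz => (hsm _ _ hz.2).contDiffWithinAt) hm
  exact (contDiff_poleDist.comp_contDiffOn h1).div_const 2

theorem swap_fst_mem {k b : ℕ} {z : Eucl b × ℝ} (hz : z.1 ∈ inclRange k b) :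
    (swap z).1 ∈ inclRange k b :=
  Submodule.smul_mem _ _ hz

theorem differentiableAt_swap {z : Eucl m × ℝ} (hz : 0 ≤ z.2) : DifferentiableAt ℝ swap z :=
  (contDiffAt_swap (poleDist_pos hz).ne').differentiableAt (by simp)

theorem fderiv_swap_fst_mem {k b : ℕ} {z v : Eucl b × ℝ} (hz : 0 ≤ z.2)
    (h1 : z.1 ∈ inclRange k b) (h2 : v.1 ∈ inclRange k b) :
    (fderiv ℝ swap z v).1 ∈ inclRange k b :=
  fderiv_fst_mem (differentiableAt_swap hz) fun _ =>
    swap_fst_mem (Submodule.add_mem _ h1 (Submodule.smul_mem _ _ h2))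

theorem scaled_fderiv_swap_orthogonal {z : Eucl m × ℝ} {e : Eucl m} (hz : 0 ≤ z.2)
    (h : inner ℝ z.1 e = 0) : (poleDist z / 2) • fderiv ℝ swap z (e, 0) = (e, 0) := by
  have hp := poleDist_pos hz
  rw [fderiv_swap_orthogonal hp.ne' h, smul_smul]
  convert one_smul ℝ _
  field_simp

theorem fderiv_swap_flat (y v : Eucl m) : fderiv ℝ swap (y, 0) (v, 0) = fderiv ℝ hemi y v := by
  have h1 : HasFDerivAt (fun y : Eucl m => swap (y, 0))
      ((fderiv ℝ swap (y, 0)).comp (ContinuousLinearMap.inl ℝ (Eucl m) ℝ)) y :=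
    HasFDerivAt.comp (f := fun y : Eucl m => (y, (0 : ℝ))) y
      (differentiableAt_swap le_rfl).hasFDerivAt (hasFDerivAt_prodMk_left y 0)
  have h2 : (fun y : Eucl m => swap (y, 0)) = hemi := funext swap_flat
  rw [h2] at h1
  rw [h1.fderiv]
  rfl

theorem fderiv_swap_hemi {y v : Eucl m} (hy : ‖y‖ ≤ 1) :
    fderiv ℝ swap (hemi y) (fderiv ℝ hemi y v) = (v, 0) := by
  have h1 : HasFDerivAt (fun y : Eucl m => swap (hemi y))
      ((fderiv ℝ swap (hemi y)).comp (fderiv ℝ hemi y)) y :=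
    HasFDerivAt.comp (f := hemi) y (differentiableAt_swap (hemi_snd_nonneg hy)).hasFDerivAt
      ((contDiff_hemi.differentiable (by simp)).differentiableAt (x := y)).hasFDerivAt
  have h2 : (fun y : Eucl m => swap (hemi y)) = fun y => (y, (0 : ℝ)) := funext swap_hemi
  rw [h2] at h1
  have h3 := h1.unique (hasFDerivAt_prodMk_left (𝕜 := ℝ) y (0 : ℝ))
  exact congrArg (fun L : Eucl m →L[ℝ] Eucl m × ℝ => L v) h3

theorem ip_fderiv_swap_eq_zero {z v : Eucl m × ℝ} (hz : z.2 = 0) (hv : v.2 = 0) :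
    ip (fderiv ℝ swap z v) (swap z) = 0 :=
  ip_fderiv_eq_zero (differentiableAt_swap hz.ge) fun _ =>
    nrm_swap_eq_one (by simp [hz, hv])

theorem eq_hemi_of_nrm_eq_one {z : Eucl m × ℝ} (hz : nrm z = 1) (h : 0 ≤ z.2) :
    ∃ x ∈ disk m, z = hemi x := by
  have h0 : z ≠ 0 := by
    rintro rfl
    simp [nrm] at hz
  refine ⟨dir z, mem_disk.2 (norm_dir_le_one h0 h), ?_⟩
  rw [hemi_dir (nrm_add_snd_pos h0 h), hz, inv_one, one_smul]

theorem nrm_inclProd {k b : ℕ} (h : k ≤ b) (z : Eucl k × ℝ) : nrm (inclProd k b z) = nrm z := by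
  rw [nrm, inclProd, norm_incl h]
  rfl

theorem mem_roundFace {p : Eucl m × ℝ} : p ∈ roundFace m ↔ nrm p = 1 ∧ 0 ≤ p.2 := by
  rw [← sq_eq_sq₀ (nrm_nonneg p) zero_le_one, nrm_sq, one_pow]
  rfl

variable {n N : ℕ}

theorem FramedDisked.map_mem (A : FramedDisked n q N) (hN : q ≤ N) {x : Eucl (n + 1)}
    (hx : x ∈ disk (n + 1)) : ‖A.map x‖ ≤ 1 := by
  rcases (mem_disk.1 hx).lt_or_eq with h | h
  · exact (A.map_interior x h).le
  · rw [A.map_boundary x (mem_sph.2 h), norm_incl (by omega)]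
    exact (mem_sph.1 (A.knot_mem x (mem_sph.2 h))).le

/-- Conjugation with `swap` moves the given disk from the flat to the round face, and the suspended
data from the hemisphere to the flat face. Membership in `inclRange` survives because `swap`
multiplies the horizontal part by a scalar, and tangency of the frame to the sphere corresponds to
the vanishing of its vertical component. -/
theorem isSlice_iff_swapSlice (hN : q ≤ N) (A : FramedDisked n q N) :
    IsSlice A ↔ ∃ M, N ≤ M ∧ ∃ H V,
      SwapSlice (n + 1) q M (fun x => incl (n + 1 + N) (n + 1 + M) (A.map x))
        (suspFrame (n + 1) N M A.frame) H V := by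
  constructor
  · rintro ⟨M, hM, H, V, G, W, h⟩
    have hqM : n + 1 + q ≤ n + 1 + M := by omega
    have hH : ∀ z ∈ halfDisk (n + 1), 0 ≤ (H z).2 := by
      intro z hz
      rcases hz.2.eq_or_lt with h0 | h0
      · have h1 : z = (z.1, 0) := Prod.ext rfl h0.symm
        rw [h1, h.map_flat]
        rw [mem_disk]
        exact (norm_le_nrm z).trans (mem_halfDisk.1 hz).1
      · exact (h.height_pos z hz h0).le
    have hround : ∀ z ∈ halfDisk (n + 1), z.2 = 0 → swap z ∈ roundFace (n + 1) := fun z hz h0 =>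
      mem_roundFace.2 ⟨nrm_swap_eq_one h0, (swap_mem_halfDisk hz).2⟩
    have hmem : ∀ z ∈ halfDisk (n + 1), z.2 = 0 →
        (H (swap z)).1 ∈ inclRange (n + 1 + q) (n + 1 + M) := fun z hz h0 => by
      rw [h.map_round _ (hround z hz h0)]
      exact incl_mem _
    refine ⟨M, hM, _, _, h.isFramedEmbedding.swap hH, ?_, ?_, ?_, ?_, ?_, ?_, ?_, ?_, ?_⟩
    · intro z hz h1
      exact nrm_swap_lt_one (h.height_pos _ (swap_mem_halfDisk hz) (swap_snd_pos h1 hz.2))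
    · intro z hz h0
      refine swap_snd_pos ?_ (hH _ (swap_mem_halfDisk hz))
      rw [← sq_lt_one_iff₀ (nrm_nonneg _), nrm_sq]
      refine h.norm_lt _ (swap_mem_halfDisk hz) ?_
      rw [← nrm_sq, sq_lt_one_iff₀ (nrm_nonneg _)]
      exact nrm_swap_lt_one h0
    · intro x hx
      simp only [swap_hemi, h.map_flat x hx, swap_flat]
    · intro x hx i
      simp only [swap_hemi, h.map_flat x hx, h.frame_flat x hx, fderiv_swap_flat, poleDist_flat]
    · intro z hz h0
      refine swap_snd_eq_zero ?_
      rw [h.map_round _ (hround z hz h0), nrm_inclProd hqM]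
      exact (mem_roundFace.1 (h.round_mem _ (hround z hz h0))).1
    · intro z hz h0
      exact swap_fst_mem (hmem z hz h0)
    · intro z hz h0 i
      have hr := hround z hz h0
      refine mul_eq_zero_of_right _ (fderiv_swap_snd_of_tangent
        (poleDist_pos (hH _ (swap_mem_halfDisk hz))).ne' ?_ ?_)
      · rw [h.map_round _ hr, nrm_inclProd hqM]
        exact (mem_roundFace.1 (h.round_mem _ hr)).1
      · rw [h.map_round _ hr, h.frame_round _ hr, suspFrameProd, ip]
        split_ifs with hi
        · simp only [inclProd, inner_incl hqM]
          exact h.round_tangent _ hr _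
        · simp only [zero_mul, add_zero]
          rw [real_inner_comm]
          exact inner_stdVec (incl_mem _) (not_lt.1 hi)
    · intro z hz h0 i hi
      refine Submodule.smul_mem _ _ (fderiv_swap_fst_mem (hH _ (swap_mem_halfDisk hz))
        (hmem z hz h0) ?_)
      rw [h.frame_round _ (hround z hz h0), suspFrameProd, dif_pos hi]
      exact incl_mem _
    · intro z hz h0 i hi
      simp only [h.frame_round _ (hround z hz h0)]
      rw [suspFrameProd, dif_neg (not_lt.2 hi)]
      exact scaled_fderiv_swap_orthogonal (hH _ (swap_mem_halfDisk hz))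
        (inner_stdVec (hmem z hz h0) hi)
  · rintro ⟨M, hM, H, V, h⟩
    have hqM : n + 1 + q ≤ n + 1 + M := by omega
    have hH : ∀ z ∈ halfDisk (n + 1), 0 ≤ (H z).2 := by
      intro z hz
      rcases hz.2.eq_or_lt with h0 | h0
      · exact (h.flat_height z hz h0.symm).ge
      · exact (h.height_pos z hz h0).le
    have hnrm : ∀ z ∈ halfDisk (n + 1), nrm (H z) ≤ 1 := by
      intro z hz
      rcases (mem_halfDisk.1 hz).1.lt_or_eq with h0 | h0
      · exact (h.nrm_lt z hz h0).le
      · obtain ⟨x, hx, rfl⟩ := eq_hemi_of_nrm_eq_one h0 hz.2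
        rw [h.map_round x hx, nrm_hemi]
    have hround : ∀ p ∈ roundFace (n + 1), p ∈ halfDisk (n + 1) ∧ swap p ∈ halfDisk (n + 1) ∧
        (swap p).2 = 0 := fun p hp => by
      rw [mem_roundFace] at hp
      have h1 : p ∈ halfDisk (n + 1) := mem_halfDisk.2 ⟨hp.1.le, hp.2⟩
      exact ⟨h1, swap_mem_halfDisk h1, swap_snd_eq_zero hp.1⟩
    have hW : ∀ p ∈ roundFace (n + 1), ∀ i : Fin M, i.1 < q →
        ((poleDist (H (swap p)) / 2) • fderiv ℝ swap (H (swap p)) (V i (swap p))).1 ∈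
          inclRange (n + 1 + q) (n + 1 + M) := fun p hp i hi => by
      obtain ⟨h1, h2, h3⟩ := hround p hp
      exact Submodule.smul_mem _ _ (fderiv_swap_fst_mem (hH _ h2) (h.flat_mem _ h2 h3)
        (h.flat_frame_mem _ h2 h3 i hi))
    have hG : ∀ p ∈ roundFace (n + 1), (swap (H (swap p))).1 ∈
        inclRange (n + 1 + q) (n + 1 + M) := fun p hp => by
      obtain ⟨h1, h2, h3⟩ := hround p hp
      exact swap_fst_mem (h.flat_mem _ h2 h3)
    refine ⟨M, hM, _, _, fun p => inclProd _ _ (swap (H (swap p))),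
      fun i p => if hi : i.1 < M then inclProd _ _ ((poleDist (H (swap p)) / 2) •
        fderiv ℝ swap (H (swap p)) (V ⟨i.1, hi⟩ (swap p))) else 0,
      h.emb.swap hH, ?_, ?_, ?_, ?_, ?_, ?_, ?_, ?_⟩
    · intro z hz h1
      rw [← nrm_sq, sq_lt_one_iff₀ (nrm_nonneg _)]
      rw [← nrm_sq, sq_lt_one_iff₀ (nrm_nonneg _)] at h1
      exact nrm_swap_lt_one (h.height_pos _ (swap_mem_halfDisk hz) (swap_snd_pos h1 hz.2))
    · intro z hz h0
      exact swap_snd_pos (h.nrm_lt _ (swap_mem_halfDisk hz) (nrm_swap_lt_one h0))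
        (hH _ (swap_mem_halfDisk hz))
    · intro x hx
      simp only [swap_flat, h.map_round x hx, swap_hemi]
    · intro x hx i
      simp only [swap_flat, h.map_round x hx, h.frame_round x hx, map_smul]
      rw [fderiv_swap_hemi, poleDist_hemi, smul_smul]
      -- Half of `poleDist` at `hemi y` is `2 / (1 + ‖y‖ ^ 2)`, the inverse of the factor in
      -- `frame_round`.
      · convert one_smul ℝ _
        have : 1 + ‖incl (n + 1 + N) (n + 1 + M) (A.map x)‖ ^ 2 ≠ 0 := by positivity
        field_simp
        norm_num
      · rw [norm_incl (by omega)]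
        exact A.map_mem hN hx
    · intro p hp
      obtain ⟨h1, h2, h3⟩ := hround p hp
      rw [mem_roundFace]
      constructor
      · rw [← nrm_inclProd hqM, inclProd, inclProd, incl_incl_of_mem (hG p hp)]
        exact nrm_swap_eq_one (h.flat_height _ h2 h3)
      · exact (swap_mem_halfDisk (mem_halfDisk.2 ⟨hnrm _ h2, hH _ h2⟩)).2
    · intro p hp i
      obtain ⟨h1, h2, h3⟩ := hround p hp
      have hi : i.1 < M := by omega
      simp only [dif_pos hi]
      simp only [inclProd]
      rw [inner_incl_of_mem hqM (hW p hp ⟨i.1, hi⟩ i.2) (hG p hp)]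
      have := ip_fderiv_swap_eq_zero (h.flat_height _ h2 h3) (h.flat_frame_height _ h2 h3 ⟨i.1, hi⟩)
      rw [ip] at this
      rw [Prod.smul_fst, Prod.smul_snd, inner_smul_left, smul_eq_mul, mul_assoc]
      exact (mul_add _ _ _).symm.trans (mul_eq_zero_of_right _ this)
    · intro p hp
      simp only [inclProd]
      rw [incl_incl_of_mem (hG p hp)]
    · intro p hp i
      obtain ⟨h1, h2, h3⟩ := hround p hp
      rw [suspFrameProd]
      by_cases hi : i.1 < q
      · rw [dif_pos hi]
        simp only [dif_pos i.2, inclProd]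
        rw [incl_incl_of_mem (hW p hp i hi)]
      · rw [dif_neg hi, h.flat_frame_std _ h2 h3 i (not_lt.1 hi)]
        exact scaled_fderiv_swap_orthogonal (hH _ h2)
          (inner_stdVec (h.flat_mem _ h2 h3) (not_lt.1 hi))

end Swap

/-! ### The flat height change and its inverse -/

section FlatExp

/-- The flat function `s ↦ exp (1 - 1 / s)`, extended by zero. -/
def flatExp (s : ℝ) : ℝ := Real.exp 1 * expNegInvGlue s

/-- The inverse of `flatExp`. -/
def unflat (u : ℝ) : ℝ := (1 - Real.log u)⁻¹

theorem flatExp_of_pos {s : ℝ} (hs : 0 < s) : flatExp s = Real.exp (1 - s⁻¹) := by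
  rw [flatExp, expNegInvGlue, if_neg (not_le.2 hs), ← Real.exp_add, sub_eq_add_neg]

theorem flatExp_zero : flatExp 0 = 0 := by simp [flatExp]

/-- The factor `Real.exp 1` in `flatExp` is the normalization that keeps the top of the cylinder in
place. -/
theorem flatExp_one : flatExp 1 = 1 := by simp [flatExp_of_pos]

theorem flatExp_pos {s : ℝ} (hs : 0 < s) : 0 < flatExp s := by
  rw [flatExp_of_pos hs]
  exact Real.exp_pos _

theorem flatExp_nonneg (s : ℝ) : 0 ≤ flatExp s :=
  mul_nonneg (Real.exp_pos 1).le (expNegInvGlue.nonneg s)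

theorem flatExp_lt_one {s : ℝ} (hs : 0 < s) (h1 : s < 1) : flatExp s < 1 := by
  rw [flatExp_of_pos hs, Real.exp_lt_one_iff, sub_neg]
  exact (one_lt_inv₀ hs).2 h1

theorem flatExp_mem {s : ℝ} (hs : s ∈ Icc (0 : ℝ) 1) : flatExp s ∈ Icc (0 : ℝ) 1 := by
  refine ⟨flatExp_nonneg s, ?_⟩
  rcases hs.1.eq_or_lt with h0 | h0
  · rw [← h0, flatExp_zero]
    exact zero_le_one
  rcases hs.2.eq_or_lt with h1 | h1
  · rw [h1, flatExp_one]
  · exact (flatExp_lt_one h0 h1).le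

theorem log_flatExp {s : ℝ} (hs : 0 < s) : Real.log (flatExp s) = 1 - s⁻¹ := by
  rw [flatExp_of_pos hs, Real.log_exp]

theorem unflat_flatExp {s : ℝ} (hs : 0 < s) : unflat (flatExp s) = s := by
  rw [unflat, log_flatExp hs, sub_sub_cancel, inv_inv]

theorem flatExp_unflat {u : ℝ} (hu : 0 < u) (h : 0 < 1 - Real.log u) : flatExp (unflat u) = u := by
  rw [unflat, flatExp_of_pos (inv_pos.2 h), inv_inv, sub_sub_cancel, Real.exp_log hu]

theorem contDiff_flatExp : ContDiff ℝ ∞ flatExp :=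
  contDiff_const.mul expNegInvGlue.contDiff

theorem hasDerivAt_flatExp {s : ℝ} (hs : 0 < s) : HasDerivAt flatExp (flatExp s * (s⁻¹) ^ 2) s := by
  have h1 : HasDerivAt (fun s : ℝ => Real.exp (1 - s⁻¹)) (Real.exp (1 - s⁻¹) * (- -(s ^ 2)⁻¹)) s :=
    ((hasDerivAt_inv hs.ne').const_sub 1).exp
  rw [← flatExp_of_pos hs] at h1
  rw [inv_pow, ← neg_neg ((s ^ 2)⁻¹)]
  exact h1.congr_of_eventuallyEq ((eventually_gt_nhds hs).mono fun t ht => flatExp_of_pos ht)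

theorem hasDerivAt_unflat {u : ℝ} (hu : u ≠ 0) (h : 1 - Real.log u ≠ 0) :
    HasDerivAt unflat (unflat u ^ 2 / u) u := by
  have := ((Real.hasDerivAt_log hu).const_sub 1).inv h
  refine this.congr_deriv ?_
  rw [unflat]
  field_simp

theorem contDiffAt_unflat {u : ℝ} (hu : u ≠ 0) (h : 1 - Real.log u ≠ 0) :
    ContDiffAt ℝ ∞ unflat u :=
  ContDiffAt.inv (contDiffAt_const.sub (Real.contDiffAt_log.2 hu)) h

end FlatExp

/-! ### The height of a concordance as a multiple of the height in the source -/

section Height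

variable {m M q : ℕ} {a : Eucl m → Eucl (m + M)} {w : Fin M → Eucl m → Eucl (m + M)}
  {F : Eucl m × ℝ → Eucl (m + M) × ℝ} {V : Fin M → Eucl m × ℝ → Eucl (m + M) × ℝ}

/-- The slope of the height along a vertical line, from the bottom, is `β (x, t)` itself, so
continuity of `β` is enough. -/
theorem fderivWithin_height {β : Eucl m × ℝ → ℝ} (hF : DifferentiableOn ℝ F (cylinder m))
    (hβ : ContinuousOn β (cylinder m)) (h : ∀ p ∈ cylinder m, (F p).2 = p.2 * β p) {x : Eucl m}
    (hx : x ∈ disk m) : (fderivWithin ℝ F (cylinder m) (x, 0) (0, 1)).2 = β (x, 0) := by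
  have hm : MapsTo (fun t : ℝ => (x, t)) (Icc 0 1) (cylinder m) := fun t ht => ⟨hx, ht⟩
  have h0 : (0 : ℝ) ∈ Icc (0 : ℝ) 1 := left_mem_Icc.2 zero_le_one
  have h1 : HasDerivWithinAt (fun t : ℝ => F (x, t))
      (fderivWithin ℝ F (cylinder m) (x, 0) (0, 1)) (Icc 0 1) 0 :=
    (hF (x, 0) (hm h0)).hasFDerivWithinAt.comp_hasDerivWithinAt (0 : ℝ)
      (f := fun t : ℝ => (x, t))
      ((hasDerivWithinAt_const _ _ _).prodMk (hasDerivWithinAt_id _ _)) hm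
  have h2 : HasDerivWithinAt (fun t : ℝ => (F (x, t)).2)
      (fderivWithin ℝ F (cylinder m) (x, 0) (0, 1)).2 (Icc 0 1) 0 :=
    have hs : HasFDerivAt (Prod.snd : Eucl (m + M) × ℝ → ℝ) (ContinuousLinearMap.snd ℝ _ ℝ)
        (F (x, 0)) := hasFDerivAt_snd
    HasFDerivAt.comp_hasDerivWithinAt (l := Prod.snd) (f := fun t : ℝ => F (x, t)) (0 : ℝ) hs h1
  have h3 : HasDerivWithinAt (fun t : ℝ => (F (x, t)).2) (β (x, 0)) (Icc 0 1) 0 := by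
    rw [hasDerivWithinAt_iff_tendsto_slope]
    have h4 : Tendsto (fun t : ℝ => β (x, t)) (𝓝[Icc 0 1 \ {0}] 0) (𝓝 (β (x, 0))) :=
      ((hβ.comp (f := fun t : ℝ => (x, t)) (by fun_prop) hm) 0 h0).mono_left
        (nhdsWithin_mono _ sdiff_subset)
    refine h4.congr' ?_
    filter_upwards [self_mem_nhdsWithin] with t ht
    have ht0 : t ≠ 0 := ht.2
    rw [slope_def_field, h _ (hm ht.1), h _ (hm h0)]
    simp only
    field_simp
    ring
  exact (uniqueDiffOn_Icc zero_lt_one 0 h0).eq_deriv _ h2 h3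

theorem RevConc.height_le_one (h : RevConc m q M a w F V) {p : Eucl m × ℝ} (hp : p ∈ cylinder m) :
    (F p).2 ≤ 1 := by
  rcases hp.2.1.eq_or_lt with h0 | h0
  · rw [show p = (p.1, 0) from Prod.ext rfl h0.symm, h.map_zero _ hp.1]
    exact zero_le_one
  rcases hp.2.2.eq_or_lt with h1 | h1
  · rw [show p = (p.1, 1) from Prod.ext rfl h1, h.map_one _ hp.1]
  · exact (h.height_mem p hp ⟨h0, h1⟩).2.le

theorem RevConc.height_pos (h : RevConc m q M a w F V) {p : Eucl m × ℝ} (hp : p ∈ cylinder m)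
    (h0 : 0 < p.2) : 0 < (F p).2 := by
  rcases hp.2.2.eq_or_lt with h1 | h1
  · rw [show p = (p.1, 1) from Prod.ext rfl h1, h.map_one _ hp.1]
    exact one_pos
  · exact (h.height_mem p hp ⟨h0, h1⟩).1

/-- Above the bottom this is positivity of the height. At the bottom a limit gives `0 ≤ β`, and
equality is impossible: the horizontal derivatives and the frame have no vertical component there,
so the complement condition forces the vertical derivative to have one. -/
theorem RevConc.factor_pos (h : RevConc m q M a w F V) {β : Eucl m × ℝ → ℝ}
    (hβ : ContinuousOn β (cylinder m)) (hF : ∀ p ∈ cylinder m, (F p).2 = p.2 * β p)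
    {p : Eucl m × ℝ} (hp : p ∈ cylinder m) : 0 < β p := by
  have hpos : ∀ p ∈ cylinder m, 0 < p.2 → 0 < β p := fun p hp h0 => by
    have := h.height_pos hp h0
    rw [hF p hp] at this
    exact pos_of_mul_pos_right this h0.le
  rcases hp.2.1.eq_or_lt with h0 | h0
  · obtain ⟨x, s⟩ := p
    obtain rfl : 0 = s := h0
    have hx : x ∈ disk m := hp.1
    have hd := fderivWithin_height (h.emb.smooth.differentiableOn (by simp)) hβ hF hx
    refine lt_of_le_of_ne ?_ (Ne.symm fun h1 => ?_)
    · have hm : MapsTo (fun t : ℝ => (x, t)) (Icc 0 1) (cylinder m) := fun t ht => ⟨hx, ht⟩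
      have h4 : Tendsto (fun t : ℝ => β (x, t)) (𝓝[Ioc 0 1] 0) (𝓝 (β (x, 0))) :=
        ((hβ.comp (f := fun t : ℝ => (x, t)) (by fun_prop) hm) 0
          (left_mem_Icc.2 zero_le_one)).mono_left (nhdsWithin_mono _ Ioc_subset_Icc_self)
      have : (𝓝[Ioc (0 : ℝ) 1] 0).NeBot := by
        rw [nhdsWithin_Ioc_eq_nhdsGT zero_lt_one]
        infer_instance
      refine ge_of_tendsto h4 ?_
      filter_upwards [self_mem_nhdsWithin] with t ht
      exact (hpos _ (hm ⟨ht.1.le, ht.2⟩) ht.1).le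
    · obtain ⟨⟨⟨y, s⟩, c⟩, hsurj⟩ := (h.emb.complement _ hp).2 (0, 1)
      have h2 : (fderivWithin ℝ F (cylinder m) (x, 0) (y, s)).2 = 0 := by
        have : ((y, s) : Eucl m × ℝ) = (y, 0) + s • (0, 1) := by apply Prod.ext <;> simp
        rw [this, map_add, map_smul, fderivWithin_standard_end
          (h.emb.smooth.differentiableOn (by simp)) h.map_zero hx, Prod.snd_add, Prod.smul_snd, hd, h1]
        simp
      have h3 : (∑ i, c i • V i (x, 0)).2 = 0 := by
        rw [Prod.snd_sum]
        exact Finset.sum_eq_zero fun i _ => by rw [h.frame_zero x hx]; exact mul_zero _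
      have h4 := congrArg Prod.snd hsurj
      simp only [Prod.snd_add, h2, h3] at h4
      norm_num at h4
  · exact hpos p hp h0

end Height

/-! ### Conjugating a concordance with the flat height change -/

section Compress

variable {m M q : ℕ} {a : Eucl m → Eucl (m + M)} {w : Fin M → Eucl m → Eucl (m + M)}
  {F : Eucl m × ℝ → Eucl (m + M) × ℝ} {V : Fin M → Eucl m × ℝ → Eucl (m + M) × ℝ}

/-- The height reparametrization of the cylinder by `flatExp`. -/
def squeeze (p : Eucl m × ℝ) : Eucl m × ℝ := (p.1, flatExp p.2)

/-- The inverse of `squeeze`. -/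
def unsqueeze (p : Eucl m × ℝ) : Eucl m × ℝ := (p.1, unflat p.2)

theorem squeeze_mem {p : Eucl m × ℝ} (hp : p ∈ cylinder m) : squeeze p ∈ cylinder m :=
  ⟨hp.1, flatExp_mem hp.2⟩

theorem contDiff_squeeze : ContDiff ℝ ∞ (squeeze (m := m)) :=
  contDiff_fst.prodMk (contDiff_flatExp.comp contDiff_snd)

theorem contDiffAt_unsqueeze {p : Eucl m × ℝ} (hu : p.2 ≠ 0) (h : 1 - Real.log p.2 ≠ 0) :
    ContDiffAt ℝ ∞ (unsqueeze (m := m)) p :=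
  contDiffAt_fst.prodMk ((contDiffAt_unflat hu h).comp p contDiffAt_snd)

theorem fderiv_unsqueeze {p : Eucl m × ℝ} (hu : p.2 ≠ 0) (h : 1 - Real.log p.2 ≠ 0)
    (v : Eucl m × ℝ) : fderiv ℝ unsqueeze p v = (v.1, v.2 * (unflat p.2 ^ 2 / p.2)) := by
  have h1 : HasFDerivAt (unsqueeze (m := m)) ((ContinuousLinearMap.fst ℝ (Eucl m) ℝ).prod
      ((unflat p.2 ^ 2 / p.2) • (ContinuousLinearMap.snd ℝ (Eucl m) ℝ))) p :=
    hasFDerivAt_fst.prodMk ((hasDerivAt_unflat hu h).comp_hasFDerivAt p hasFDerivAt_snd)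
  rw [h1.fderiv]
  simp [mul_comm]

theorem RevConc.log_height (h : RevConc m q M a w F V) {β : Eucl m × ℝ → ℝ}
    (hβ : ContinuousOn β (cylinder m)) (hF : ∀ p ∈ cylinder m, (F p).2 = p.2 * β p)
    {p : Eucl m × ℝ} (hp : p ∈ cylinder m) (h0 : 0 < p.2) :
    p.2 * Real.log (F (squeeze p)).2 = p.2 - 1 + p.2 * Real.log (β (squeeze p)) := by
  have h1 : (squeeze p).2 = flatExp p.2 := rfl
  rw [hF _ (squeeze_mem hp), Real.log_mul (h1 ▸ (flatExp_pos h0).ne')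
    (h.factor_pos hβ hF (squeeze_mem hp)).ne', h1, log_flatExp h0, mul_add, mul_sub,
    mul_inv_cancel₀ h0.ne', mul_one]

/-- For positive `p.2` the denominator is `p.2` minus `p.2` times the logarithm of the height at
`squeeze p`, and that logarithm is nonpositive because heights are at most one. -/
theorem RevConc.denom_pos (h : RevConc m q M a w F V) {β : Eucl m × ℝ → ℝ}
    (hβ : ContinuousOn β (cylinder m)) (hF : ∀ p ∈ cylinder m, (F p).2 = p.2 * β p)
    {p : Eucl m × ℝ} (hp : p ∈ cylinder m) : 0 < 1 - p.2 * Real.log (β (squeeze p)) := by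
  rcases hp.2.1.eq_or_lt with h0 | h0
  · rw [← h0]
    simp
  · have h1 := h.height_le_one (squeeze_mem hp)
    have h2 := h.height_pos (squeeze_mem hp) (flatExp_pos h0)
    have h3 := mul_nonpos_of_nonneg_of_nonpos h0.le (Real.log_nonpos h2.le h1)
    rw [h.log_height hβ hF hp h0] at h3
    linarith

/-- The height function of a concordance `F` with `(F p).2 = p.2 * β p`, conjugated with
`flatExp`. -/
def squeezeHeight (β : Eucl m × ℝ → ℝ) (p : Eucl m × ℝ) : ℝ :=
  p.2 / (1 - p.2 * Real.log (β (squeeze p)))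

/-- The conjugate of a concordance with `squeeze`. -/
def squeezeMap (F : Eucl m × ℝ → Eucl (m + M) × ℝ) (β : Eucl m × ℝ → ℝ) (p : Eucl m × ℝ) :
    Eucl (m + M) × ℝ :=
  ((F (squeeze p)).1, squeezeHeight β p)

/-- The framing of `squeezeMap`, for `(V i p).2 = p.2 * δ i p`. -/
def squeezeFrame (V : Fin M → Eucl m × ℝ → Eucl (m + M) × ℝ) (β : Eucl m × ℝ → ℝ)
    (δ : Fin M → Eucl m × ℝ → ℝ) (i : Fin M) (p : Eucl m × ℝ) : Eucl (m + M) × ℝ :=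
  ((V i (squeeze p)).1, δ i (squeeze p) * squeezeHeight β p ^ 2 / β (squeeze p))

/-- The reason for the exponential: `log (flatExp s * β) = 1 - 1/s + log β`, so the conjugated
height is `1 / (1/s - log β)`, and written as `s / (1 - s log β)` it has no singularity at `s = 0`.
-/
theorem unflat_height {p : Eucl m × ℝ} (h0 : 0 < p.2) {β : Eucl m × ℝ → ℝ}
    (hb : 0 < β (squeeze p)) : unflat (flatExp p.2 * β (squeeze p)) = squeezeHeight β p := by
  rw [unflat, Real.log_mul (flatExp_pos h0).ne' hb.ne', log_flatExp h0, squeezeHeight]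
  have : 1 - (1 - p.2⁻¹ + Real.log (β (squeeze p))) =
      (1 - p.2 * Real.log (β (squeeze p))) / p.2 := by
    field_simp
    ring
  rw [this, inv_div]

theorem squeeze_end (x : Eucl m) : squeeze (x, (0 : ℝ)) = (x, 0) := by rw [squeeze, flatExp_zero]

theorem squeeze_one (x : Eucl m) : squeeze (x, (1 : ℝ)) = (x, 1) := by rw [squeeze, flatExp_one]

theorem squeezeHeight_end (β : Eucl m × ℝ → ℝ) (x : Eucl m) : squeezeHeight β (x, 0) = 0 := by
  simp [squeezeHeight]

theorem RevConc.contDiffOn_denom (h : RevConc m q M a w F V) {β : Eucl m × ℝ → ℝ}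
    (hβ : ContDiffOn ℝ ∞ β (cylinder m)) (hF : ∀ p ∈ cylinder m, (F p).2 = p.2 * β p) :
    ContDiffOn ℝ ∞ (fun p => 1 - p.2 * Real.log (β (squeeze p))) (cylinder m) := by
  have hβs : ContDiffOn ℝ ∞ (fun p => β (squeeze p)) (cylinder m) :=
    hβ.comp contDiff_squeeze.contDiffOn fun _ => squeeze_mem
  exact contDiffOn_const.sub (contDiff_snd.contDiffOn.mul (hβs.log fun p hp =>
    (h.factor_pos hβ.continuousOn hF (squeeze_mem hp)).ne'))

theorem RevConc.contDiffOn_squeezeHeight (h : RevConc m q M a w F V) {β : Eucl m × ℝ → ℝ}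
    (hβ : ContDiffOn ℝ ∞ β (cylinder m)) (hF : ∀ p ∈ cylinder m, (F p).2 = p.2 * β p) :
    ContDiffOn ℝ ∞ (squeezeHeight β) (cylinder m) :=
  contDiff_snd.contDiffOn.div (h.contDiffOn_denom hβ hF)
    fun _ hp => (h.denom_pos hβ.continuousOn hF hp).ne'

theorem RevConc.contDiffOn_squeezeMap (h : RevConc m q M a w F V) {β : Eucl m × ℝ → ℝ}
    (hβ : ContDiffOn ℝ ∞ β (cylinder m)) (hF : ∀ p ∈ cylinder m, (F p).2 = p.2 * β p) :
    ContDiffOn ℝ ∞ (squeezeMap F β) (cylinder m) := by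
  have hFs : ContDiffOn ℝ ∞ (fun p => F (squeeze p)) (cylinder m) :=
    h.emb.smooth.comp contDiff_squeeze.contDiffOn fun _ => squeeze_mem
  exact (contDiff_fst.comp_contDiffOn hFs).prodMk (h.contDiffOn_squeezeHeight hβ hF)

theorem RevConc.isFramedEmbedding_squeeze_inter (h : RevConc m q M a w F V) :
    IsFramedEmbedding (cylinder m ∩ {p | 0 < p.2}) (fun p => unsqueeze (F (squeeze p)))
      (fun i p => (1 : ℝ) • fderiv ℝ unsqueeze (F (squeeze p)) (V i (squeeze p))) :=
  have hs : MapsTo (squeeze (m := m)) (cylinder m) (cylinder m) := fun _ => squeeze_mem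
  h.emb.push (uniqueDiffOn_cylinder.inter (isOpen_lt continuous_const continuous_snd))
    (Φ := squeeze) (Φi := unsqueeze) (Ψ := unsqueeze) (Ψi := squeeze) (c := fun _ => 1)
    (fun p hp => hs hp.1) (fun _ _ => contDiff_squeeze.contDiffAt)
    (fun p hp => by
      refine (contDiffAt_unsqueeze (flatExp_pos hp.2).ne' ?_).differentiableAt (by simp)
      simp only [squeeze]
      rw [log_flatExp hp.2, sub_sub_cancel]
      exact inv_ne_zero (ne_of_gt hp.2))
    (fun p hp => by
      filter_upwards [(isOpen_lt continuous_const continuous_snd).mem_nhds hp.2] with y hy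
      exact Prod.ext rfl (unflat_flatExp hy))
    (fun p hp => contDiffAt_unsqueeze (h.height_pos (hs hp.1) (flatExp_pos hp.2)).ne' (by
      have := Real.log_nonpos (h.height_pos (hs hp.1) (flatExp_pos hp.2)).le
        (h.height_le_one (hs hp.1))
      linarith))
    (fun _ _ => (contDiff_squeeze.differentiable (by simp)).differentiableAt)
    (fun p hp => by
      have h1 := h.height_pos (hs hp.1) (flatExp_pos hp.2)
      have h2 : (F (squeeze p)).2 < 2 := (h.height_le_one (hs hp.1)).trans_lt one_lt_two
      filter_upwards [(isOpen_lt continuous_const continuous_snd).mem_nhds h1,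
        (isOpen_lt continuous_snd continuous_const).mem_nhds h2] with y hy hy2
      -- The inverse needs `log y < 1`. By `log y ≤ y - 1` this holds below height 2, which leaves
      -- an open neighbourhood of the top height 1.
      refine Prod.ext rfl (flatExp_unflat hy ?_)
      have := Real.log_le_sub_one_of_pos hy
      have hy2' : y.2 < 2 := hy2
      linarith)
    contDiffOn_const (fun _ _ => one_ne_zero)

theorem RevConc.squeezeMap_eq (h : RevConc m q M a w F V) {β : Eucl m × ℝ → ℝ}
    (hβ : ContinuousOn β (cylinder m)) (hF : ∀ p ∈ cylinder m, (F p).2 = p.2 * β p)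
    {p : Eucl m × ℝ} (hp : p ∈ cylinder m) (h0 : 0 < p.2) :
    squeezeMap F β p = unsqueeze (F (squeeze p)) := by
  refine Prod.ext rfl ?_
  simp only [unsqueeze]
  rw [hF _ (squeeze_mem hp)]
  exact (unflat_height h0 (h.factor_pos hβ hF (squeeze_mem hp))).symm

/-- At `u = flatExp s * β` the derivative of `unflat` is `unflat u ^ 2 / u`, and the vertical
component of the frame is `flatExp s * δ`. The flat factor cancels, and what remains is smooth at
the bottom. -/
theorem RevConc.squeezeFrame_eq (h : RevConc m q M a w F V) {β : Eucl m × ℝ → ℝ}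
    {δ : Fin M → Eucl m × ℝ → ℝ}
    (hβ : ContinuousOn β (cylinder m)) (hF : ∀ p ∈ cylinder m, (F p).2 = p.2 * β p)
    (hV : ∀ i, ∀ p ∈ cylinder m, (V i p).2 = p.2 * δ i p)
    {p : Eucl m × ℝ} (hp : p ∈ cylinder m) (h0 : 0 < p.2) (i : Fin M) :
    squeezeFrame V β δ i p =
      (1 : ℝ) • fderiv ℝ unsqueeze (F (squeeze p)) (V i (squeeze p)) := by
  have hs := squeeze_mem hp
  have h1 := h.height_pos hs (flatExp_pos h0)
  have h2 : 1 - Real.log (F (squeeze p)).2 ≠ 0 := by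
    have := Real.log_nonpos h1.le (h.height_le_one hs)
    linarith
  have h4 := h.factor_pos hβ hF hs
  have h5 : (squeeze p).2 = flatExp p.2 := rfl
  rw [one_smul, fderiv_unsqueeze h1.ne' h2]
  refine Prod.ext rfl ?_
  simp only [squeezeFrame]
  rw [hF _ hs, hV _ _ hs, h5, unflat_height h0 h4]
  have h3 := (flatExp_pos h0).ne'
  have h4 := h4.ne'
  field_simp

/-- At positive heights this is a conjugate by local diffeomorphisms. At height zero the map and the
frame are standard and the height factor `1 / (1 - s log β)` is one, so `bijective_frame_standard`
applies. -/
theorem RevConc.isFramedEmbedding_squeeze (h : RevConc m q M a w F V) {β : Eucl m × ℝ → ℝ}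
    {δ : Fin M → Eucl m × ℝ → ℝ}
    (hβ : ContDiffOn ℝ ∞ β (cylinder m)) (hF : ∀ p ∈ cylinder m, (F p).2 = p.2 * β p)
    (hδ : ∀ i, ContDiffOn ℝ ∞ (δ i) (cylinder m))
    (hV : ∀ i, ∀ p ∈ cylinder m, (V i p).2 = p.2 * δ i p) :
    IsFramedEmbedding (cylinder m) (squeezeMap F β) (squeezeFrame V β δ) where
  smooth := h.contDiffOn_squeezeMap hβ hF
  injOn := by
    have hpos : ∀ p ∈ cylinder m, 0 < p.2 → 0 < squeezeHeight β p := fun p hp h0 =>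
      div_pos h0 (h.denom_pos hβ.continuousOn hF hp)
    have hzero : ∀ p ∈ cylinder m, 0 = p.2 → squeezeMap F β p = (incl m (m + M) p.1, 0) := by
      intro p hp h0
      rw [show p = (p.1, 0) from Prod.ext rfl h0.symm, squeezeMap, squeeze_end,
        squeezeHeight_end, h.map_zero _ hp.1]
    intro p hp p' hp' hpp
    rcases hp.2.1.eq_or_lt with h0 | h0 <;> rcases hp'.2.1.eq_or_lt with h0' | h0'
    · rw [hzero p hp h0, hzero p' hp' h0', Prod.mk.injEq] at hpp
      exact Prod.ext ((isFramedEmbedding_incl m M).injOn hp.1 hp'.1 hpp.1) (h0.symm.trans h0')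
    · have h1 := congrArg Prod.snd hpp
      rw [hzero p hp h0] at h1
      exact absurd h1 (hpos p' hp' h0').ne
    · have h1 := congrArg Prod.snd hpp
      rw [hzero p' hp' h0'] at h1
      exact absurd h1 (hpos p hp h0).ne'
    · refine h.isFramedEmbedding_squeeze_inter.injOn ⟨hp, h0⟩ ⟨hp', h0'⟩ ?_
      rw [h.squeezeMap_eq hβ.continuousOn hF hp h0, h.squeezeMap_eq hβ.continuousOn hF hp' h0'] at hpp
      exact hpp
  smooth_frame := by
    intro i
    have hs : MapsTo (squeeze (m := m)) (cylinder m) (cylinder m) := fun _ => squeeze_mem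
    have hβs : ContDiffOn ℝ ∞ (fun p => β (squeeze p)) (cylinder m) :=
      hβ.comp contDiff_squeeze.contDiffOn hs
    have hVs : ContDiffOn ℝ ∞ (fun p => V i (squeeze p)) (cylinder m) :=
      (h.emb.smooth_frame i).comp contDiff_squeeze.contDiffOn hs
    have hδs : ContDiffOn ℝ ∞ (fun p => δ i (squeeze p)) (cylinder m) :=
      (hδ i).comp contDiff_squeeze.contDiffOn hs
    exact (contDiff_fst.comp_contDiffOn hVs).prodMk
      ((hδs.mul ((h.contDiffOn_squeezeHeight hβ hF).pow 2)).div hβs fun p hp =>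
        (h.factor_pos hβ.continuousOn hF (hs hp)).ne')
  complement := by
    intro p hp
    have hd := (h.contDiffOn_squeezeMap hβ hF).differentiableOn (by simp)
    rcases hp.2.1.eq_or_lt with h0 | h0
    · obtain ⟨x, s⟩ := p
      obtain rfl : 0 = s := h0
      refine bijective_frame_standard (fun y => fderivWithin_standard_end
        hd (fun x hx => ?_) hp.1 y) ?_ fun i => ?_
      · rw [squeezeMap, squeeze_end, squeezeHeight_end, h.map_zero x hx]
      · rw [fderivWithin_height (β := fun p => (1 - p.2 * Real.log (β (squeeze p)))⁻¹) hd
          ((h.contDiffOn_denom hβ hF).continuousOn.inv₀ fun p hp =>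
            (h.denom_pos hβ.continuousOn hF hp).ne')
          (fun _ _ => div_eq_mul_inv _ _) hp.1]
        simp
      · rw [squeezeFrame, squeeze_end, squeezeHeight_end, h.frame_zero x hp.1]
        simp
    · exact h.isFramedEmbedding_squeeze_inter.complement_congr
        (isOpen_lt continuous_const continuous_snd)
        (fun p hp => h.squeezeMap_eq hβ.continuousOn hF hp.1 hp.2)
        (fun p hp i => h.squeezeFrame_eq hβ.continuousOn hF hV hp.1 hp.2 i) ⟨hp, h0⟩

/-- Conjugation with `squeeze` preserves concordances, since smoothness at height `0` is kept. -/
theorem RevConc.conj (h : RevConc m q M a w F V) {β : Eucl m × ℝ → ℝ} {δ : Fin M → Eucl m × ℝ → ℝ}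
    (hβ : ContDiffOn ℝ ∞ β (cylinder m)) (hF : ∀ p ∈ cylinder m, (F p).2 = p.2 * β p)
    (hδ : ∀ i, ContDiffOn ℝ ∞ (δ i) (cylinder m))
    (hV : ∀ i, ∀ p ∈ cylinder m, (V i p).2 = p.2 * δ i p) :
    RevConc m q M a w (squeezeMap F β) (squeezeFrame V β δ) where
  emb := h.isFramedEmbedding_squeeze hβ hF hδ hV
  norm_lt := fun p hp h1 => h.norm_lt _ (squeeze_mem hp) h1
  height_mem := by
    intro p hp h1
    have hden := h.denom_pos hβ.continuousOn hF hp
    refine ⟨div_pos h1.1 hden, ?_⟩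
    have h2 := h.height_mem _ (squeeze_mem hp) ⟨flatExp_pos h1.1, flatExp_lt_one h1.1 h1.2⟩
    have h3 := mul_neg_of_pos_of_neg h1.1 (Real.log_neg h2.1 h2.2)
    rw [h.log_height hβ.continuousOn hF hp h1.1] at h3
    refine (div_lt_one hden).2 ?_
    linarith
  map_zero := fun x hx => by
    rw [squeezeMap, squeeze_end, squeezeHeight_end, h.map_zero x hx]
  frame_zero := fun x hx i => by
    rw [squeezeFrame, squeeze_end, squeezeHeight_end, h.frame_zero x hx]
    simp
  map_one := by
    intro x hx
    have h1 := hF (x, 1) ⟨hx, right_mem_Icc.2 zero_le_one⟩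
    rw [h.map_one x hx, one_mul] at h1
    simp [squeezeMap, squeezeHeight, squeeze_one, h.map_one x hx, ← h1]
  frame_one := by
    intro x hx i
    have h1 := hV i (x, 1) ⟨hx, right_mem_Icc.2 zero_le_one⟩
    rw [h.frame_one x hx, one_mul] at h1
    simp [squeezeFrame, squeeze_one, h.frame_one x hx, ← h1]
  side_norm := fun p hp h1 => h.side_norm _ (squeeze_mem hp) h1
  side_mem := fun p hp h1 => h.side_mem _ (squeeze_mem hp) h1
  side_tangent := fun p hp h1 => h.side_tangent _ (squeeze_mem hp) h1
  side_frame_mem := fun p hp h1 => h.side_frame_mem _ (squeeze_mem hp) h1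
  side_frame_std := by
    intro p hp h1 i hi
    have h2 := h.side_frame_std _ (squeeze_mem hp) h1 i hi
    refine Prod.ext (by rw [squeezeFrame, h2]) ?_
    simp only [squeezeFrame]
    rcases hp.2.1.eq_or_lt with h0 | h0
    · rw [show p = (p.1, 0) from Prod.ext rfl h0.symm, squeezeHeight_end]
      simp
    · have h3 := hV i _ (squeeze_mem hp)
      rw [h2] at h3
      have h4 : δ i (squeeze p) = 0 := (mul_eq_zero.1 h3.symm).resolve_left (flatExp_pos h0).ne'
      rw [h4, zero_mul, zero_div]

/-- Every concordance can be made standard to infinite order at height `0`. -/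
theorem RevConc.exists_flat (h : RevConc m q M a w F V) : ∃ F' V', RevConc m q M a w F' V' ∧
    (∃ E : Eucl m × ℝ → Eucl (m + M) × ℝ, ContDiffOn ℝ ∞ E (cylinder m) ∧
      ∀ p ∈ cylinder m, F' p = (incl m (m + M) p.1, p.2) + flatExp p.2 • E p) ∧
    ∀ i, ∃ E : Eucl m × ℝ → Eucl (m + M) × ℝ, ContDiffOn ℝ ∞ E (cylinder m) ∧
      ∀ p ∈ cylinder m, V' i p = (stdVec m M i, 0) + flatExp p.2 • E p := by
  have hs : MapsTo (squeeze (m := m)) (cylinder m) (cylinder m) := fun _ => squeeze_mem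
  have hcs : ∀ {G : Type} [NormedAddCommGroup G] [NormedSpace ℝ G] {g : Eucl m × ℝ → G},
      ContDiffOn ℝ ∞ g (cylinder m) → ContDiffOn ℝ ∞ (fun p => g (squeeze p)) (cylinder m) :=
    fun hg => hg.comp contDiff_squeeze.contDiffOn hs
  have had : ∀ {G : Type} [NormedAddCommGroup G] [NormedSpace ℝ G] [CompleteSpace G]
      {g : Eucl m × ℝ → G}, ContDiffOn ℝ ∞ g (cylinder m) → ∃ g' : Eucl m × ℝ → G,
      ContDiffOn ℝ ∞ g' (cylinder m) ∧ ∀ p ∈ cylinder m, g p = g (p.1, 0) + p.2 • g' p := by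
    intro G _ _ _ g hg
    obtain ⟨g', h1, h2, -⟩ := exists_hadamard isCompact_disk convex_disk (uniqueDiffOn_disk m) hg
    exact ⟨g', h1, fun p hp => h2 p.1 hp.1 p.2 hp.2⟩
  obtain ⟨β, hβ, hF⟩ := had (g := fun p => (F p).2) (contDiff_snd.comp_contDiffOn h.emb.smooth)
  replace hF : ∀ p ∈ cylinder m, (F p).2 = p.2 * β p := fun p hp => by
    have := hF p hp
    rwa [h.map_zero p.1 hp.1, zero_add] at this
  have hδ : ∀ i, ∃ δ : Eucl m × ℝ → ℝ, ContDiffOn ℝ ∞ δ (cylinder m) ∧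
      ∀ p ∈ cylinder m, (V i p).2 = p.2 * δ p := fun i => by
    obtain ⟨δ, h1, h2⟩ := had (g := fun p => (V i p).2)
      (contDiff_snd.comp_contDiffOn (h.emb.smooth_frame i))
    refine ⟨δ, h1, fun p hp => ?_⟩
    have := h2 p hp
    rwa [h.frame_zero p.1 hp.1, zero_add] at this
  choose δ hδ hV using hδ
  -- First conjugation: its height factor `β1` is one at the bottom, and the vertical component of
  -- its frame is divisible by `p.2 ^ 2`.
  have h1 := h.conj hβ hF hδ hV
  have hden := h.contDiffOn_denom hβ hF
  have hden0 := fun p hp => (h.denom_pos hβ.continuousOn hF (p := p) hp).ne'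
  have hfac0 := fun p hp => (h.factor_pos hβ.continuousOn hF (hs (x := p) hp)).ne'
  set β1 : Eucl m × ℝ → ℝ := fun p => (1 - p.2 * Real.log (β (squeeze p)))⁻¹ with hβ1def
  have hβ1 : ContDiffOn ℝ ∞ β1 (cylinder m) := hden.inv hden0
  have hF1 : ∀ p ∈ cylinder m, (squeezeMap F β p).2 = p.2 * β1 p := fun p _ => div_eq_mul_inv _ _
  set δ' : Fin M → Eucl m × ℝ → ℝ := fun i p => δ i (squeeze p) * β1 p ^ 2 / β (squeeze p)
  have hδ' : ∀ i, ContDiffOn ℝ ∞ (δ' i) (cylinder m) := fun i =>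
    ((hcs (hδ i)).mul (hβ1.pow 2)).div (hcs hβ) hfac0
  have hδ1 : ∀ i, ContDiffOn ℝ ∞ (fun p => p.2 * δ' i p) (cylinder m) := fun i =>
    contDiff_snd.contDiffOn.mul (hδ' i)
  have hV1 : ∀ i, ∀ p ∈ cylinder m, (squeezeFrame V β δ i p).2 = p.2 * (p.2 * δ' i p) := by
    intro i p _
    simp only [squeezeFrame, squeezeHeight, δ', hβ1def, div_eq_mul_inv]
    ring
  -- Second conjugation: errors that were multiples of `p.2` become multiples of `flatExp p.2`. For
  -- the height this concerns `log β1`, which vanishes at the bottom; the original `log β` need not,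
  -- which is why one conjugation is not enough.
  have h2 := h1.conj hβ1 hF1 hδ1 hV1
  have hβ1pos := fun p hp => h1.factor_pos hβ1.continuousOn hF1 (p := p) hp
  have hden1 := h1.contDiffOn_denom hβ1 hF1
  have hden10 := fun p hp => (h1.denom_pos hβ1.continuousOn hF1 (p := p) hp).ne'
  obtain ⟨l, hl, hl'⟩ := had (hβ1.log fun p hp => (hβ1pos p hp).ne')
  replace hl' : ∀ p ∈ cylinder m, Real.log (β1 p) = p.2 * l p := fun p hp => by
    rw [hl' p hp]
    simp [hβ1def]
  obtain ⟨A, hA, hA'⟩ := had (g := fun p => (squeezeMap F β p).1)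
    (contDiff_fst.comp_contDiffOn h1.emb.smooth)
  have hB := fun i => had (g := fun p => (squeezeFrame V β δ i p).1)
    (contDiff_fst.comp_contDiffOn (h1.emb.smooth_frame i))
  choose B hB hB' using hB
  refine ⟨_, _, h2, ⟨fun p => (A (squeeze p), p.2 ^ 2 * l (squeeze p) /
    (1 - p.2 * Real.log (β1 (squeeze p)))), ?_, ?_⟩, fun i => ⟨fun p => (B i (squeeze p),
    δ' i (squeeze p) * squeezeHeight β1 p ^ 2 / β1 (squeeze p)), ?_, ?_⟩⟩
  · exact (hcs hA).prodMk (((contDiff_snd.contDiffOn.pow 2).mul (hcs hl)).div hden1 hden10)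
  · intro p hp
    refine Prod.ext ?_ ?_
    · have := hA' _ (hs hp)
      rwa [h1.map_zero _ (hs hp).1] at this
    · have h3 := hden10 p hp
      have h4 : Real.log (β1 (squeeze p)) = flatExp p.2 * l (squeeze p) := hl' _ (hs hp)
      change p.2 / (1 - p.2 * Real.log (β1 (squeeze p))) = p.2 + flatExp p.2 *
        (p.2 ^ 2 * l (squeeze p) / (1 - p.2 * Real.log (β1 (squeeze p))))
      rw [h4] at h3 ⊢
      rw [div_eq_iff h3, add_mul, mul_assoc (flatExp _), div_mul_cancel₀ _ h3]
      ring
  · exact (hcs (hB i)).prodMk (((hcs (hδ' i)).mul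
      ((h1.contDiffOn_squeezeHeight hβ1 hF1).pow 2)).div (hcs hβ1)
      fun p hp => (hβ1pos _ (hs hp)).ne')
  · intro p hp
    refine Prod.ext ?_ ?_
    · have := hB' i _ (hs hp)
      rwa [h1.frame_zero _ (hs hp).1] at this
    · simp only [squeezeFrame, Prod.snd_add, Prod.smul_snd, smul_eq_mul, squeeze]
      ring

end Compress

/-! ### Polar coordinates on the half disk -/

section Polar

variable {m : ℕ}

/-- Polar coordinates around the origin of the half space. -/
def polar (z : Eucl m × ℝ) : Eucl m × ℝ := (dir z, nrm z)

/-- The cone map, inverse to `polar`. -/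
def cone (p : Eucl m × ℝ) : Eucl m × ℝ := p.2 • hemi p.1

theorem cone_polar {z : Eucl m × ℝ} (hz : 0 < nrm z + z.2) : cone (polar z) = z := by
  have h0 : nrm z ≠ 0 := by
    intro h
    rw [nrm_eq_zero] at h
    simp [h, nrm] at hz
  rw [cone, polar, hemi_dir hz, smul_smul, mul_inv_cancel₀ h0, one_smul]

theorem nrm_cone {p : Eucl m × ℝ} (hp : 0 ≤ p.2) : nrm (cone p) = p.2 := by
  rw [cone, nrm_smul hp, nrm_hemi, mul_one]

theorem polar_cone {p : Eucl m × ℝ} (hp : 0 < p.2) : polar (cone p) = p :=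
  Prod.ext ((dir_smul hp _).trans (dir_hemi _)) (nrm_cone hp.le)

theorem polar_hemi (x : Eucl m) : polar (hemi x) = (x, 1) :=
  Prod.ext (dir_hemi x) (nrm_hemi x)

theorem polar_zero : polar (0 : Eucl m × ℝ) = (0, 0) := by
  simp [polar, dir, nrm_eq_zero.2 rfl]

/-- At the origin the convention `0⁻¹ = 0` makes the direction the centre of the disk, so the origin
needs no exception. -/
theorem polar_mem {z : Eucl m × ℝ} (hz : z ∈ halfDisk m) : polar z ∈ cylinder m := by
  rw [mem_halfDisk] at hz
  by_cases h0 : z = 0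
  · rw [h0, polar_zero]
    simp [mem_cylinder]
  · exact mem_cylinder.2 ⟨norm_dir_le_one h0 hz.2, nrm_nonneg z, hz.1⟩

theorem cone_mem {p : Eucl m × ℝ} (hp : p ∈ cylinder m) : cone p ∈ halfDisk m := by
  rw [mem_cylinder] at hp
  rw [mem_halfDisk, nrm_cone hp.2.1]
  exact ⟨hp.2.2, mul_nonneg hp.2.1 (hemi_snd_nonneg hp.1)⟩

theorem contDiff_cone : ContDiff ℝ ∞ (cone (m := m)) :=
  contDiff_snd.smul (contDiff_hemi.comp contDiff_fst)

theorem contDiffAt_polar {z : Eucl m × ℝ} (hz : 0 < nrm z + z.2) :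
    ContDiffAt ℝ ∞ (polar (m := m)) z := by
  refine (contDiffAt_dir hz).prodMk (contDiffAt_nrm ?_)
  rintro rfl
  simp [nrm] at hz

theorem hasFDerivAt_hemi (y : Eucl m) : HasFDerivAt hemi (fderiv ℝ hemi y) y :=
  ((contDiff_hemi.differentiable (by simp)).differentiableAt).hasFDerivAt

theorem fderiv_cone (p v : Eucl m × ℝ) :
    fderiv ℝ cone p v = p.2 • fderiv ℝ hemi p.1 v.1 + v.2 • hemi p.1 := by
  have h1 : HasFDerivAt (fun p : Eucl m × ℝ => p.2) (ContinuousLinearMap.snd ℝ (Eucl m) ℝ) p :=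
    hasFDerivAt_snd
  have h2 : HasFDerivAt (fun p : Eucl m × ℝ => hemi p.1)
      ((fderiv ℝ hemi p.1).comp (ContinuousLinearMap.fst ℝ (Eucl m) ℝ)) p :=
    HasFDerivAt.comp (f := Prod.fst) p (hasFDerivAt_hemi p.1) hasFDerivAt_fst
  have h3 : HasFDerivAt (cone (m := m)) _ p := h1.smul h2
  rw [h3.fderiv]
  rfl

theorem nrm_add_snd_smul_pos {z : Eucl m × ℝ} (hz : 0 < nrm z + z.2) {c : ℝ} (hc : 0 < c) :
    0 < nrm (c • z) + (c • z).2 := by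
  rw [nrm_smul hc.le, Prod.smul_snd, smul_eq_mul, ← mul_add]
  exact mul_pos hc hz

/-- The derivative of polar coordinates, in terms of smooth functions of the direction. -/
theorem hasFDerivAt_polar {z : Eucl m × ℝ} (hz : 0 < nrm z + z.2) :
    HasFDerivAt polar ((nrm z)⁻¹ • (fderiv ℝ dir (hemi (dir z))).prod
      (nrm z • fderiv ℝ nrm (hemi (dir z)))) z := by
  have h0 : z ≠ 0 := by
    rintro rfl
    simp [nrm] at hz
  have hc : 0 < (nrm z)⁻¹ := inv_pos.2 (nrm_pos.2 h0)
  rw [hemi_dir hz]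
  set c := (nrm z)⁻¹ with hcdef
  -- `dir` is homogeneous of degree zero and `nrm` of degree one, so both derivatives at `z` can be
  -- read off at the unit vector `c • z`.
  have hs : HasFDerivAt (fun y : Eucl m × ℝ => c • y) (c • ContinuousLinearMap.id ℝ _) z :=
    (hasFDerivAt_id z).const_smul c
  have hd : HasFDerivAt dir (c • fderiv ℝ dir (c • z)) z := by
    have h1 := ((contDiffAt_dir (nrm_add_snd_smul_pos hz hc)).differentiableAt (by simp)).hasFDerivAt
    have h2 := HasFDerivAt.comp (f := fun y : Eucl m × ℝ => c • y) z h1 hs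
    refine (h2.congr_of_eventuallyEq (Eventually.of_forall fun y => (dir_smul hc y).symm)).congr_fderiv ?_
    exact ContinuousLinearMap.ext fun v => map_smul (fderiv ℝ dir (c • z)) c v
  have hn : HasFDerivAt nrm (fderiv ℝ nrm (c • z)) z := by
    have h1 := ((contDiffAt_nrm (z := c • z) (smul_ne_zero hc.ne' h0)).differentiableAt
      (by simp)).hasFDerivAt
    have h2 := (HasFDerivAt.comp (f := fun y : Eucl m × ℝ => c • y) z h1 hs).const_mul c⁻¹
    refine (h2.congr_of_eventuallyEq (Eventually.of_forall fun y => ?_)).congr_fderiv ?_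
    · simp [nrm_smul hc.le, hc.ne']
    · refine ContinuousLinearMap.ext fun v => ?_
      change c⁻¹ * fderiv ℝ nrm (c • z) (c • v) = _
      rw [map_smul, smul_eq_mul, inv_mul_cancel_left₀ hc.ne']
  refine (hd.prodMk hn).congr_fderiv (ContinuousLinearMap.ext fun v => Prod.ext rfl ?_)
  have h1 : c * nrm z = 1 := inv_mul_cancel₀ (nrm_pos.2 h0).ne'
  change fderiv ℝ nrm (c • z) v = c * (nrm z * fderiv ℝ nrm (c • z) v)
  rw [← mul_assoc, h1, one_mul]

end Polar

/-! ### Smoothness at the origin of flat functions of the radius -/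

section Blowdown

variable {m : ℕ}

theorem tendsto_inv_pow_mul_flatExp (k : ℕ) :
    Tendsto (fun s : ℝ => s⁻¹ ^ k * flatExp s) (𝓝 0) (𝓝 0) := by
  have h := (expNegInvGlue.tendsto_polynomial_inv_mul_zero (Polynomial.X ^ k)).const_mul (Real.exp 1)
  rw [mul_zero] at h
  refine h.congr fun s => ?_
  rw [flatExp, Polynomial.eval_pow, Polynomial.eval_X]
  ring

/-- Products of `s⁻¹ ^ k * flatExp s` with polynomials reproduce themselves under differentiation,
at the cost of two powers of `s⁻¹`. -/
theorem hasDerivAt_inv_pow_mul_flatExp (k : ℕ) {s : ℝ} (hs : 0 < s) :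
    HasDerivAt (fun s : ℝ => s⁻¹ ^ k * flatExp s) (s⁻¹ ^ (k + 2) * flatExp s * (1 - k * s)) s := by
  have h1 := ((hasDerivAt_inv hs.ne').pow k).mul (hasDerivAt_flatExp hs)
  refine h1.congr_deriv ?_
  rcases k with _ | k
  · simp
    ring
  · simp only [Nat.add_sub_cancel, Pi.pow_apply]
    push_cast
    have : s * s⁻¹ = 1 := mul_inv_cancel₀ hs.ne'
    rw [← inv_pow]
    linear_combination ((k + 1 : ℝ) * s⁻¹ ^ k * s⁻¹ ^ 2 * flatExp s) * this

theorem nrm_le (z : Eucl m × ℝ) : nrm z ≤ 2 * ‖z‖ := by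
  have h1 : ‖z.1‖ ≤ ‖z‖ := norm_fst_le z
  have h2 : |z.2| ≤ ‖z‖ := norm_snd_le z
  refine Real.sqrt_le_iff.2 ⟨by positivity, ?_⟩
  have h3 := pow_le_pow_left₀ (norm_nonneg _) h1 2
  have h4 := pow_le_pow_left₀ (abs_nonneg _) h2 2
  rw [sq_abs] at h4
  nlinarith [sq_nonneg ‖z‖]

variable {G : Type} [NormedAddCommGroup G] [NormedSpace ℝ G]

/-- A flat function of the radius times a smooth function in polar coordinates. -/
def flatCone (k : ℕ) (E : Eucl m × ℝ → G) (z : Eucl m × ℝ) : G :=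
  ((nrm z)⁻¹ ^ k * flatExp (nrm z)) • E (polar z)

theorem flatCone_zero (k : ℕ) (E : Eucl m × ℝ → G) : flatCone k E 0 = 0 := by
  rw [flatCone, nrm_eq_zero.2 rfl, flatExp_zero, mul_zero, zero_smul]

/-- `E` is bounded on the compact cylinder and the radial factor is `o(r)` for every `k`, so it does
not matter that `E (polar z)` may have no limit at the origin. -/
theorem hasFDerivWithinAt_flatCone_zero (k : ℕ) {E : Eucl m × ℝ → G}
    (hE : ContinuousOn E (cylinder m)) :
    HasFDerivWithinAt (flatCone k E) (0 : Eucl m × ℝ →L[ℝ] G) (halfDisk m) 0 := by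
  obtain ⟨C, hC⟩ := isCompact_cylinder.exists_bound_of_continuousOn hE
  have hC0 : 0 ≤ C := (norm_nonneg _).trans (hC 0 (by simp [mem_cylinder]))
  refine HasFDerivWithinAt.of_isLittleO (Asymptotics.isLittleO_iff.2 fun ε hε => ?_)
  have ht : Tendsto (fun z : Eucl m × ℝ => (nrm z)⁻¹ ^ (k + 1) * flatExp (nrm z)) (𝓝 0) (𝓝 0) := by
    refine (tendsto_inv_pow_mul_flatExp (k + 1)).comp ?_
    have := continuous_nrm.tendsto (0 : Eucl m × ℝ)
    rwa [nrm_eq_zero.2 rfl] at this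
  have hev := nhdsWithin_le_nhds (s := halfDisk m)
    (ht.eventually (gt_mem_nhds (show (0 : ℝ) < ε / (2 * (C + 1)) by positivity)))
  filter_upwards [self_mem_nhdsWithin, hev] with z hz hz'
  rw [flatCone_zero, sub_zero, sub_zero, zero_apply, sub_zero]
  have h1 := hC _ (polar_mem hz)
  have hn := nrm_nonneg z
  have hf := flatExp_nonneg (nrm z)
  have h2 : (nrm z)⁻¹ ^ k * flatExp (nrm z) ≤ nrm z * (ε / (2 * (C + 1))) := by
    by_cases h0 : nrm z = 0
    · rw [h0, flatExp_zero]
      simp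
    · have : (nrm z)⁻¹ ^ k * flatExp (nrm z) =
          nrm z * ((nrm z)⁻¹ ^ (k + 1) * flatExp (nrm z)) := by
        rw [pow_succ]
        field_simp
      rw [this]
      exact mul_le_mul_of_nonneg_left (le_of_lt hz') hn
  rw [flatCone, norm_smul, Real.norm_of_nonneg (by positivity)]
  calc (nrm z)⁻¹ ^ k * flatExp (nrm z) * ‖E (polar z)‖
      ≤ (nrm z * (ε / (2 * (C + 1)))) * C := by gcongr
    _ ≤ ((2 * ‖z‖) * (ε / (2 * (C + 1)))) * (C + 1) := by
        gcongr
        · exact nrm_le z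
        · linarith
    _ = ε * ‖z‖ := by field_simp

/-- The derivative of `polar` is `1/r` times a smooth function of the polar coordinates, so the
derivative of a `flatCone` is a `flatCone` with exponent `k + 2`, at the origin too. Smoothness of
every order then follows by induction. -/
theorem exists_hasFDerivWithinAt_flatCone (k : ℕ) {E : Eucl m × ℝ → G}
    (hE : ContDiffOn ℝ ∞ E (cylinder m)) : ∃ E' : Eucl m × ℝ → Eucl m × ℝ →L[ℝ] G,
    ContDiffOn ℝ ∞ E' (cylinder m) ∧ ∀ z ∈ halfDisk m,
      HasFDerivWithinAt (flatCone k E) (flatCone (k + 2) E' z) (halfDisk m) z := by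
  have hdn : ContDiff ℝ ∞ (fun x : Eucl m => fderiv ℝ nrm (hemi x)) :=
    contDiff_iff_contDiffAt.2 fun x => (((contDiffAt_nrm (hemi_ne_zero x)).fderiv_right
      (m := ∞) (by simp)).comp x contDiff_hemi.contDiffAt)
  have hdd : ContDiff ℝ ∞ (fun x : Eucl m => fderiv ℝ dir (hemi x)) :=
    contDiff_iff_contDiffAt.2 fun x => (((contDiffAt_dir (nrm_add_snd_hemi_pos x)).fderiv_right
      (m := ∞) (by simp)).comp x contDiff_hemi.contDiffAt)
  have hdn' : ContDiffOn ℝ ∞ (fun p : Eucl m × ℝ => fderiv ℝ nrm (hemi p.1)) (cylinder m) :=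
    (hdn.comp contDiff_fst).contDiffOn
  have hdd' : ContDiffOn ℝ ∞ (fun p : Eucl m × ℝ => fderiv ℝ dir (hemi p.1)) (cylinder m) :=
    (hdd.comp contDiff_fst).contDiffOn
  have hk : ContDiffOn ℝ ∞ (fun p : Eucl m × ℝ => 1 - (k : ℝ) * p.2) (cylinder m) :=
    ContDiff.contDiffOn (by fun_prop)
  -- The first summand differentiates the radial factor and the second differentiates `E`. The outer
  -- `p.2` of the second raises the `1/r` from `polar` to the common `1/r²`.
  refine ⟨fun p => (1 - k * p.2) • (fderiv ℝ nrm (hemi p.1)).smulRight (E p) +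
    p.2 • (fderivWithin ℝ E (cylinder m) p).comp ((fderiv ℝ dir (hemi p.1)).prod
      (p.2 • fderiv ℝ nrm (hemi p.1))), ?_, fun z hz => ?_⟩
  · refine ContDiffOn.add ?_ ?_
    · refine hk.smul (hdn'.smulRight hE)
    · refine contDiff_snd.contDiffOn.smul ((hE.fderivWithin uniqueDiffOn_cylinder (by simp)).clm_comp ?_)
      exact (ContinuousLinearMap.prodₗᵢ (𝕜 := ℝ) (E := Eucl m × ℝ) (F := Eucl m) (G := ℝ)
        ℝ).contDiff.comp_contDiffOn
        (hdd'.prodMk (contDiff_snd.contDiffOn.smul hdn'))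
  by_cases h0 : z = 0
  · rw [h0, flatCone_zero]
    exact hasFDerivWithinAt_flatCone_zero k hE.continuousOn
  have hp := nrm_pos.2 h0
  have hz2 := nrm_add_snd_pos h0 hz.2
  have hpol := hasFDerivAt_polar hz2
  have h1 : HasFDerivAt nrm (fderiv ℝ nrm (hemi (dir z))) z := by
    refine (HasFDerivAt.comp (f := polar) z (hasFDerivAt_snd (𝕜 := ℝ)) hpol).congr_fderiv ?_
    refine ContinuousLinearMap.ext fun v => ?_
    change (nrm z)⁻¹ * (nrm z * fderiv ℝ nrm (hemi (dir z)) v) = _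
    rw [← mul_assoc, inv_mul_cancel₀ hp.ne', one_mul]
  have h2 := ((hasDerivAt_inv_pow_mul_flatExp k hp).comp_hasFDerivAt z h1).hasFDerivWithinAt
    (s := halfDisk m)
  have h3 : HasFDerivWithinAt (fun y => E (polar y)) _ (halfDisk m) z :=
    (hE.differentiableOn (by simp) _ (polar_mem hz)).hasFDerivWithinAt.comp_of_tendsto z
      hpol.hasFDerivWithinAt (tendsto_nhdsWithin_iff.2 ⟨hpol.continuousAt.continuousWithinAt,
        eventually_mem_nhdsWithin.mono fun y hy => polar_mem hy⟩)
  refine (h2.smul h3).congr_fderiv (ContinuousLinearMap.ext fun v => ?_)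
  simp only [flatCone, add_apply, smul_apply,
    ContinuousLinearMap.comp_apply, ContinuousLinearMap.smulRight_apply, Function.comp_apply, map_smul]
  have e1 : (polar z).2 = nrm z := rfl
  have e2 : (polar z).1 = dir z := rfl
  rw [e1, e2]
  set u := (fderivWithin ℝ E (cylinder m) (polar z)) (((fderiv ℝ dir (hemi (dir z))).prod
    (nrm z • fderiv ℝ nrm (hemi (dir z)))) v)
  rw [smul_add, smul_smul, smul_smul, smul_smul, smul_smul, add_comm]
  refine congrArg₂ (· + ·) ?_ ?_
  · rw [smul_eq_mul]
  · congr 1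
    rw [pow_succ, pow_succ]
    field_simp

theorem contDiffOn_flatCone_nat (n : ℕ) : ∀ {G : Type} [NormedAddCommGroup G] [NormedSpace ℝ G]
    (k : ℕ) {E : Eucl m × ℝ → G} (_ : ContDiffOn ℝ ∞ E (cylinder m)),
    ContDiffOn ℝ n (flatCone k E) (halfDisk m) := by
  induction n with
  | zero =>
    intro G _ _ k E hE
    obtain ⟨E', -, hd⟩ := exists_hasFDerivWithinAt_flatCone k hE
    exact contDiffOn_zero.2 fun z hz => (hd z hz).continuousWithinAt
  | succ n ih =>
    intro G _ _ k E hE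
    obtain ⟨E', hE', hd⟩ := exists_hasFDerivWithinAt_flatCone k hE
    rw [Nat.cast_succ, contDiffOn_succ_iff_hasFDerivWithinAt_of_uniqueDiffOn uniqueDiffOn_halfDisk]
    exact ⟨by simp, _, ih _ hE', hd⟩

theorem contDiffOn_flatCone (k : ℕ) {E : Eucl m × ℝ → G} (hE : ContDiffOn ℝ ∞ E (cylinder m)) :
    ContDiffOn ℝ ∞ (flatCone k E) (halfDisk m) :=
  contDiffOn_infty.2 fun n => contDiffOn_flatCone_nat n k hE

end Blowdown

/-! ### Blowing down a concordance to a slice disk -/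

section Slice

variable {m M q : ℕ} {a : Eucl m → Eucl (m + M)} {w : Fin M → Eucl m → Eucl (m + M)}
  {F : Eucl m × ℝ → Eucl (m + M) × ℝ} {V : Fin M → Eucl m × ℝ → Eucl (m + M) × ℝ}

/-- The standard inclusion `ℝ^a × ℝ ⊂ ℝ^b × ℝ` as a continuous linear map. -/
def inclProdL (a b : ℕ) : Eucl a × ℝ →L[ℝ] Eucl b × ℝ :=
  (incl a b).prodMap (ContinuousLinearMap.id ℝ ℝ)

theorem hemi_incl (y : Eucl m) :
    hemi (incl m (m + M) y) = inclProdL m (m + M) (hemi y) := by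
  simp [hemi, inclProdL, norm_incl (Nat.le_add_right m M)]

theorem cone_incl (p : Eucl m × ℝ) :
    cone (incl m (m + M) p.1, p.2) = inclProdL m (m + M) (cone p) := by
  rw [cone, cone, hemi_incl, map_smul]

/-- The rescaled derivative of inverse stereographic projection. -/
def hemiFrame (p : Eucl m × Eucl m) : Eucl m × ℝ := ((1 + ‖p.1‖ ^ 2) / 2) • fderiv ℝ hemi p.1 p.2

theorem contDiff_hemiFrame : ContDiff ℝ ∞ (hemiFrame (m := m)) := by
  have h2 : ContDiff ℝ ∞ (fun y : Eucl m => ‖y‖ ^ 2) := contDiff_norm_sq ℝ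
  have h3 : ContDiff ℝ ∞ (fderiv ℝ (hemi (m := m))) := contDiff_hemi.fderiv_right (by simp)
  exact ((contDiff_const.add (h2.comp contDiff_fst)).div_const 2).smul
    ((h3.comp contDiff_fst).clm_apply contDiff_snd)

theorem hemiFrame_orthogonal {y e : Eucl m} (h : inner ℝ y e = 0) : hemiFrame (y, e) = (e, 0) := by
  rw [hemiFrame, fderiv_hemi_orthogonal h, smul_smul]
  convert one_smul ℝ _
  have : 1 + ‖y‖ ^ 2 ≠ 0 := by positivity
  field_simp

/-- The framing of a blown down concordance. -/
def coneFrame (F : Eucl m × ℝ → Eucl (m + M) × ℝ) (V : Fin M → Eucl m × ℝ → Eucl (m + M) × ℝ)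
    (i : Fin M) (z : Eucl m × ℝ) : Eucl (m + M) × ℝ :=
  open Classical in if z = 0 then (stdVec m M i, 0) else
    ((F (polar z)).2⁻¹ * ((1 + ‖(F (polar z)).1‖ ^ 2) / 2)) •
      fderiv ℝ cone (F (polar z)) (V i (polar z))

/-- The inverse height cancels the factor that `cone` puts on directions along the disk; the only
quotient left is that of the vertical component of the frame by the height. -/
theorem coneFrame_eq {z : Eucl m × ℝ} (hz : z ≠ 0) (h0 : (F (polar z)).2 ≠ 0) (i : Fin M) :
    coneFrame F V i z = hemiFrame ((F (polar z)).1, (V i (polar z)).1) +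
      ((V i (polar z)).2 * (F (polar z)).2⁻¹ * ((1 + ‖(F (polar z)).1‖ ^ 2) / 2)) •
        hemi (F (polar z)).1 := by
  rw [coneFrame, if_neg hz, fderiv_cone, hemiFrame, smul_add, smul_smul, smul_smul]
  congr 2
  · field_simp
  · ring

/-- Smooth maps preserve equality up to flat errors: Hadamard's lemma is applied to `Q (f p + u • E
p)` in the extra variable `u`, and `u = flatExp p.2` is substituted afterwards. -/
theorem exists_flat_composition {G E' : Type} [NormedAddCommGroup G] [NormedSpace ℝ G] [CompleteSpace G]
    [NormedAddCommGroup E'] [NormedSpace ℝ E'] {Q : E' → G} (hQ : ContDiff ℝ ∞ Q)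
    {f E : Eucl m × ℝ → E'} (hf : ContDiffOn ℝ ∞ f (cylinder m))
    (hE : ContDiffOn ℝ ∞ E (cylinder m)) : ∃ R : Eucl m × ℝ → G, ContDiffOn ℝ ∞ R (cylinder m) ∧
      ∀ p ∈ cylinder m, Q (f p + flatExp p.2 • E p) = Q (f p) + flatExp p.2 • R p := by
  have h1 : ContDiffOn ℝ ∞ (fun x : (Eucl m × ℝ) × ℝ => Q (f x.1 + x.2 • E x.1))
      (cylinder m ×ˢ Icc (0 : ℝ) 1) := by
    have hm : MapsTo Prod.fst (cylinder m ×ˢ Icc (0 : ℝ) 1) (cylinder m) := fun x hx => hx.1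
    exact hQ.comp_contDiffOn ((hf.comp contDiff_fst.contDiffOn hm).add
      (contDiff_snd.contDiffOn.smul (hE.comp contDiff_fst.contDiffOn hm)))
  obtain ⟨R, hR, h2, -⟩ := exists_hadamard isCompact_cylinder convex_cylinder uniqueDiffOn_cylinder h1
  refine ⟨fun p => R (p, flatExp p.2), ?_, fun p hp => ?_⟩
  · exact hR.comp (contDiff_id.prodMk (contDiff_flatExp.comp contDiff_snd)).contDiffOn
      fun p hp => ⟨hp, flatExp_mem hp.2⟩
  · simpa using h2 p hp _ (flatExp_mem hp.2)

theorem RevConc.exists_factor (h : RevConc m q M a w F V) : ∃ β : Eucl m × ℝ → ℝ,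
    ContDiffOn ℝ ∞ β (cylinder m) ∧ (∀ p ∈ cylinder m, (F p).2 = p.2 * β p) ∧
    ∀ p ∈ cylinder m, 0 < β p := by
  obtain ⟨β, hβ, hF, -⟩ := exists_hadamard (f := fun p => (F p).2) isCompact_disk convex_disk
    (uniqueDiffOn_disk m) (contDiff_snd.comp_contDiffOn h.emb.smooth)
  replace hF : ∀ p ∈ cylinder m, (F p).2 = p.2 * β p := fun p hp => by
    have := hF p.1 hp.1 p.2 hp.2
    rwa [h.map_zero p.1 hp.1, zero_add] at this
  exact ⟨β, hβ, hF, fun p hp => h.factor_pos hβ.continuousOn hF hp⟩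

theorem polar_snd_pos {z : Eucl m × ℝ} (hz : z ≠ 0) : 0 < (polar z).2 := nrm_pos.2 hz

/-- By `cone_incl` the exact product concordance blows down to the linear inclusion; the flat error
of `F` passes through `cone` and becomes a `flatCone`. -/
theorem RevConc.exists_cone_eq (h : RevConc m q M a w F V) {E : Eucl m × ℝ → Eucl (m + M) × ℝ}
    (hE : ContDiffOn ℝ ∞ E (cylinder m))
    (hF : ∀ p ∈ cylinder m, F p = (incl m (m + M) p.1, p.2) + flatExp p.2 • E p) :
    ∃ R : Eucl m × ℝ → Eucl (m + M) × ℝ, ContDiffOn ℝ ∞ R (cylinder m) ∧ ∀ z ∈ halfDisk m,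
      cone (F (polar z)) = inclProdL m (m + M) z + flatCone 0 R z := by
  obtain ⟨R, hR, hQ⟩ := exists_flat_composition (Q := cone)
    (f := inclProdL m (m + M)) contDiff_cone (inclProdL m (m + M)).contDiff.contDiffOn hE
  refine ⟨R, hR, fun z hz => ?_⟩
  by_cases h0 : z = 0
  · have h1 := h.map_zero 0 (mem_disk.2 (by simp))
    rw [h0, flatCone_zero, polar_zero, h1, _root_.map_zero, cone]
    simp
  · have hp := polar_mem hz
    have h1 : F (polar z) = inclProdL m (m + M) (polar z) + flatExp (polar z).2 • E (polar z) :=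
      hF _ hp
    rw [h1, hQ _ hp, flatCone, pow_zero, one_mul]
    congr 1
    exact (cone_incl _).trans (by rw [cone_polar (nrm_add_snd_pos h0 hz.2)])

theorem RevConc.exists_coneFrame_eq (h : RevConc m q M a w F V)
    {E : Eucl m × ℝ → Eucl (m + M) × ℝ} (hE : ContDiffOn ℝ ∞ E (cylinder m))
    (hF : ∀ p ∈ cylinder m, F p = (incl m (m + M) p.1, p.2) + flatExp p.2 • E p)
    (i : Fin M) {B : Eucl m × ℝ → Eucl (m + M) × ℝ} (hB : ContDiffOn ℝ ∞ B (cylinder m))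
    (hV : ∀ p ∈ cylinder m, V i p = (stdVec m M i, 0) + flatExp p.2 • B p) :
    ∃ R : Eucl m × ℝ → Eucl (m + M) × ℝ, ContDiffOn ℝ ∞ R (cylinder m) ∧ ∀ z ∈ halfDisk m,
      coneFrame F V i z = (stdVec m M i, 0) + flatCone 1 R z := by
  obtain ⟨β, hβ, hFβ, hβpos⟩ := h.exists_factor
  have hF1 : ContDiffOn ℝ ∞ (fun p => (F p).1) (cylinder m) :=
    contDiff_fst.comp_contDiffOn h.emb.smooth
  obtain ⟨R, hR, hQ⟩ := exists_flat_composition (Q := hemiFrame)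
    (f := fun p => (incl m (m + M) p.1, stdVec m M i)) (E := fun p => ((E p).1, (B p).1))
    contDiff_hemiFrame (ContDiff.contDiffOn (by fun_prop))
    ((contDiff_fst.comp_contDiffOn hE).prodMk (contDiff_fst.comp_contDiffOn hB))
  have h2 : ContDiff ℝ ∞ (fun y : Eucl (m + M) => ‖y‖ ^ 2) := contDiff_norm_sq ℝ
  -- The radial term is divided by the height `r β`, so the error is written as a `flatCone` of
  -- exponent one; the factor `p.2` compensates for this in the other term.
  refine ⟨fun p => p.2 • R p + ((B p).2 * (β p)⁻¹ * ((1 + ‖(F p).1‖ ^ 2) / 2)) • hemi (F p).1,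
    ?_, fun z hz => ?_⟩
  · have h3 : ContDiffOn ℝ ∞ (fun p => hemi (F p).1) (cylinder m) :=
      contDiff_hemi.comp_contDiffOn hF1
    have h4 : ContDiffOn ℝ ∞ (fun p => (B p).2) (cylinder m) := contDiff_snd.comp_contDiffOn hB
    have h5 : ContDiffOn ℝ ∞ (fun p => ‖(F p).1‖ ^ 2) (cylinder m) := h2.comp_contDiffOn hF1
    have h6 : ContDiffOn ℝ ∞ (fun p => (β p)⁻¹) (cylinder m) := hβ.inv fun p hp => (hβpos p hp).ne'
    exact (contDiff_snd.contDiffOn.smul hR).add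
      (((h4.mul h6).mul ((contDiffOn_const.add h5).div_const 2)).smul h3)
  · by_cases h0 : z = 0
    · rw [h0, flatCone_zero, coneFrame, if_pos rfl, add_zero]
    · have hp := polar_mem hz
      have hz2 := polar_snd_pos h0
      have hFz := hFβ _ hp
      rw [coneFrame_eq h0 (hFz ▸ (mul_pos hz2 (hβpos _ hp)).ne')]
      have h1 : ((F (polar z)).1, (V i (polar z)).1) = (incl m (m + M) (polar z).1, stdVec m M i) +
          flatExp (polar z).2 • ((E (polar z)).1, (B (polar z)).1) := by
        rw [hF _ hp, hV _ hp]
        rfl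
      have h3 : (V i (polar z)).2 = flatExp (polar z).2 * (B (polar z)).2 := by
        rw [hV _ hp]
        exact zero_add _
      rw [h1, hQ _ hp, hemiFrame_orthogonal (inner_incl_stdVec _ _), add_assoc, h3, hFz, flatCone]
      have e1 : nrm z = (polar z).2 := rfl
      have hβ0 := (hβpos _ hp).ne'
      congr 1
      rw [e1, pow_one, smul_add, smul_smul, smul_smul]
      congr 2
      · field_simp
      · field_simp

theorem RevConc.isFramedEmbedding_cone_inter (h : RevConc m q M a w F V) :
    IsFramedEmbedding (halfDisk m ∩ {0}ᶜ) (fun z => cone (F (polar z)))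
      (fun i z => ((F (polar z)).2⁻¹ * ((1 + ‖(F (polar z)).1‖ ^ 2) / 2)) •
        fderiv ℝ cone (F (polar z)) (V i (polar z))) := by
  have hpos : ∀ z ∈ halfDisk m ∩ {0}ᶜ, 0 < (F (polar z)).2 := fun z hz =>
    h.height_pos (polar_mem hz.1) (polar_snd_pos hz.2)
  have hgood : ∀ z ∈ halfDisk m ∩ {0}ᶜ, 0 < nrm z + z.2 := fun z hz =>
    nrm_add_snd_pos hz.2 hz.1.2
  have hop : IsOpen {z : Eucl m × ℝ | 0 < nrm z + z.2} :=
    isOpen_lt continuous_const (continuous_nrm.add continuous_snd)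
  have hgood' : ∀ {k : ℕ} (p : Eucl k × ℝ), 0 < p.2 → 0 < nrm (cone p) + (cone p).2 := fun p hp => by
    rw [cone]
    exact nrm_add_snd_smul_pos (nrm_add_snd_hemi_pos _) hp
  have hm : MapsTo polar (halfDisk m ∩ {0}ᶜ) (cylinder m) := fun z hz => polar_mem hz.1
  have hFp : ContDiffOn ℝ ∞ (fun z => F (polar z)) (halfDisk m ∩ {0}ᶜ) :=
    h.emb.smooth.comp (fun z hz => (contDiffAt_polar (hgood z hz)).contDiffWithinAt) hm
  have h2 : ContDiff ℝ ∞ (fun y : Eucl (m + M) => ‖y‖ ^ 2) := contDiff_norm_sq ℝ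
  exact h.emb.push (uniqueDiffOn_halfDisk.inter isOpen_compl_singleton) (Φ := polar) (Φi := cone)
    (Ψ := cone) (Ψi := polar) (c := fun z => (F (polar z)).2⁻¹ * ((1 + ‖(F (polar z)).1‖ ^ 2) / 2))
    hm (fun z hz => contDiffAt_polar (hgood z hz))
    (fun _ _ => (contDiff_cone.differentiable (by simp)).differentiableAt)
    (fun z hz => by filter_upwards [hop.mem_nhds (hgood z hz)] with y hy using cone_polar hy)
    (fun _ _ => contDiff_cone.contDiffAt)
    (fun z hz => (contDiffAt_polar (hgood' _ (hpos z hz))).differentiableAt (by simp))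
    (fun z hz => by
      filter_upwards [(isOpen_lt continuous_const continuous_snd).mem_nhds (hpos z hz)] with y hy
        using polar_cone hy)
    (((contDiff_snd.comp_contDiffOn hFp).inv fun z hz => (hpos z hz).ne').mul
      ((contDiffOn_const.add (h2.comp_contDiffOn (contDiff_fst.comp_contDiffOn hFp))).div_const 2))
    (fun z hz => mul_ne_zero (inv_ne_zero (hpos z hz).ne') (by positivity))

/-- A concordance which is standard to infinite order at height `0` blows down to a framed
embedding. -/
theorem RevConc.isFramedEmbedding_cone (h : RevConc m q M a w F V)
    {E : Eucl m × ℝ → Eucl (m + M) × ℝ} (hE : ContDiffOn ℝ ∞ E (cylinder m))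
    (hF : ∀ p ∈ cylinder m, F p = (incl m (m + M) p.1, p.2) + flatExp p.2 • E p)
    {B : Fin M → Eucl m × ℝ → Eucl (m + M) × ℝ} (hB : ∀ i, ContDiffOn ℝ ∞ (B i) (cylinder m))
    (hV : ∀ i, ∀ p ∈ cylinder m, V i p = (stdVec m M i, 0) + flatExp p.2 • B i p) :
    IsFramedEmbedding (halfDisk m) (fun z => cone (F (polar z))) (coneFrame F V) := by
  obtain ⟨R, hR, hR'⟩ := h.exists_cone_eq hE hF
  have hfr := fun i => h.exists_coneFrame_eq hE hF i (hB i) (hV i)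
  have h00 := h.map_zero 0 (mem_disk.2 (by simp))
  have hc0 : cone (F (polar (0 : Eucl m × ℝ))) = 0 := by
    rw [polar_zero, h00, cone, zero_smul]
  have hpos : ∀ z ∈ halfDisk m, z ≠ 0 → cone (F (polar z)) ≠ 0 := fun z hz h0 => by
    have h1 := h.height_pos (polar_mem hz) (polar_snd_pos h0)
    rw [← nrm_pos, nrm_cone h1.le]
    exact h1
  constructor
  · exact ((inclProdL m (m + M)).contDiff.contDiffOn.add (contDiffOn_flatCone 0 hR)).congr hR'
  · intro z hz z' hz' hzz
    by_cases h0 : z = 0 <;> by_cases h0' : z' = 0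
    · rw [h0, h0']
    · simp only [h0, hc0] at hzz
      exact absurd hzz.symm (hpos z' hz' h0')
    · simp only [h0', hc0] at hzz
      exact absurd hzz (hpos z hz h0)
    · exact h.isFramedEmbedding_cone_inter.injOn ⟨hz, h0⟩ ⟨hz', h0'⟩ hzz
  · intro i
    obtain ⟨R, hR, hR'⟩ := hfr i
    exact (contDiffOn_const.add (contDiffOn_flatCone 1 hR)).congr hR'
  · intro z hz
    by_cases h0 : z = 0
    · subst h0
      -- The flat error has derivative zero at the origin, so the derivative of the blow down is the
      -- linear inclusion itself.
      have hd : HasFDerivWithinAt (fun z => cone (F (polar z))) (inclProdL m (m + M))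
          (halfDisk m) 0 := by
        have h1 := ((inclProdL m (m + M)).hasFDerivWithinAt (s := halfDisk m) (x := 0)).add
          (hasFDerivWithinAt_flatCone_zero 0 hR.continuousOn)
        rw [add_zero] at h1
        exact h1.congr hR' (hR' 0 hz)
      rw [hd.fderivWithin (uniqueDiffOn_halfDisk 0 hz)]
      have e1 : ∀ y, inclProdL m (m + M) (y, 0) = (incl m (m + M) y, 0) := fun y => by
        simp [inclProdL]
      have e2 : (inclProdL m (m + M) (0, 1)).2 ≠ 0 := by simp [inclProdL]
      have e3 : ∀ i, coneFrame F V i 0 = (stdVec m M i, 0) := fun i => by rw [coneFrame, if_pos rfl]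
      exact bijective_frame_standard (v := fun i => coneFrame F V i 0) e1 e2 e3
    · have e : ∀ x ∈ halfDisk m ∩ {0}ᶜ, ∀ i, coneFrame F V i x =
          ((F (polar x)).2⁻¹ * ((1 + ‖(F (polar x)).1‖ ^ 2) / 2)) •
            fderiv ℝ cone (F (polar x)) (V i (polar x)) := fun x hx i => by
        have h3 : x ≠ 0 := hx.2
        rw [coneFrame, if_neg h3]
      have e' : ∀ x ∈ halfDisk m ∩ {0}ᶜ, cone (F (polar x)) = cone (F (polar x)) := fun _ _ => rfl
      have hi := h.isFramedEmbedding_cone_inter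
      exact hi.complement_congr isOpen_compl_singleton e' e ⟨hz, h0⟩

/-- The framing of a blown down concordance on the flat face. -/
theorem RevConc.coneFrame_flat (h : RevConc m q M a w F V) {z : Eucl m × ℝ} (hz : z ∈ halfDisk m)
    (h0 : z ≠ 0) (h2 : z.2 = 0) (i : Fin M) : coneFrame F V i z =
      ((V i (polar z)).1 + ((V i (polar z)).2 * (F (polar z)).2⁻¹) • (F (polar z)).1, 0) := by
  have hp := polar_mem hz
  have h1 : ‖(polar z).1‖ = 1 := norm_dir_eq_one h0 h2
  have h3 := h.side_norm _ hp h1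
  have h4 := h.height_pos hp (polar_snd_pos h0)
  have h5 : hemi (F (polar z)).1 = ((F (polar z)).1, 0) := by
    rw [hemi, h3]
    norm_num
  -- On the side the position has norm one, where `hemi` is the horizontal inclusion and the
  -- conformal factor is one; tangency of the frame permits `hemiFrame_orthogonal`.
  rw [coneFrame_eq h0 h4.ne', hemiFrame_orthogonal (by
    rw [real_inner_comm]; exact h.side_tangent _ hp h1 i), h5, h3]
  refine Prod.ext ?_ ?_
  · norm_num
  · norm_num

/-- A concordance which is standard to infinite order at height `0` blows down to a slice disk. -/
theorem RevConc.swapSlice (h : RevConc m q M a w F V) {E : Eucl m × ℝ → Eucl (m + M) × ℝ}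
    (hE : ContDiffOn ℝ ∞ E (cylinder m))
    (hF : ∀ p ∈ cylinder m, F p = (incl m (m + M) p.1, p.2) + flatExp p.2 • E p)
    {B : Fin M → Eucl m × ℝ → Eucl (m + M) × ℝ} (hB : ∀ i, ContDiffOn ℝ ∞ (B i) (cylinder m))
    (hV : ∀ i, ∀ p ∈ cylinder m, V i p = (stdVec m M i, 0) + flatExp p.2 • B i p) :
    SwapSlice m q M a w (fun z => cone (F (polar z))) (coneFrame F V) := by
  have h00 := h.map_zero 0 (mem_disk.2 (by simp))
  have hc0 : cone (F (polar (0 : Eucl m × ℝ))) = 0 := by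
    rw [polar_zero, h00, cone, zero_smul]
  have hn0 : nrm (0 : Eucl (m + M) × ℝ) = 0 := nrm_eq_zero.2 rfl
  have hside : ∀ z ∈ halfDisk m, z ≠ 0 → z.2 = 0 → ‖(polar z).1‖ = 1 := fun z _ h0 h2 =>
    norm_dir_eq_one h0 h2
  refine ⟨h.isFramedEmbedding_cone hE hF hB hV, ?_, ?_, ?_, ?_, ?_, ?_, ?_, ?_, ?_⟩
  · intro z hz h1
    by_cases h0 : z = 0
    · rw [h0, hc0, hn0]
      exact one_pos
    · have h2 := h.height_mem _ (polar_mem hz) ⟨polar_snd_pos h0, h1⟩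
      rw [nrm_cone h2.1.le]
      exact h2.2
  · intro z hz h2
    have h0 : z ≠ 0 := by
      rintro rfl
      exact lt_irrefl _ h2
    exact mul_pos (h.height_pos (polar_mem hz) (polar_snd_pos h0))
      (hemi_snd_pos.2 (h.norm_lt _ (polar_mem hz) (norm_dir_lt_one h2)))
  · intro x hx
    simp only [polar_hemi, h.map_one x hx, cone, one_smul]
  · intro x hx i
    rw [coneFrame, if_neg (hemi_ne_zero x), polar_hemi, h.map_one x hx, h.frame_one x hx, fderiv_cone]
    simp
  · intro z hz h2
    by_cases h0 : z = 0
    · rw [h0, hc0]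
      rfl
    · exact mul_eq_zero_of_right _ (hemi_snd_eq_zero.2
        (h.side_norm _ (polar_mem hz) (hside z hz h0 h2)))
  · intro z hz h2
    by_cases h0 : z = 0
    · rw [h0, hc0]
      exact Submodule.zero_mem _
    · exact Submodule.smul_mem _ _ (Submodule.smul_mem _ _
        (h.side_mem _ (polar_mem hz) (hside z hz h0 h2)))
  · intro z hz h2 i
    by_cases h0 : z = 0
    · rw [coneFrame, if_pos h0]
    · rw [h.coneFrame_flat hz h0 h2]
  · intro z hz h2 i hi
    by_cases h0 : z = 0
    · rw [coneFrame, if_pos h0]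
      intro j hj
      rw [stdVec, PiLp.single_apply, if_neg]
      rintro rfl
      simp only [Fin.val_natAdd] at hj
      omega
    · rw [h.coneFrame_flat hz h0 h2]
      have h1 := hside z hz h0 h2
      exact Submodule.add_mem _ (h.side_frame_mem _ (polar_mem hz) h1 i hi)
        (Submodule.smul_mem _ _ (h.side_mem _ (polar_mem hz) h1))
  · intro z hz h2 i hi
    by_cases h0 : z = 0
    · rw [coneFrame, if_pos h0]
    · rw [h.coneFrame_flat hz h0 h2, h.side_frame_std _ (polar_mem hz) (hside z hz h0 h2) i hi]
      simp

theorem RevConc.exists_swapSlice (h : RevConc m q M a w F V) : ∃ H V', SwapSlice m q M a w H V' := by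
  obtain ⟨F', V', h', ⟨E, hE, hF⟩, hV⟩ := h.exists_flat
  choose B hB hV using hV
  exact ⟨_, _, h'.swapSlice hE hF hB hV⟩

end Slice

/-! ### Paths of invertible operators -/

section LinearPath

variable {ι : Type} [Fintype ι]

/-- The map `y ↦ y - 2 ⟨v, y⟩ v`, the reflection in the hyperplane orthogonal to a unit vector. -/
def reflect (v : EuclideanSpace ℝ ι) : EuclideanSpace ℝ ι →L[ℝ] EuclideanSpace ℝ ι :=
  1 - (2 : ℝ) • (innerSL ℝ v).smulRight v

theorem reflect_apply (v y : EuclideanSpace ℝ ι) :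
    reflect v y = y - (2 : ℝ) • (inner ℝ v y : ℝ) • v := rfl

theorem reflect_mul_self {v : EuclideanSpace ℝ ι} (hv : ‖v‖ = 1) : reflect v * reflect v = 1 := by
  ext1 y
  have h : inner ℝ v v = (1 : ℝ) := by rw [real_inner_self_eq_norm_sq, hv, one_pow]
  rw [mul_apply_eq_comp, reflect_apply, reflect_apply, inner_sub_right, inner_smul_right,
    inner_smul_right, h, one_apply_eq_self]
  module

theorem isUnit_reflect {v : EuclideanSpace ℝ ι} (hv : ‖v‖ = 1) : IsUnit (reflect v) :=
  ⟨⟨reflect v, reflect v, reflect_mul_self hv, reflect_mul_self hv⟩, rfl⟩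

theorem contDiff_reflect : ContDiff ℝ ∞ (reflect (ι := ι)) := by
  unfold reflect
  exact contDiff_const.sub (((innerSL ℝ).contDiff.smulRight contDiff_id).const_smul (2 : ℝ))

variable [DecidableEq ι]

/-- There is a smooth path of invertible operators from `T` to the identity or to the reflection in
the coordinate `i₀`. -/
def HasLinearPath (i₀ : ι) (T : EuclideanSpace ℝ ι →L[ℝ] EuclideanSpace ℝ ι) : Prop :=
  ∃ B : ℝ → EuclideanSpace ℝ ι →L[ℝ] EuclideanSpace ℝ ι, ContDiff ℝ ∞ B ∧ (∀ t, IsUnit (B t)) ∧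
    B 0 = T ∧ (B 1 = 1 ∨ B 1 = reflect (EuclideanSpace.single i₀ 1))

variable {i₀ : ι}

theorem HasLinearPath.mul {S T : EuclideanSpace ℝ ι →L[ℝ] EuclideanSpace ℝ ι}
    (hS : HasLinearPath i₀ S) (hT : HasLinearPath i₀ T) : HasLinearPath i₀ (S * T) := by
  obtain ⟨B, hB, hBu, hB0, hB1⟩ := hS
  obtain ⟨C, hC, hCu, hC0, hC1⟩ := hT
  refine ⟨fun t => B t * C t, hB.mul hC, fun t => (hBu t).mul (hCu t), by simp only [hB0, hC0], ?_⟩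
  rcases hB1 with hB1 | hB1 <;> rcases hC1 with hC1 | hC1
  · exact Or.inl (by simp only [hB1, hC1, one_mul])
  · exact Or.inr (by simp only [hB1, hC1, one_mul])
  · exact Or.inr (by simp only [hB1, hC1, mul_one])
  · exact Or.inl (by
      simp only [hB1, hC1]
      exact reflect_mul_self (by simp))

theorem hasLinearPath_one : HasLinearPath i₀ 1 :=
  ⟨fun _ => 1, contDiff_const, fun _ => isUnit_one, rfl, Or.inl rfl⟩

/-- A straight or curved path in a line of matrices through the identity. -/
theorem hasLinearPath_of_line {X : Matrix ι ι ℝ} {f : ℝ → ℝ} (hf : ContDiff ℝ ∞ f) (h1 : f 1 = 0)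
    (hdet : ∀ t, (1 + f t • X).det ≠ 0) :
    HasLinearPath i₀ (Matrix.toEuclideanCLM (𝕜 := ℝ) (1 + f 0 • X)) := by
  refine ⟨fun t => Matrix.toEuclideanCLM (𝕜 := ℝ) (1 + f t • X), ?_, fun t => ?_, rfl, Or.inl ?_⟩
  · simp only [map_add, map_smul, map_one]
    exact contDiff_const.add (hf.smul contDiff_const)
  · exact ((Matrix.isUnit_iff_isUnit_det _).2 (hdet t).isUnit).map (Matrix.toEuclideanCLM (𝕜 := ℝ))
  · simp only [h1, zero_smul, add_zero, map_one]

theorem hasLinearPath_transvection (t : Matrix.TransvectionStruct ι ℝ) :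
    HasLinearPath i₀ (Matrix.toEuclideanCLM (𝕜 := ℝ) t.toMatrix) := by
  have h := hasLinearPath_of_line (i₀ := i₀) (X := Matrix.single t.i t.j (1 : ℝ))
    (f := fun s => (1 - s) * t.c) (by fun_prop) (by simp) (fun s => by
      rw [Matrix.smul_single, smul_eq_mul, mul_one]
      change (Matrix.transvection t.i t.j ((1 - s) * t.c)).det ≠ 0
      rw [Matrix.det_transvection_of_ne _ _ t.hij]
      exact one_ne_zero)
  rw [Matrix.smul_single, smul_eq_mul, mul_one, sub_zero, one_mul] at h
  exact h

theorem diagonal_update {ι : Type} [DecidableEq ι] (i : ι) (c : ℝ) : Matrix.diagonal (Function.update (1 : ι → ℝ) i c) =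
    1 + (c - 1) • Matrix.single i i (1 : ℝ) := by
  ext a b
  by_cases hab : a = b
  · subst hab
    by_cases hai : a = i
    · subst hai
      simp
    · simp [hai, Ne.symm hai]
  · have : ¬ (i = a ∧ i = b) := fun h => hab (h.1.symm.trans h.2)
    simp [hab, this]

theorem det_diagonal_update (i : ι) (c : ℝ) :
    (Matrix.diagonal (Function.update (1 : ι → ℝ) i c)).det = c := by
  rw [Matrix.det_diagonal, Finset.prod_update_of_mem (Finset.mem_univ i)]
  simp

/-- The entry moves along `c ^ (1 - s)`, which stays positive. -/
theorem hasLinearPath_scale_of_pos (i : ι) {c : ℝ} (hc : 0 < c) :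
    HasLinearPath i₀ (Matrix.toEuclideanCLM (𝕜 := ℝ)
      (Matrix.diagonal (Function.update (1 : ι → ℝ) i c))) := by
  have h := hasLinearPath_of_line (i₀ := i₀) (X := Matrix.single i i (1 : ℝ))
    (f := fun s => Real.exp ((1 - s) * Real.log c) - 1) (by fun_prop) (by simp) (fun s => by
      rw [← diagonal_update, det_diagonal_update]
      exact (Real.exp_pos _).ne')
  rwa [← diagonal_update, sub_zero, one_mul, Real.exp_log hc] at h

theorem toEuclideanCLM_diagonal (d : ι → ℝ) (y : EuclideanSpace ℝ ι) (j : ι) :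
    Matrix.toEuclideanCLM (𝕜 := ℝ) (Matrix.diagonal d) y j = d j * y j := by
  rw [Matrix.ofLp_toEuclideanCLM, Matrix.mulVec_diagonal]

theorem reflect_single_apply (i j : ι) (y : EuclideanSpace ℝ ι) :
    reflect (EuclideanSpace.single i 1) y j = Function.update (1 : ι → ℝ) i (-1) j * y j := by
  rw [reflect_apply, EuclideanSpace.inner_single_left]
  by_cases h : j = i
  · subst h
    simp
    ring
  · simp [h]

theorem toEuclideanCLM_reflection (i : ι) : Matrix.toEuclideanCLM (𝕜 := ℝ)
    (Matrix.diagonal (Function.update (1 : ι → ℝ) i (-1))) =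
      reflect (EuclideanSpace.single i 1) := by
  ext y j
  rw [toEuclideanCLM_diagonal, reflect_single_apply]

theorem hasLinearPath_reflect (i : ι) :
    HasLinearPath i₀ (reflect (EuclideanSpace.single i 1)) := by
  by_cases hi : i = i₀
  · subst hi
    refine ⟨fun _ => reflect (EuclideanSpace.single i 1), contDiff_const, fun _ => ?_, rfl,
      Or.inr rfl⟩
    exact isUnit_reflect (by simp)
  -- The normal of the mirror is rotated by a quarter turn from the coordinate `i` to the coordinate
  -- `i₀`, through unit vectors.
  · have hv : ∀ t : ℝ, ‖Real.cos (t * (Real.pi / 2)) • EuclideanSpace.single i (1 : ℝ) +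
        Real.sin (t * (Real.pi / 2)) • EuclideanSpace.single i₀ (1 : ℝ)‖ = 1 := fun t => by
      rw [← sq_eq_sq₀ (norm_nonneg _) zero_le_one, norm_add_sq_real, inner_smul_left,
        inner_smul_right, EuclideanSpace.inner_single_left, norm_smul, norm_smul]
      simp [hi]
    refine ⟨fun t => reflect (Real.cos (t * (Real.pi / 2)) • EuclideanSpace.single i (1 : ℝ) +
        Real.sin (t * (Real.pi / 2)) • EuclideanSpace.single i₀ (1 : ℝ)), ?_, fun t => ?_, ?_, ?_⟩
    · refine contDiff_reflect.comp ?_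
      exact ((Real.contDiff_cos.comp (contDiff_id.mul contDiff_const)).smul contDiff_const).add
        ((Real.contDiff_sin.comp (contDiff_id.mul contDiff_const)).smul contDiff_const)
    · exact isUnit_reflect (hv t)
    · simp
    · simp

theorem hasLinearPath_scale (i : ι) {c : ℝ} (hc : c ≠ 0) :
    HasLinearPath i₀ (Matrix.toEuclideanCLM (𝕜 := ℝ)
      (Matrix.diagonal (Function.update (1 : ι → ℝ) i c))) := by
  rcases hc.lt_or_gt with h | h
  · have h1 := (hasLinearPath_scale_of_pos (i₀ := i₀) i (neg_pos.2 h)).mul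
      (hasLinearPath_reflect (i₀ := i₀) i)
    rw [← toEuclideanCLM_reflection, ← map_mul, Matrix.diagonal_mul_diagonal] at h1
    refine (congrArg (fun d => HasLinearPath i₀ (Matrix.toEuclideanCLM (𝕜 := ℝ) (Matrix.diagonal d)))
      (funext fun j => ?_)).mp h1
    by_cases hj : j = i
    · subst hj
      simp
    · simp [hj]
  · exact hasLinearPath_scale_of_pos i h

theorem hasLinearPath_diagonal {d : ι → ℝ} (hd : ∀ i, d i ≠ 0) :
    HasLinearPath i₀ (Matrix.toEuclideanCLM (𝕜 := ℝ) (Matrix.diagonal d)) := by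
  have h : ∀ s : Finset ι, HasLinearPath i₀ (Matrix.toEuclideanCLM (𝕜 := ℝ)
      (Matrix.diagonal fun j => if j ∈ s then d j else 1)) := by
    intro s
    induction s using Finset.induction_on with
    | empty =>
      simpa using hasLinearPath_one (i₀ := i₀)
    | insert i s hi ih =>
      have h1 := (hasLinearPath_scale (i₀ := i₀) i (hd i)).mul ih
      rw [← map_mul, Matrix.diagonal_mul_diagonal] at h1
      refine (congrArg (fun d => HasLinearPath i₀ (Matrix.toEuclideanCLM (𝕜 := ℝ)
        (Matrix.diagonal d))) (funext fun j => ?_)).mp h1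
      by_cases hj : j = i
      · subst hj
        simp [hi]
      · simp [hj]
  simpa using h Finset.univ

/-- The group of invertible operators has at most two components, which are smoothly connected. -/
theorem hasLinearPath_of_isUnit (i₀ : ι) {T : EuclideanSpace ℝ ι →L[ℝ] EuclideanSpace ℝ ι}
    (hT : IsUnit T) : HasLinearPath i₀ T := by
  obtain ⟨A, rfl⟩ := (Matrix.toEuclideanCLM (n := ι) (𝕜 := ℝ)).surjective T
  have hA : IsUnit A := by
    simpa using hT.map (Matrix.toEuclideanCLM (n := ι) (𝕜 := ℝ)).symm
  -- Gaussian elimination into transvections and an invertible diagonal matrix. Products are allowed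
  -- because two reflections in the same coordinate cancel.
  refine Matrix.diagonal_transvection_induction_of_det_ne_zero
    (fun A => HasLinearPath i₀ (Matrix.toEuclideanCLM (𝕜 := ℝ) A)) A
    ((Matrix.isUnit_iff_isUnit_det A).1 hA).ne_zero (fun D hD => ?_)
    hasLinearPath_transvection (fun A B _ _ hA hB => ?_)
  · rw [Matrix.det_diagonal, Finset.prod_ne_zero_iff] at hD
    exact hasLinearPath_diagonal fun i => hD i (Finset.mem_univ i)
  · rw [map_mul]
    exact hA.mul hB

end LinearPath

/-! ### Extending operators by the identity -/

section Stabilize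

variable {a b : ℕ}

/-- The operator `C ⊕ 1` on `ℝ^b`, for an operator `C` on `ℝ^a`. -/
def stabilize (a b : ℕ) (C : Eucl a →L[ℝ] Eucl a) : Eucl b →L[ℝ] Eucl b :=
  1 + (incl a b).comp ((C - 1).comp (incl b a))

theorem stabilize_apply (C : Eucl a →L[ℝ] Eucl a) (y : Eucl b) :
    stabilize a b C y = y + incl a b (C (incl b a y) - incl b a y) := rfl

theorem incl_self (y : Eucl a) : incl a a y = y := by
  ext i
  rw [incl_apply, dif_pos i.2]

theorem incl_truncate (h : a ≤ b) (y : Eucl a) : incl b a (incl a b y) = y := by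
  rw [incl_incl h, incl_self]

theorem stabilize_incl (h : a ≤ b) (C : Eucl a →L[ℝ] Eucl a) (y : Eucl a) :
    stabilize a b C (incl a b y) = incl a b (C y) := by
  rw [stabilize_apply, incl_truncate h, map_sub, add_sub_cancel]

theorem truncate_stabilize (h : a ≤ b) (C : Eucl a →L[ℝ] Eucl a) (y : Eucl b) :
    incl b a (stabilize a b C y) = C (incl b a y) := by
  rw [stabilize_apply, map_add, incl_truncate h, add_sub_cancel]

theorem stabilize_stabilize (h : a ≤ b) {C D : Eucl a →L[ℝ] Eucl a} (hCD : C * D = 1) (y : Eucl b) :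
    stabilize a b C (stabilize a b D y) = y := by
  have h1 : C (D (incl b a y)) = incl b a y := DFunLike.congr_fun hCD _
  rw [stabilize_apply, truncate_stabilize h, h1, stabilize_apply, add_assoc, ← map_add]
  simp

theorem stabilize_mem {C : Eucl a →L[ℝ] Eucl a} {y : Eucl b} (hy : y ∈ inclRange a b) :
    stabilize a b C y ∈ inclRange a b :=
  Submodule.add_mem _ hy (incl_mem _)

theorem stabilize_of_truncate_eq_zero {C : Eucl a →L[ℝ] Eucl a} {y : Eucl b}
    (hy : incl b a y = 0) : stabilize a b C y = y := by
  rw [stabilize_apply, hy, map_zero, sub_zero, map_zero, add_zero]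

theorem contDiff_stabilize : ContDiff ℝ ∞ (stabilize a b) := by
  unfold stabilize
  exact contDiff_const.add (contDiff_const.clm_comp ((contDiff_id.sub contDiff_const).clm_comp
    contDiff_const))

theorem stabilize_one (y : Eucl b) : stabilize a b 1 y = y := by
  rw [stabilize_apply, one_apply_eq_self, sub_self, map_zero, add_zero]

theorem stabilize_reflect_apply (h : a ≤ b) (i : Fin a) (y : Eucl b) (j : Fin b) :
    stabilize a b (reflect (EuclideanSpace.single i 1)) y j =
      Function.update (1 : Fin b → ℝ) (Fin.castLE h i) (-1) j * y j := by
  rw [stabilize_apply, PiLp.add_apply, incl_apply]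
  by_cases hj : j.1 < a
  · rw [dif_pos hj, PiLp.sub_apply, reflect_single_apply, incl_apply, dif_pos j.2]
    by_cases hi : j = Fin.castLE h i
    · subst hi
      have e : y (Fin.castLE h i) = y ⟨i.1, i.2.trans_le h⟩ := rfl
      simp only [Fin.val_castLE, Fin.eta, Function.update_self, e]
      ring
    · have : (⟨j.1, hj⟩ : Fin a) ≠ i := fun h1 => hi (by rw [← h1]; rfl)
      simp [hi, this]
  · have : j ≠ Fin.castLE h i := fun h1 => hj (by rw [h1]; exact i.2)
    rw [dif_neg hj, Function.update_of_ne this]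
    simp

end Stabilize

/-! ### Making a tangent plane and its framing standard -/

section Straightening

variable {m q M : ℕ}

theorem truncate_stdVec {i : Fin M} (hi : q ≤ i.1) :
    incl (m + M) (m + q) (stdVec m M i) = 0 := by
  ext j
  rw [incl_apply, dif_pos (by have := j.2; omega), stdVec, PiLp.single_apply, if_neg]
  · rfl
  · intro h1
    have := congrArg Fin.val h1
    simp only [Fin.val_natAdd] at this
    have := j.2
    omega

/-- A smooth family of operators from one which makes the tangent plane `L` and the normal
vectors `v` standard to a reflection or the identity, respecting the flat face and its suspended
part. -/
structure Straightening (m q M : ℕ) (L : Eucl m × ℝ →L[ℝ] Eucl (m + M) × ℝ)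
    (v : Fin M → Eucl (m + M) × ℝ) (P Q : ℝ → Eucl (m + M) × ℝ →L[ℝ] Eucl (m + M) × ℝ)
    (d : Fin (m + M) → ℝ) : Prop where
  contDiff : ContDiff ℝ ∞ P
  contDiff_inv : ContDiff ℝ ∞ Q
  left_inv : ∀ t z, Q t (P t z) = z
  zero_map : ∀ z, P 0 (L z) = (incl m (m + M) z.1, z.2)
  zero_frame : ∀ i, P 0 (v i) = (stdVec m M i, 0)
  mem : ∀ t (z : Eucl (m + M) × ℝ), z.2 = 0 → z.1 ∈ inclRange (m + q) (m + M) →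
    (P t z).1 ∈ inclRange (m + q) (m + M)
  height : ∀ t, ∃ c : ℝ, 0 < c ∧ ∀ z, (P t z).2 = c * z.2
  std : ∀ t, ∀ i : Fin M, q ≤ i.1 → P t (stdVec m M i, 0) = (stdVec m M i, 0)
  one_fst : ∀ z j, (P 1 z).1 j = d j * z.1 j
  one_snd : ∀ z, (P 1 z).2 = z.2

/-- The operator `(y, h) ↦ (C y + c h u, e h)` on `ℝ^(m+M) × ℝ`. -/
def shearOp (C : Eucl (m + M) →L[ℝ] Eucl (m + M)) (c e : ℝ) (u : Eucl (m + M)) :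
    Eucl (m + M) × ℝ →L[ℝ] Eucl (m + M) × ℝ :=
  (ContinuousLinearMap.inl ℝ (Eucl (m + M)) ℝ).comp (C.comp
    (ContinuousLinearMap.fst ℝ (Eucl (m + M)) ℝ)) +
  (c • (ContinuousLinearMap.inl ℝ (Eucl (m + M)) ℝ).comp
    ((ContinuousLinearMap.snd ℝ (Eucl (m + M)) ℝ).smulRight u) +
  e • (ContinuousLinearMap.inr ℝ (Eucl (m + M)) ℝ).comp
    (ContinuousLinearMap.snd ℝ (Eucl (m + M)) ℝ))

theorem shearOp_apply (C : Eucl (m + M) →L[ℝ] Eucl (m + M)) (c e : ℝ) (u : Eucl (m + M))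
    (z : Eucl (m + M) × ℝ) : shearOp C c e u z = (C z.1 + (c * z.2) • u, e * z.2) := by
  refine Prod.ext ?_ ?_
  · simp [shearOp, mul_smul]
  · simp [shearOp]

theorem contDiff_shearOp {C : ℝ → Eucl (m + M) →L[ℝ] Eucl (m + M)} {c e : ℝ → ℝ}
    (hC : ContDiff ℝ ∞ C) (hc : ContDiff ℝ ∞ c) (he : ContDiff ℝ ∞ e) (u : Eucl (m + M)) :
    ContDiff ℝ ∞ fun t => shearOp (C t) (c t) (e t) u := by
  unfold shearOp
  exact (contDiff_const.clm_comp (hC.clm_comp contDiff_const)).add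
    ((hc.smul contDiff_const).add (he.smul contDiff_const))

theorem sum_castLE {A : Type} [AddCommMonoid A] (hq : q ≤ M) (f : Fin M → A)
    (hf : ∀ i, q ≤ i.1 → f i = 0) : ∑ i, f i = ∑ i : Fin q, f (Fin.castLE hq i) := by
  obtain ⟨k, rfl⟩ := Nat.exists_eq_add_of_le hq
  rw [Fin.sum_univ_add, Finset.sum_eq_zero (s := Finset.univ) (f := fun i => f (Fin.natAdd q i))
    fun i _ => hf _ (by simp), add_zero]
  rfl

/-- The horizontal part of `L` and the first `q` frame vectors form a basis of `ℝ^(m+q)`, the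
columns of `T`; the other frame vectors are standard, and only `L (0, 1)` has a height `w`. At time
zero `P` shears away the horizontal part of `L (0, 1)`, divides heights by `w` and applies the
inverse of `T`. The shear and the scaling are deformed to the identity, the inverse of `T` to the
identity or a reflection. Since the last path stays inside `ℝ^(m+q)` and is stabilized, the subspace
and the appended vectors are respected throughout. -/
theorem exists_straightening (hm : 0 < m) (hq : q ≤ M) {L : Eucl m × ℝ →L[ℝ] Eucl (m + M) × ℝ}
    {v : Fin M → Eucl (m + M) × ℝ} (hL : ∀ y, (L (y, 0)).2 = 0)
    (hLm : ∀ y, (L (y, 0)).1 ∈ inclRange (m + q) (m + M)) (hL1 : 0 < (L (0, 1)).2)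
    (hv : ∀ i, (v i).2 = 0) (hvm : ∀ i : Fin M, i.1 < q → (v i).1 ∈ inclRange (m + q) (m + M))
    (hvs : ∀ i : Fin M, q ≤ i.1 → v i = (stdVec m M i, 0))
    (hb : Function.Bijective
      (fun p : (Eucl m × ℝ) × (Fin M → ℝ) => L p.1 + ∑ i, p.2 i • v i)) :
    ∃ P Q d, Straightening m q M L v P Q d ∧
      (d = 1 ∨ d = Function.update (1 : Fin (m + M) → ℝ) ⟨0, Nat.add_pos_left hm M⟩ (-1)) := by
  have hqM : m + q ≤ m + M := Nat.add_le_add_left hq m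
  let T : Eucl (m + q) →L[ℝ] Eucl (m + q) := (incl (m + M) (m + q)).comp
    ((ContinuousLinearMap.fst ℝ _ ℝ).comp (L.comp
      ((ContinuousLinearMap.inl ℝ _ ℝ).comp (incl (m + q) m))) +
      ∑ i : Fin q, (EuclideanSpace.proj (Fin.natAdd m i) : Eucl (m + q) →L[ℝ] ℝ).smulRight
        (v (Fin.castLE hq i)).1)
  have hT : ∀ y, incl (m + q) (m + M) (T y) = (L (incl (m + q) m y, 0)).1 +
      ∑ i : Fin q, y (Fin.natAdd m i) • (v (Fin.castLE hq i)).1 := by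
    intro y
    have h1 : T y = incl (m + M) (m + q) ((L (incl (m + q) m y, 0)).1 +
        ∑ i : Fin q, y (Fin.natAdd m i) • (v (Fin.castLE hq i)).1) := by
      simp [T]
    rw [h1, incl_incl_of_mem]
    exact Submodule.add_mem _ (hLm _) (Submodule.sum_mem _ fun i _ =>
      Submodule.smul_mem _ _ (hvm _ i.2))
  have hTL : ∀ y, incl (m + q) (m + M) (T (incl m (m + q) y)) = (L (y, 0)).1 := by
    intro y
    rw [hT, incl_truncate (Nat.le_add_right m q)]
    simp [incl_apply]
  have hTv : ∀ i : Fin q, incl (m + q) (m + M) (T (stdVec m q i)) = (v (Fin.castLE hq i)).1 := by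
    intro i
    have h1 : incl (m + q) m (stdVec m q i) = 0 := truncate_stdVec (q := 0) (Nat.zero_le _)
    rw [hT, h1, Prod.mk_zero_zero, map_zero]
    simp [stdVec, PiLp.single_apply]
  have hTu : IsUnit T := by
    rw [ContinuousLinearMap.isUnit_iff_bijective]
    have h1 : Function.Injective T.toLinearMap := by
      rw [← LinearMap.ker_eq_bot, LinearMap.ker_eq_bot']
      intro y hy
      -- A kernel vector of `T` is a relation between `L` and the whole frame, with coefficient zero
      -- on the appended vectors.
      let c : Fin M → ℝ := fun i => if h : i.1 < q then y (Fin.natAdd m ⟨i.1, h⟩) else 0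
      have h2 : (L (incl (m + q) m y, 0)).1 + ∑ i, c i • (v i).1 = 0 := by
        rw [sum_castLE hq (fun i => c i • (v i).1) fun i hi => by simp [c, not_lt.2 hi]]
        have h3 := hT y
        rw [show T y = 0 from hy, map_zero] at h3
        rw [h3]
        simp only [c, Fin.val_castLE, Fin.is_lt, dif_pos, Fin.eta]
      have h3 := @hb.1 ((incl (m + q) m y, 0), c) 0 (by
        simp only [Prod.fst_zero, map_zero, Prod.snd_zero, Pi.zero_apply, zero_smul,
          Finset.sum_const_zero, add_zero]
        refine Prod.ext ?_ ?_
        · simpa [Prod.fst_sum] using h2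
        · simp [Prod.snd_sum, hL, hv])
      have h4 : incl (m + q) m y = 0 := congrArg (fun p => p.1.1) h3
      have h5 : c = 0 := congrArg Prod.snd h3
      ext j
      refine Fin.addCases (fun a => ?_) (fun b => ?_) j
      · have h6 := congrArg (fun x : Eucl m => x a) h4
        rw [incl_apply, dif_pos (by have := a.2; omega)] at h6
        exact h6
      · have h6 := congrFun h5 (Fin.castLE hq b)
        simp only [c, Fin.val_castLE, Fin.is_lt, dif_pos, Fin.eta] at h6
        exact h6
    exact ⟨h1, LinearMap.injective_iff_surjective.1 h1⟩
  obtain ⟨B, hB, hBu, hB0, hB1⟩ := hasLinearPath_of_isUnit (⟨0, Nat.add_pos_left hm q⟩ : Fin (m + q))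
    hTu.ringInverse
  set u := (L (0, 1)).1 with hu
  set w := (L (0, 1)).2 with hw
  have hLz : ∀ z : Eucl m × ℝ, L z = ((L (z.1, 0)).1 + z.2 • u, z.2 * w) := by
    intro z
    have h1 : z = (z.1, 0) + z.2 • (0, 1) := by
      refine Prod.ext ?_ ?_ <;> simp
    conv_lhs => rw [h1, map_add, map_smul]
    refine Prod.ext rfl ?_
    rw [Prod.snd_add, hL, zero_add]
    rfl
  have hB0T : ∀ y, B 0 (T y) = y := fun y => by
    rw [hB0]
    exact DFunLike.congr_fun (Ring.inverse_mul_cancel T hTu) y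
  have hexp : ∀ t : ℝ, Real.exp ((1 - t) * Real.log w) * Real.exp (-((1 - t) * Real.log w)) = 1 :=
    fun t => by rw [← Real.exp_add, add_neg_cancel, Real.exp_zero]
  -- The scaling is `w ^ (t - 1)`. As `L z` has height `z.2 * w`, the shear coefficient `(1 - t) /
  -- w` removes exactly `z.2 • u` at the start and nothing at the end.
  let P : ℝ → Eucl (m + M) × ℝ →L[ℝ] Eucl (m + M) × ℝ := fun t =>
    (shearOp (stabilize (m + q) (m + M) (B t)) 0 (Real.exp (-((1 - t) * Real.log w))) 0).comp
      (shearOp 1 (-((1 - t) * w⁻¹)) 1 u)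
  let Q : ℝ → Eucl (m + M) × ℝ →L[ℝ] Eucl (m + M) × ℝ := fun t =>
    (shearOp 1 ((1 - t) * w⁻¹) 1 u).comp
      (shearOp (stabilize (m + q) (m + M) (Ring.inverse (B t))) 0
        (Real.exp ((1 - t) * Real.log w)) 0)
  have hP : ∀ t z, P t z = (stabilize (m + q) (m + M) (B t) (z.1 - ((1 - t) * w⁻¹ * z.2) • u),
      Real.exp (-((1 - t) * Real.log w)) * z.2) := fun t z => by
    simp [P, shearOp_apply, sub_eq_add_neg]
  have hQ : ∀ t z, Q t z = (stabilize (m + q) (m + M) (Ring.inverse (B t)) z.1 +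
      ((1 - t) * w⁻¹ * (Real.exp ((1 - t) * Real.log w) * z.2)) • u,
      Real.exp ((1 - t) * Real.log w) * z.2) := fun t z => by
    simp [Q, shearOp_apply]
  obtain ⟨d, hd, hd1⟩ : ∃ d : Fin (m + M) → ℝ,
      (d = 1 ∨ d = Function.update (1 : Fin (m + M) → ℝ) ⟨0, Nat.add_pos_left hm M⟩ (-1)) ∧
      ∀ y j, stabilize (m + q) (m + M) (B 1) y j = d j * y j := by
    rcases hB1 with hB1 | hB1
    · exact ⟨1, Or.inl rfl, fun y j => by rw [hB1, stabilize_one, Pi.one_apply, one_mul]⟩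
    · exact ⟨_, Or.inr rfl, fun y j => by rw [hB1, stabilize_reflect_apply hqM]; rfl⟩
  refine ⟨P, Q, d, ⟨?_, ?_, ?_, ?_, ?_, ?_, ?_, ?_, ?_, ?_⟩, hd⟩
  · refine ContDiff.clm_comp ?_ ?_
    · exact contDiff_shearOp (contDiff_stabilize.comp hB) contDiff_const (by fun_prop) _
    · exact contDiff_shearOp contDiff_const (by fun_prop) contDiff_const _
  · refine ContDiff.clm_comp ?_ ?_
    · exact contDiff_shearOp contDiff_const (by fun_prop) contDiff_const _
    · refine contDiff_shearOp (contDiff_stabilize.comp ?_) contDiff_const (by fun_prop) _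
      rw [contDiff_iff_contDiffAt]
      intro t
      obtain ⟨x, hx⟩ := hBu t
      exact ContDiffAt.comp t (hx ▸ contDiffAt_ringInverse ℝ x) hB.contDiffAt
  · intro t z
    rw [hP, hQ]
    have h1 : Real.exp ((1 - t) * Real.log w) * (Real.exp (-((1 - t) * Real.log w)) * z.2) = z.2 := by
      rw [← mul_assoc, hexp, one_mul]
    simp only [h1]
    rw [stabilize_stabilize hqM (Ring.inverse_mul_cancel _ (hBu t)), sub_add_cancel]
  · intro z
    rw [hP, hLz]
    refine Prod.ext ?_ ?_
    · have h1 : (1 - (0 : ℝ)) * w⁻¹ * (z.2 * w) = z.2 := by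
        field_simp
        ring
      simp only [h1]
      rw [add_sub_cancel_right, ← hTL, stabilize_incl hqM, hB0T, incl_incl (Nat.le_add_right _ _)]
    · simp only [sub_zero, one_mul, Real.exp_neg, Real.exp_log hL1]
      field_simp
  · intro i
    rw [hP, hv, mul_zero, mul_zero, zero_smul, sub_zero]
    congr 1
    by_cases hi : i.1 < q
    · have h1 := hTv ⟨i.1, hi⟩
      rw [show Fin.castLE hq ⟨i.1, hi⟩ = i from rfl] at h1
      rw [← h1, stabilize_incl hqM, hB0T, incl_stdVec]
    · rw [hvs i (not_lt.1 hi)]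
      exact stabilize_of_truncate_eq_zero (truncate_stdVec (not_lt.1 hi))
  · intro t z hz hzm
    rw [hP, hz, mul_zero, zero_smul, sub_zero]
    exact stabilize_mem hzm
  · intro t
    exact ⟨_, Real.exp_pos _, fun z => by rw [hP]⟩
  · intro t i hi
    rw [hP]
    simp only [mul_zero, zero_smul, sub_zero]
    rw [stabilize_of_truncate_eq_zero (truncate_stdVec hi)]
  · intro z j
    rw [hP, hd1]
    simp
  · intro z
    rw [hP]
    simp

end Straightening

/-! ### The gauge of the ball seen from an interior point -/

section Gauge

variable {b : ℕ}

theorem ip_comm (z w : Eucl b × ℝ) : ip z w = ip w z := by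
  rw [ip, ip, real_inner_comm, mul_comm]

theorem ip_add_left (z z' w : Eucl b × ℝ) : ip (z + z') w = ip z w + ip z' w := by
  simp only [ip, Prod.fst_add, Prod.snd_add, inner_add_left]
  ring

theorem ip_add_right (z w w' : Eucl b × ℝ) : ip z (w + w') = ip z w + ip z w' := by
  rw [ip_comm, ip_add_left, ip_comm w, ip_comm w']

theorem ip_smul_right (c : ℝ) (z w : Eucl b × ℝ) : ip z (c • w) = c * ip z w := by
  simp only [ip, Prod.smul_fst, Prod.smul_snd, inner_smul_right, smul_eq_mul]
  ring

theorem ip_smul_left (c : ℝ) (z w : Eucl b × ℝ) : ip (c • z) w = c * ip z w := by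
  rw [ip_comm, ip_smul_right, ip_comm]

theorem ip_self (z : Eucl b × ℝ) : ip z z = nrm z ^ 2 := by
  rw [ip, nrm_sq, real_inner_self_eq_norm_sq, sq z.2]

theorem nrm_add_smul_sq (p k : Eucl b × ℝ) (c : ℝ) :
    nrm (p + c • k) ^ 2 = nrm p ^ 2 + 2 * c * ip p k + c ^ 2 * nrm k ^ 2 := by
  rw [← ip_self, ip_add_left, ip_add_right, ip_add_right, ip_smul_right, ip_smul_left, ip_smul_left,
    ip_smul_right, ip_self, ip_self, ip_comm k p]
  ring

theorem contDiff_ip {E : Type} [NormedAddCommGroup E] [NormedSpace ℝ E] {f g : E → Eucl b × ℝ}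
    (hf : ContDiff ℝ ∞ f) (hg : ContDiff ℝ ∞ g) : ContDiff ℝ ∞ fun x => ip (f x) (g x) :=
  ((contDiff_fst.comp hf).inner ℝ (contDiff_fst.comp hg)).add
    ((contDiff_snd.comp hf).mul (contDiff_snd.comp hg))

/-- The gauge of the unit ball seen from its interior point `p`. -/
def ballGauge (x : (Eucl b × ℝ) × Eucl b × ℝ) : ℝ :=
  (ip x.1 x.2 + √(ip x.1 x.2 ^ 2 + nrm x.2 ^ 2 * (1 - nrm x.1 ^ 2))) / (1 - nrm x.1 ^ 2)

variable {p k : Eucl b × ℝ}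

theorem one_sub_nrm_sq_pos (hp : nrm p < 1) : 0 < 1 - nrm p ^ 2 := by
  rw [sub_pos, sq_lt_one_iff₀ (nrm_nonneg p)]
  exact hp

theorem abs_ip_lt_sqrt (hp : nrm p < 1) (hk : k ≠ 0) :
    |ip p k| < √(ip p k ^ 2 + nrm k ^ 2 * (1 - nrm p ^ 2)) := by
  have h1 := one_sub_nrm_sq_pos hp
  have h2 := nrm_pos.2 hk
  rw [Real.lt_sqrt (abs_nonneg _), sq_abs]
  have : 0 < nrm k ^ 2 * (1 - nrm p ^ 2) := by positivity
  linarith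

theorem ballGauge_pos (hp : nrm p < 1) (hk : k ≠ 0) : 0 < ballGauge (p, k) := by
  refine div_pos ?_ (one_sub_nrm_sq_pos hp)
  have := abs_ip_lt_sqrt hp hk
  have := neg_abs_le (ip p k)
  simp only
  linarith

theorem ballGauge_mul (hp : nrm p < 1) : (1 - nrm p ^ 2) * ballGauge (p, k) =
    ip p k + √(ip p k ^ 2 + nrm k ^ 2 * (1 - nrm p ^ 2)) :=
  mul_div_cancel₀ _ (one_sub_nrm_sq_pos hp).ne'

/-- The condition that `p + r⁻¹ • k` lies on the unit sphere is a quadratic equation for `r`;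
`ballGauge` is written as its positive root. -/
theorem ballGauge_quadratic (hp : nrm p < 1) :
    (1 - nrm p ^ 2) * ballGauge (p, k) ^ 2 - 2 * ip p k * ballGauge (p, k) - nrm k ^ 2 = 0 := by
  have h1 := one_sub_nrm_sq_pos hp
  have h2 : 0 ≤ ip p k ^ 2 + nrm k ^ 2 * (1 - nrm p ^ 2) := by positivity
  have h3 := Real.sq_sqrt h2
  have h4 := ballGauge_mul (k := k) hp
  rw [← sub_eq_iff_eq_add'] at h4
  rw [← h4] at h3
  have h5 : (1 - nrm p ^ 2) * ((1 - nrm p ^ 2) * ballGauge (p, k) ^ 2 -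
      2 * ip p k * ballGauge (p, k) - nrm k ^ 2) = 0 := by linear_combination h3
  exact (mul_eq_zero.1 h5).resolve_left h1.ne'

/-- Where the ray from `p` in the direction `k` leaves the unit ball. -/
theorem nrm_ray_sub_one (hp : nrm p < 1) (hk : k ≠ 0) {r : ℝ} (hr : 0 < r) :
    ∃ c : ℝ, 0 < c ∧ 1 - nrm (p + r⁻¹ • k) ^ 2 = c * (r - ballGauge (p, k)) := by
  -- The cofactor left when the quadratic polynomial is divided by its root. It is positive because
  -- `(1 - nrm p ^ 2) * ballGauge (p, k)` already exceeds `2 * ip p k`.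
  refine ⟨((1 - nrm p ^ 2) * (r + ballGauge (p, k)) - 2 * ip p k) / r ^ 2, ?_, ?_⟩
  · refine div_pos ?_ (by positivity)
    have h1 := ballGauge_mul (k := k) hp
    have h2 := abs_ip_lt_sqrt hp hk
    have h3 := le_abs_self (ip p k)
    have h4 := mul_pos (one_sub_nrm_sq_pos hp) hr
    linarith
  · have h1 := ballGauge_quadratic (k := k) hp
    rw [nrm_add_smul_sq]
    field_simp
    linear_combination h1

theorem ballGauge_lt_iff (hp : nrm p < 1) (hk : k ≠ 0) {r : ℝ} (hr : 0 < r) :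
    ballGauge (p, k) < r ↔ nrm (p + r⁻¹ • k) < 1 := by
  obtain ⟨c, hc, h⟩ := nrm_ray_sub_one hp hk hr
  rw [← sq_lt_one_iff₀ (nrm_nonneg _), ← sub_pos, ← sub_pos (b := nrm (p + r⁻¹ • k) ^ 2), h,
    mul_pos_iff_of_pos_left hc]

theorem ballGauge_eq_iff (hp : nrm p < 1) (hk : k ≠ 0) {r : ℝ} (hr : 0 < r) :
    ballGauge (p, k) = r ↔ nrm (p + r⁻¹ • k) = 1 := by
  obtain ⟨c, hc, h⟩ := nrm_ray_sub_one hp hk hr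
  rw [← sq_eq_sq₀ (nrm_nonneg _) zero_le_one, one_pow, eq_comm, ← sub_eq_zero,
    eq_comm (a := nrm (p + r⁻¹ • k) ^ 2), ← sub_eq_zero (b := nrm (p + r⁻¹ • k) ^ 2), h, mul_eq_zero,
    or_iff_right hc.ne']

theorem ballGauge_smul {c : ℝ} (hc : 0 ≤ c) (p k : Eucl b × ℝ) :
    ballGauge (p, c • k) = c * ballGauge (p, k) := by
  simp only [ballGauge, ip_smul_right, nrm_smul hc]
  have : (c * ip p k) ^ 2 + (c * nrm k) ^ 2 * (1 - nrm p ^ 2) =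
      c ^ 2 * (ip p k ^ 2 + nrm k ^ 2 * (1 - nrm p ^ 2)) := by ring
  rw [this, Real.sqrt_mul (sq_nonneg c), Real.sqrt_sq hc]
  ring

theorem contDiffAt_ballGauge (hp : nrm p < 1) (hk : k ≠ 0) :
    ContDiffAt ℝ ∞ (ballGauge (b := b)) (p, k) := by
  unfold ballGauge
  have h1 : ContDiff ℝ ∞ fun x : (Eucl b × ℝ) × Eucl b × ℝ => ip x.1 x.2 :=
    contDiff_ip contDiff_fst contDiff_snd
  have h2 : ContDiff ℝ ∞ fun x : (Eucl b × ℝ) × Eucl b × ℝ => nrm x.1 ^ 2 := by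
    simp only [← ip_self]
    exact contDiff_ip contDiff_fst contDiff_fst
  have h3 : ContDiff ℝ ∞ fun x : (Eucl b × ℝ) × Eucl b × ℝ => nrm x.2 ^ 2 := by
    simp only [← ip_self]
    exact contDiff_ip contDiff_snd contDiff_snd
  have h4 := contDiff_const (c := (1 : ℝ)).sub h2
  refine ContDiffAt.div ?_ h4.contDiffAt (one_sub_nrm_sq_pos hp).ne'
  refine h1.contDiffAt.add (((h1.pow 2).add (h3.mul h4)).contDiffAt.sqrt ?_)
  exact (Real.sqrt_pos.1 ((abs_nonneg _).trans_lt (abs_ip_lt_sqrt hp hk))).ne'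

theorem contDiffAt_ballGauge_right (hp : nrm p < 1) (hk : k ≠ 0) :
    ContDiffAt ℝ ∞ (fun k => ballGauge (p, k)) k :=
  (contDiffAt_ballGauge hp hk).comp k (contDiffAt_const.prodMk contDiffAt_id)

theorem hasDerivAt_ip_line (p k e : Eucl b × ℝ) :
    HasDerivAt (fun t : ℝ => ip p (k + t • e)) (ip p e) 0 := by
  simp only [ip_add_right, ip_smul_right]
  simpa using ((hasDerivAt_id (0 : ℝ)).mul_const (ip p e)).const_add (ip p k)

theorem hasDerivAt_nrm_sq_line (k e : Eucl b × ℝ) :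
    HasDerivAt (fun t : ℝ => nrm (k + t • e) ^ 2) (2 * ip k e) 0 := by
  simp only [nrm_add_smul_sq]
  have h := ((((hasDerivAt_id (0 : ℝ)).const_mul 2).mul_const (ip k e)).const_add (nrm k ^ 2)).add
    (((hasDerivAt_id (0 : ℝ)).pow 2).mul_const (nrm e ^ 2))
  refine h.congr_deriv ?_
  simp

/-- The gauge is stationary in the directions tangent to its level sets. -/
theorem hasDerivAt_ballGauge_line (hp : nrm p < 1) (hk : k ≠ 0) {e : Eucl b × ℝ}
    (h : ip p e * ballGauge (p, k) + ip k e = 0) :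
    HasDerivAt (fun t : ℝ => ballGauge (p, k + t • e)) 0 0 := by
  have h1 : DifferentiableAt ℝ (fun t : ℝ => ballGauge (p, k + t • e)) 0 := by
    have h2 : DifferentiableAt ℝ (fun k => ballGauge (p, k)) (k + (0 : ℝ) • e) := by
      rw [zero_smul, add_zero]
      exact (contDiffAt_ballGauge_right hp hk).differentiableAt (by simp)
    exact DifferentiableAt.comp (f := fun t : ℝ => k + t • e) (0 : ℝ) h2 (by fun_prop)
  have h2 := h1.hasDerivAt
  set d := deriv (fun t : ℝ => ballGauge (p, k + t • e)) 0
  have h3 := (((h2.pow 2).const_mul (1 - nrm p ^ 2)).sub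
    (((hasDerivAt_ip_line p k e).const_mul 2).mul h2)).sub (hasDerivAt_nrm_sq_line k e)
  have h4 := h3.unique ((hasDerivAt_const (0 : ℝ) (0 : ℝ)).congr_of_eventuallyEq
    (Eventually.of_forall fun t => ballGauge_quadratic hp))
  simp only [zero_smul, add_zero, Nat.cast_ofNat, Nat.add_one_sub_one, pow_one] at h4
  -- The derivative of the quadratic equation. The factor of `d` is the square root in `ballGauge`,
  -- nonzero because the root is simple.
  have h5 : d * ((1 - nrm p ^ 2) * ballGauge (p, k) - ip p k) = 0 := by
    linear_combination (1 / 2) * h4 + h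
  have h6 : 0 < (1 - nrm p ^ 2) * ballGauge (p, k) - ip p k := by
    rw [ballGauge_mul hp, add_sub_cancel_left]
    exact (abs_nonneg _).trans_lt (abs_ip_lt_sqrt hp hk)
  rw [(mul_eq_zero.1 h5).resolve_right h6.ne'] at h2
  exact h2

end Gauge

/-! ### Blow-up coordinates of the ball at an interior point -/

section BlowUp

variable {b : ℕ}

/-- The point in the direction of which `blowUp` looks. -/
def blowCore (p : Eucl b × ℝ) (P : ℝ → Eucl b × ℝ →L[ℝ] Eucl b × ℝ) (x : (Eucl b × ℝ) × ℝ) :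
    Eucl b × ℝ :=
  P (x.2 * ballGauge (p, x.1)) (x.1 + (x.2 * ballGauge (p, x.1) ^ 2) • p)

/-- Coordinates of the point `p + x.2 • x.1` of the unit ball in the blow-up of the ball at `p`; they
are standard at the boundary of the ball and twisted by the operators `P` inside. -/
def blowUp (p : Eucl b × ℝ) (P : ℝ → Eucl b × ℝ →L[ℝ] Eucl b × ℝ) (x : (Eucl b × ℝ) × ℝ) :
    Eucl b × ℝ :=
  (dir (blowCore p P x), x.2 * ballGauge (p, x.1))

/-- The inverse of `blowUp p P (·, 1)`. -/
def blowInv (p : Eucl b × ℝ) (Q : ℝ → Eucl b × ℝ →L[ℝ] Eucl b × ℝ) (y : Eucl b × ℝ) : Eucl b × ℝ :=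
  (y.2 / ballGauge ((1 - y.2) • p, Q y.2 (hemi y.1))) • Q y.2 (hemi y.1) - y.2 ^ 2 • p

variable {p k : Eucl b × ℝ} {P Q : ℝ → Eucl b × ℝ →L[ℝ] Eucl b × ℝ} {ρ : ℝ}

theorem contDiffAt_blowCore (hP : ContDiff ℝ ∞ P) (hp : nrm p < 1) (hk : k ≠ 0) :
    ContDiffAt ℝ ∞ (blowCore p P) (k, ρ) := by
  have h1 : ContDiffAt ℝ ∞ (fun x : (Eucl b × ℝ) × ℝ => ballGauge (p, x.1)) (k, ρ) :=
    (contDiffAt_ballGauge_right hp hk).comp (k, ρ) contDiffAt_fst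
  have h2 : ContDiffAt ℝ ∞ (fun x : (Eucl b × ℝ) × ℝ => P (x.2 * ballGauge (p, x.1))) (k, ρ) :=
    hP.contDiffAt.comp (k, ρ) (contDiffAt_snd.mul h1)
  exact h2.clm_apply (contDiffAt_fst.add ((contDiffAt_snd.mul (h1.pow 2)).smul contDiffAt_const))

theorem contDiffAt_blowUp (hP : ContDiff ℝ ∞ P) (hp : nrm p < 1) (hk : k ≠ 0)
    (hc : 0 < nrm (blowCore p P (k, ρ)) + (blowCore p P (k, ρ)).2) :
    ContDiffAt ℝ ∞ (blowUp p P) (k, ρ) := by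
  have h1 : ContDiffAt ℝ ∞ (fun x : (Eucl b × ℝ) × ℝ => ballGauge (p, x.1)) (k, ρ) :=
    (contDiffAt_ballGauge_right hp hk).comp (k, ρ) contDiffAt_fst
  exact ((contDiffAt_dir hc).comp (k, ρ) (contDiffAt_blowCore hP hp hk)).prodMk
    (contDiffAt_snd.mul h1)

/-- For `z = p + ρ • k` of radius `r = ρ * ballGauge (p, k)`, both sides are `P r (z - (1 - r ^ 2) •
p)`. The centre of vision moves from `p` to the origin of the ball, so that on the sphere the
direction is that of `z`; the square makes the shift vanish at `ρ = 0` even after division by `ρ`.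
-/
theorem blowCore_smul (hρ : 0 < ρ) : blowCore p P (ρ • k, 1) = ρ • blowCore p P (k, ρ) := by
  simp only [blowCore, ballGauge_smul hρ.le, one_mul]
  rw [← map_smul, smul_add, smul_smul]
  congr 3
  ring

/-- For `ρ > 0` the coordinates depend only on the point `p + ρ • k`. The pair `(k, ρ)` is kept
because in this form they extend smoothly to `ρ = 0`. -/
theorem blowUp_smul (hρ : 0 < ρ) : blowUp p P (ρ • k, 1) = blowUp p P (k, ρ) := by
  rw [blowUp, blowUp, blowCore_smul hρ, dir_smul hρ]
  simp only [ballGauge_smul hρ.le, one_mul]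

theorem blowCore_smul_pos (hρ : 0 < ρ)
    (hc : 0 < nrm (blowCore p P (k, ρ)) + (blowCore p P (k, ρ)).2) :
    0 < nrm (blowCore p P (ρ • k, 1)) + (blowCore p P (ρ • k, 1)).2 := by
  rw [blowCore_smul hρ]
  exact nrm_add_snd_smul_pos hc hρ

/-- With `u` the recovered direction, `k = c • u - r ^ 2 • p` for some `c`. That `k` has gauge `r`
means that `p + r⁻¹ • k = (1 - r) • p + (c / r) • u` is on the unit sphere, so `r / c` is the gauge
of `u` seen from the interior point `(1 - r) • p`. -/
theorem blowInv_blowUp (hPQ : ∀ t z, Q t (P t z) = z) (hp : nrm p < 1) (hk : k ≠ 0)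
    (hc : 0 < nrm (blowCore p P (k, 1)) + (blowCore p P (k, 1)).2)
    (hr : nrm ((1 - ballGauge (p, k)) • p) < 1) : blowInv p Q (blowUp p P (k, 1)) = k := by
  have hμ := ballGauge_pos hp hk
  have hc0 : blowCore p P (k, 1) ≠ 0 := fun h0 => by simp [h0, nrm] at hc
  set r := ballGauge (p, k) with hrdef
  have hn := inv_pos.2 (nrm_pos.2 hc0)
  set l := (nrm (blowCore p P (k, 1)))⁻¹
  have hcore : blowCore p P (k, 1) = P r (k + r ^ 2 • p) := by
    simp only [blowCore, one_mul, hrdef]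
  have hx0 : k + r ^ 2 • p ≠ 0 := fun h0 => hc0 (by rw [hcore, h0, map_zero])
  have h1 : Q r (hemi (dir (blowCore p P (k, 1)))) = l • (k + r ^ 2 • p) := by
    rw [hemi_dir hc, map_smul]
    conv_lhs => rw [hcore, hPQ]
    rw [← hcore]
  have h2 : ballGauge ((1 - r) • p, k + r ^ 2 • p) = r := by
    rw [ballGauge_eq_iff hr hx0 hμ]
    have h3 := (ballGauge_eq_iff hp hk hμ).1 rfl
    have h4 : r⁻¹ * r ^ 2 = r := by field_simp
    have h5 : (1 - r) • p + r⁻¹ • (k + r ^ 2 • p) = p + r⁻¹ • k := by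
      rw [smul_add, smul_smul, h4]
      module
    rw [h5, h3]
  simp only [blowInv, blowUp, one_mul, ← hrdef, h1, ballGauge_smul hn.le, h2, smul_smul]
  have h5 : r / (l * r) * l = 1 := by field_simp
  rw [h5, one_smul, add_sub_cancel_right]

theorem eventually_blowInv_blowUp (hP : ContDiff ℝ ∞ P) (hPQ : ∀ t z, Q t (P t z) = z)
    (hp : nrm p < 1) (hk : k ≠ 0)
    (hc : 0 < nrm (blowCore p P (k, 1)) + (blowCore p P (k, 1)).2)
    (hr : nrm ((1 - ballGauge (p, k)) • p) < 1) :
    ∀ᶠ k' in 𝓝 k, blowInv p Q (blowUp p P (k', 1)) = k' := by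
  have h1 : ContinuousAt (fun k => blowCore p P (k, 1)) k :=
    ContinuousAt.comp (g := blowCore p P) (f := fun k => (k, (1 : ℝ)))
      (contDiffAt_blowCore hP hp hk).continuousAt (continuousAt_id.prodMk continuousAt_const)
  have h2 : ContinuousAt (fun k => nrm (blowCore p P (k, 1)) + (blowCore p P (k, 1)).2) k :=
    (continuous_nrm.continuousAt.comp h1).add (continuous_snd.continuousAt.comp h1)
  have h3 : ContinuousAt (fun k => nrm ((1 - ballGauge (p, k)) • p)) k := by
    have h4 := (contDiffAt_ballGauge_right hp hk).continuousAt
    have h5 : ContinuousAt (fun k => (1 - ballGauge (p, k)) • p) k :=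
      (continuousAt_const.sub h4).smul continuousAt_const
    exact continuous_nrm.continuousAt.comp h5
  filter_upwards [h2.eventually (lt_mem_nhds hc), h3.eventually (gt_mem_nhds hr),
    isOpen_ne.mem_nhds hk] with k' e1 e2 e3
  exact blowInv_blowUp hPQ hp e3 e1 e2

theorem differentiableAt_blowInv (hQ : ContDiff ℝ ∞ Q) {y : Eucl b × ℝ}
    (h0 : Q y.2 (hemi y.1) ≠ 0) (hr : nrm ((1 - y.2) • p) < 1) :
    DifferentiableAt ℝ (blowInv p Q) y := by
  have h1 : ContDiff ℝ ∞ fun y : Eucl b × ℝ => Q y.2 (hemi y.1) :=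
    (hQ.comp contDiff_snd).clm_apply (contDiff_hemi.comp contDiff_fst)
  have h2 : ContDiffAt ℝ ∞ (fun y : Eucl b × ℝ =>
      ballGauge ((1 - y.2) • p, Q y.2 (hemi y.1))) y :=
    ContDiffAt.comp (g := ballGauge) (f := fun y : Eucl b × ℝ => ((1 - y.2) • p, Q y.2 (hemi y.1))) y
      (contDiffAt_ballGauge hr h0) (ContDiffAt.prodMk
        ((contDiffAt_const.sub contDiffAt_snd).smul contDiffAt_const) h1.contDiffAt)
  have h3 : ContDiffAt ℝ ∞ (blowInv p Q) y :=
    ((contDiffAt_snd.div h2 (ballGauge_pos hr h0).ne').smul h1.contDiffAt).sub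
      ((contDiffAt_snd.pow 2).smul contDiffAt_const)
  exact h3.differentiableAt (by simp)

/-- The derivative of `blowUp` in directions in which the second coordinate is stationary. -/
theorem fderiv_blowUp (hP : ContDiff ℝ ∞ P) (hp : nrm p < 1) (hk : k ≠ 0)
    (hc : 0 < nrm (blowCore p P (k, ρ)) + (blowCore p P (k, ρ)).2) {e : Eucl b × ℝ}
    (he : ρ = 0 ∨ ip p e * ballGauge (p, k) + ip k e = 0) :
    fderiv ℝ (blowUp p P) (k, ρ) (e, 0) =
      (fderiv ℝ dir (blowCore p P (k, ρ)) (P (ρ * ballGauge (p, k)) e), 0) := by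
  refine fderiv_apply_eq_of_line ((contDiffAt_blowUp hP hp hk hc).differentiableAt (by simp)) ?_
  -- Either alternative makes the radius stationary, so `P` itself contributes no derivative, only
  -- its argument does.
  have hμ : ∃ d, HasDerivAt (fun t : ℝ => ballGauge (p, k + t • e)) d 0 ∧ ρ * d = 0 := by
    rcases he with h | h
    · have h2 : DifferentiableAt ℝ (fun k => ballGauge (p, k)) (k + (0 : ℝ) • e) := by
        rw [zero_smul, add_zero]
        exact (contDiffAt_ballGauge_right hp hk).differentiableAt (by simp)
      exact ⟨_, (DifferentiableAt.comp (f := fun t : ℝ => k + t • e) (0 : ℝ) h2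
        (by fun_prop)).hasDerivAt, by rw [h, zero_mul]⟩
    · exact ⟨0, hasDerivAt_ballGauge_line hp hk h, mul_zero ρ⟩
  obtain ⟨d, hd, hd0⟩ := hμ
  have h1 : HasDerivAt (fun t : ℝ => ρ * ballGauge (p, k + t • e)) 0 0 := by
    have := hd.const_mul ρ
    rwa [hd0] at this
  have h2 : HasDerivAt (fun t : ℝ => ρ * ballGauge (p, k + t • e) ^ 2) 0 0 := by
    refine ((hd.pow 2).const_mul ρ).congr_deriv ?_
    linear_combination (2 * ballGauge (p, k + (0 : ℝ) • e)) * hd0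
  have h3 : HasDerivAt (fun t : ℝ => P (ρ * ballGauge (p, k + t • e))) 0 0 := by
    have h4 := (hP.differentiable (by simp)).differentiableAt
      (x := ρ * ballGauge (p, k + (0 : ℝ) • e)) |>.hasDerivAt
    have h5 := HasDerivAt.scomp (h := fun t : ℝ => ρ * ballGauge (p, k + t • e)) (0 : ℝ) h4 h1
    exact h5.congr_deriv (zero_smul ℝ (deriv P (ρ * ballGauge (p, k + (0 : ℝ) • e))))
  have hl : HasDerivAt (fun t : ℝ => k + t • e) e 0 := by
    simpa using ((hasDerivAt_id (0 : ℝ)).smul_const e).const_add k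
  have h6 := h3.clm_apply (hl.add (h2.smul_const p))
  have h7 : HasDerivAt (fun t : ℝ => blowCore p P (k + t • e, ρ)) (P (ρ * ballGauge (p, k)) e) 0 := by
    refine h6.congr_deriv ?_
    simp
  have h8 : HasFDerivAt dir (fderiv ℝ dir (blowCore p P (k, ρ)))
      (blowCore p P (k + (0 : ℝ) • e, ρ)) := by
    rw [zero_smul, add_zero]
    exact ((contDiffAt_dir hc).differentiableAt (by simp)).hasFDerivAt
  have h9 := (h8.comp_hasDerivAt 0 h7).prodMk h1
  refine h9.congr_of_eventuallyEq (Eventually.of_forall fun t => ?_)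
  simp [blowUp]

/-- On the rays, the derivative of `blowUp` is that of `blowUp p P (·, 1)`. -/
theorem fderiv_blowUp_smul (hP : ContDiff ℝ ∞ P) (hp : nrm p < 1) (hk : k ≠ 0) (hρ : 0 < ρ)
    (hc : 0 < nrm (blowCore p P (k, ρ)) + (blowCore p P (k, ρ)).2) {z : Eucl b × ℝ}
    (hz : z = p + ρ • k) (e : Eucl b × ℝ) : fderiv ℝ (blowUp p P) (k, ρ) (e, 0) =
      ρ • fderiv ℝ (fun z => blowUp p P (z - p, 1)) z e := by
  refine fderiv_apply_eq_of_line ((contDiffAt_blowUp hP hp hk hc).differentiableAt (by simp)) ?_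
  have h1 : DifferentiableAt ℝ (fun z => blowUp p P (z - p, 1)) (p + ρ • (k + (0 : ℝ) • e)) := by
    rw [zero_smul, add_zero]
    refine DifferentiableAt.comp (g := blowUp p P) (f := fun z => (z - p, (1 : ℝ))) (p + ρ • k) ?_
      (by fun_prop)
    rw [add_sub_cancel_left]
    exact (contDiffAt_blowUp hP hp (smul_ne_zero hρ.ne' hk)
      (blowCore_smul_pos hρ hc)).differentiableAt (by simp)
  have hl : HasDerivAt (fun t : ℝ => p + ρ • (k + t • e)) (ρ • e) 0 := by
    have := ((((hasDerivAt_id (0 : ℝ)).smul_const e).const_add k).const_smul ρ).const_add p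
    simpa using this
  have h2 := h1.hasFDerivAt.comp_hasDerivAt (0 : ℝ) hl
  rw [map_smul, zero_smul, add_zero, ← hz] at h2
  refine h2.congr_of_eventuallyEq (Eventually.of_forall fun t => ?_)
  rw [Function.comp_apply, add_sub_cancel_left, blowUp_smul hρ]
  simp

end BlowUp

/-! ### A slice disk near the origin -/

section Origin

variable {m q M : ℕ} {a : Eucl m → Eucl (m + M)} {w : Fin M → Eucl m → Eucl (m + M)}
  {H : Eucl m × ℝ → Eucl (m + M) × ℝ} {V : Fin M → Eucl m × ℝ → Eucl (m + M) × ℝ}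

theorem nonneg_zero_of_Ioc {f : ℝ → ℝ} (hf : ContinuousOn f (Icc 0 1))
    (h : ∀ t ∈ Ioc (0 : ℝ) 1, 0 ≤ f t) : 0 ≤ f 0 := by
  have h1 : Tendsto f (𝓝[Ioc 0 1] 0) (𝓝 (f 0)) :=
    (hf 0 (left_mem_Icc.2 zero_le_one)).mono Ioc_subset_Icc_self
  have : (𝓝[Ioc (0 : ℝ) 1] 0).NeBot := by
    rw [nhdsWithin_Ioc_eq_nhdsGT zero_lt_one]
    infer_instance
  exact ge_of_tendsto h1 (eventually_mem_nhdsWithin.mono h)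

theorem eq_zero_of_Ioc {f : ℝ → ℝ} (hf : ContinuousOn f (Icc 0 1))
    (h : ∀ t ∈ Ioc (0 : ℝ) 1, f t = 0) : f 0 = 0 :=
  le_antisymm (neg_nonneg.1 (nonneg_zero_of_Ioc hf.neg fun t ht => by simp [h t ht]))
    (nonneg_zero_of_Ioc hf fun t ht => (h t ht).ge)

theorem zero_mem_halfDisk : (0 : Eucl m × ℝ) ∈ halfDisk m :=
  mem_halfDisk.2 ⟨by rw [nrm_eq_zero.2 rfl]; exact zero_le_one, le_rfl⟩

/-- A slice disk, divided by the distance to the origin, extends smoothly over the origin. -/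
theorem SwapSlice.exists_divided (h : SwapSlice m q M a w H V) :
    ∃ K : Eucl m × ℝ → Eucl (m + M) × ℝ, ContDiffOn ℝ ∞ K (cylinder m) ∧
      (∀ x ∈ cylinder m, H (cone x) = H 0 + x.2 • K x) ∧
      ∀ x ∈ disk m, K (x, 0) = fderivWithin ℝ H (halfDisk m) 0 (hemi x) := by
  have hs : ContDiffOn ℝ ∞ (fun x => H (cone x)) (cylinder m) :=
    h.emb.smooth.comp contDiff_cone.contDiffOn fun x hx => cone_mem hx
  obtain ⟨K, hK, h1, h2⟩ := exists_hadamard isCompact_disk convex_disk (uniqueDiffOn_disk m) hs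
  have hc0 : ∀ x : Eucl m, cone (x, 0) = 0 := fun x => zero_smul ℝ _
  refine ⟨K, hK, fun x hx => ?_, fun x hx => ?_⟩
  · have h3 := h1 x.1 hx.1 x.2 hx.2
    rwa [hc0] at h3
  · rw [h2 x hx]
    have hx0 : (x, (0 : ℝ)) ∈ cylinder m := ⟨hx, left_mem_Icc.2 zero_le_one⟩
    have h3 : HasFDerivWithinAt H (fderivWithin ℝ H (halfDisk m) 0) (halfDisk m) (cone (x, 0)) := by
      rw [hc0]
      exact (h.emb.smooth.differentiableOn (by simp) 0 zero_mem_halfDisk).hasFDerivWithinAt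
    have h4 : HasFDerivWithinAt cone (fderiv ℝ cone (x, (0 : ℝ))) (cylinder m) (x, 0) :=
      (contDiff_cone.differentiable (by simp)).differentiableAt.hasFDerivAt.hasFDerivWithinAt
    have h5 := h3.comp (x, (0 : ℝ)) h4 fun x hx => cone_mem hx
    have h6 := h5.fderivWithin (uniqueDiffOn_cylinder _ hx0)
    have h7 : fderivWithin ℝ (fun x => H (cone x)) (cylinder m) (x, 0) (0, 1) =
        fderivWithin ℝ H (halfDisk m) 0 (fderiv ℝ cone (x, (0 : ℝ)) (0, 1)) :=
      DFunLike.congr_fun h6 _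
    refine h7.trans ?_
    rw [fderiv_cone]
    simp

/-- The data of a slice disk `H` near the origin: `H (ρ • hemi x) = H 0 + ρ • K (x, ρ)`, and a family
of operators which makes the derivative at the origin standard. -/
structure SliceOrigin (m q M : ℕ) (a : Eucl m → Eucl (m + M)) (w : Fin M → Eucl m → Eucl (m + M))
    (H : Eucl m × ℝ → Eucl (m + M) × ℝ) (V : Fin M → Eucl m × ℝ → Eucl (m + M) × ℝ)
    (K : Eucl m × ℝ → Eucl (m + M) × ℝ) (L : Eucl m × ℝ →L[ℝ] Eucl (m + M) × ℝ)
    (P Q : ℝ → Eucl (m + M) × ℝ →L[ℝ] Eucl (m + M) × ℝ) (d : Fin (m + M) → ℝ) : Prop where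
  slice : SwapSlice m q M a w H V
  smooth : ContDiffOn ℝ ∞ K (cylinder m)
  eq : ∀ x ∈ cylinder m, H (cone x) = H 0 + x.2 • K x
  zero : ∀ x ∈ disk m, K (x, 0) = L (hemi x)
  injective : Function.Injective L
  height : ∀ y, (L (y, 0)).2 = 0
  mem : ∀ y, (L (y, 0)).1 ∈ inclRange (m + q) (m + M)
  height_pos : 0 < (L (0, 1)).2
  straight : Straightening m q M L (fun i => V i 0) P Q d

/-- The derivative `L` at the origin is a limit of difference quotients along rays and inherits the
closed conditions: flat directions go to `ℝ^(m+q)` at height zero, and `L (0, 1)` has nonnegative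
height. This height is positive, since otherwise neither `L` nor the frame would reach the vertical
direction. -/
theorem SwapSlice.exists_sliceOrigin (h : SwapSlice m q M a w H V) (hm : 0 < m) (hq : q ≤ M) :
    ∃ K L P Q d, SliceOrigin m q M a w H V K L P Q d ∧
      (d = 1 ∨ d = Function.update (1 : Fin (m + M) → ℝ) ⟨0, Nat.add_pos_left hm M⟩ (-1)) := by
  obtain ⟨K, hK, hHK, hK0⟩ := h.exists_divided
  set L := fderivWithin ℝ H (halfDisk m) 0 with hL
  have h00 := h.flat_height 0 zero_mem_halfDisk rfl
  have hline : ∀ x ∈ disk m, ContinuousOn (fun t : ℝ => K (x, t)) (Icc 0 1) := fun x hx =>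
    hK.continuousOn.comp (by fun_prop) fun t ht => ⟨hx, ht⟩
  have hray : ∀ x ∈ disk m, ∀ t ∈ Ioc (0 : ℝ) 1, K (x, t) = t⁻¹ • (H (cone (x, t)) - H 0) :=
    fun x hx t ht => by
      rw [hHK (x, t) ⟨hx, ht.1.le, ht.2⟩, add_sub_cancel_left, smul_smul,
        inv_mul_cancel₀ ht.1.ne', one_smul]
  have hsph : ∀ x : Eucl m, ‖x‖ = 1 → (L (x, 0)).2 = 0 ∧
      (L (x, 0)).1 ∈ inclRange (m + q) (m + M) := by
    intro x hx
    have hxd : x ∈ disk m := mem_disk.2 hx.le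
    have e1 : hemi x = (x, 0) := by
      rw [hemi, hx]
      norm_num
    have hc : ∀ t ∈ Ioc (0 : ℝ) 1, cone (x, t) ∈ halfDisk m ∧ (cone (x, t)).2 = 0 := fun t ht =>
      ⟨cone_mem ⟨hxd, ht.1.le, ht.2⟩, by simp [cone, e1]⟩
    rw [← e1, ← hK0 x hxd]
    refine ⟨?_, fun j hj => ?_⟩
    · refine eq_zero_of_Ioc (continuous_snd.comp_continuousOn (hline x hxd)) fun t ht => ?_
      rw [Function.comp_apply, hray x hxd t ht, Prod.smul_snd, Prod.snd_sub, h00,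
        h.flat_height _ (hc t ht).1 (hc t ht).2, sub_zero, smul_zero]
    · refine eq_zero_of_Ioc (f := fun t => (K (x, t)).1 j) ?_ fun t ht => ?_
      · exact (EuclideanSpace.proj j : Eucl (m + M) →L[ℝ] ℝ).continuous.comp_continuousOn
          (continuous_fst.comp_continuousOn (hline x hxd))
      · rw [hray x hxd t ht]
        exact Submodule.smul_mem _ _ (Submodule.sub_mem _ (h.flat_mem _ (hc t ht).1 (hc t ht).2)
          (h.flat_mem 0 zero_mem_halfDisk rfl)) j hj
  have hflat : ∀ y : Eucl m, (L (y, 0)).2 = 0 ∧ (L (y, 0)).1 ∈ inclRange (m + q) (m + M) := by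
    intro y
    by_cases hy : y = 0
    · rw [hy, Prod.mk_zero_zero, map_zero]
      exact ⟨rfl, Submodule.zero_mem _⟩
    · have h1 := hsph (‖y‖⁻¹ • y) (by
        rw [norm_smul, norm_inv, norm_norm, inv_mul_cancel₀ (norm_ne_zero_iff.2 hy)])
      have h2 : L (y, 0) = ‖y‖ • L (‖y‖⁻¹ • y, 0) := by
        rw [← map_smul, Prod.smul_mk, smul_smul, mul_inv_cancel₀ (norm_ne_zero_iff.2 hy), one_smul,
          smul_zero]
      rw [h2]
      exact ⟨by rw [Prod.smul_snd, h1.1, smul_zero], Submodule.smul_mem _ _ h1.2⟩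
  have hb := h.emb.complement 0 zero_mem_halfDisk
  have hpos : 0 < (L (0, 1)).2 := by
    have h0d : (0 : Eucl m) ∈ disk m := mem_disk.2 (by simp)
    have e1 : hemi (0 : Eucl m) = (0, 1) := by simp [hemi]
    have h1 : 0 ≤ (L (0, 1)).2 := by
      rw [← e1, ← hK0 0 h0d]
      refine nonneg_zero_of_Ioc (continuous_snd.comp_continuousOn (hline 0 h0d)) fun t ht => ?_
      rw [Function.comp_apply, hray 0 h0d t ht, Prod.smul_snd, Prod.snd_sub, h00, sub_zero]
      have h2 : 0 < (H (cone (0, t))).2 := h.height_pos _ (cone_mem ⟨h0d, ht.1.le, ht.2⟩) (by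
        simpa [cone, e1] using ht.1)
      exact (smul_pos (inv_pos.2 ht.1) h2).le
    refine h1.lt_of_ne fun h2 => ?_
    obtain ⟨⟨z, c⟩, hz⟩ := hb.2 (0, 1)
    have h3 : (L z).2 = 0 := by
      have e2 : z = (z.1, 0) + z.2 • (0, 1) := by
        refine Prod.ext ?_ ?_ <;> simp
      rw [e2, map_add, map_smul, Prod.snd_add, Prod.smul_snd, (hflat _).1, ← h2]
      simp
    have h4 := congrArg Prod.snd hz
    simp [Prod.snd_sum, h.flat_frame_height 0 zero_mem_halfDisk rfl] at h4
    exact zero_ne_one (h3.symm.trans h4)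
  obtain ⟨P, Q, d, hP, hd⟩ := exists_straightening hm hq (fun y => (hflat y).1)
    (fun y => (hflat y).2) hpos (h.flat_frame_height 0 zero_mem_halfDisk rfl)
    (h.flat_frame_mem 0 zero_mem_halfDisk rfl) (h.flat_frame_std 0 zero_mem_halfDisk rfl) hb
  refine ⟨K, L, P, Q, d, ⟨h, hK, hHK, hK0, fun z z' hz => ?_, fun y => (hflat y).1,
    fun y => (hflat y).2, hpos, hP⟩, hd⟩
  have h1 := @hb.1 (z, 0) (z', 0) (by simpa using hz)
  exact congrArg Prod.fst h1

end Origin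

/-! ### The blown-up slice disk above the bottom -/

section Blown

variable {m q M : ℕ} {a : Eucl m → Eucl (m + M)} {w : Fin M → Eucl m → Eucl (m + M)}
  {H : Eucl m × ℝ → Eucl (m + M) × ℝ} {V : Fin M → Eucl m × ℝ → Eucl (m + M) × ℝ}
  {K : Eucl m × ℝ → Eucl (m + M) × ℝ} {L : Eucl m × ℝ →L[ℝ] Eucl (m + M) × ℝ}
  {P Q : ℝ → Eucl (m + M) × ℝ →L[ℝ] Eucl (m + M) × ℝ} {d : Fin (m + M) → ℝ}

namespace SliceOrigin

theorem origin_lt (h : SliceOrigin m q M a w H V K L P Q d) : nrm (H 0) < 1 :=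
  h.slice.nrm_lt 0 zero_mem_halfDisk (by rw [nrm_eq_zero.2 rfl]; exact zero_lt_one)

theorem origin_height (h : SliceOrigin m q M a w H V K L P Q d) : (H 0).2 = 0 :=
  h.slice.flat_height 0 zero_mem_halfDisk rfl

theorem origin_mem (h : SliceOrigin m q M a w H V K L P Q d) :
    (H 0).1 ∈ inclRange (m + q) (m + M) :=
  h.slice.flat_mem 0 zero_mem_halfDisk rfl

theorem eq_divided (h : SliceOrigin m q M a w H V K L P Q d) {x : Eucl m × ℝ} (hx : x ∈ cylinder m)
    (h0 : 0 < x.2) : K x = x.2⁻¹ • (H (cone x) - H 0) := by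
  rw [h.eq x hx, add_sub_cancel_left, smul_smul, inv_mul_cancel₀ h0.ne', one_smul]

theorem snd_nonneg {x : Eucl m × ℝ} (hx : x ∈ cylinder m) : 0 ≤ x.2 := hx.2.1

theorem cone_ne_zero {x : Eucl m × ℝ} (h0 : 0 < x.2) : cone x ≠ 0 :=
  smul_ne_zero h0.ne' (hemi_ne_zero _)

/-- Above the bottom this is injectivity of `H`, at the bottom injectivity of its derivative. -/
theorem ne_zero (h : SliceOrigin m q M a w H V K L P Q d) {x : Eucl m × ℝ} (hx : x ∈ cylinder m) :
    K x ≠ 0 := by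
  rcases (snd_nonneg hx).eq_or_lt with h0 | h0
  · have h1 : K x = L (hemi x.1) := by
      rw [← h.zero x.1 hx.1, h0]
    rw [h1]
    exact (map_ne_zero_iff L h.injective).2 (hemi_ne_zero _)
  · rw [h.eq_divided hx h0]
    refine smul_ne_zero (inv_ne_zero h0.ne') (sub_ne_zero.2 fun h1 => cone_ne_zero h0 ?_)
    exact h.slice.emb.injOn (cone_mem hx) zero_mem_halfDisk h1

theorem map_snd (h : SliceOrigin m q M a w H V K L P Q d) (z : Eucl m × ℝ) :
    (L z).2 = z.2 * (L (0, 1)).2 := by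
  have e2 : z = (z.1, 0) + z.2 • (0, 1) := by
    refine Prod.ext ?_ ?_ <;> simp
  conv_lhs => rw [e2, map_add, map_smul, Prod.snd_add, Prod.smul_snd, h.height, zero_add, smul_eq_mul]

theorem divided_height_pos (h : SliceOrigin m q M a w H V K L P Q d) {x : Eucl m × ℝ}
    (hx : x ∈ cylinder m) (h1 : ‖x.1‖ < 1) : 0 < (K x).2 := by
  rcases (snd_nonneg hx).eq_or_lt with h0 | h0
  · have h2 : K x = L (hemi x.1) := by
      rw [← h.zero x.1 hx.1, h0]
    rw [h2, h.map_snd]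
    exact mul_pos (hemi_snd_pos.2 h1) h.height_pos
  · rw [h.eq_divided hx h0, Prod.smul_snd, Prod.snd_sub, h.origin_height, sub_zero]
    exact smul_pos (inv_pos.2 h0)
      (h.slice.height_pos _ (cone_mem hx) (mul_pos h0 (hemi_snd_pos.2 h1)))

theorem cone_side {x : Eucl m × ℝ} (h1 : ‖x.1‖ = 1) : (cone x).2 = 0 :=
  mul_eq_zero_of_right _ (hemi_snd_eq_zero.2 h1)

theorem divided_side (h : SliceOrigin m q M a w H V K L P Q d) {x : Eucl m × ℝ}
    (hx : x ∈ cylinder m) (h1 : ‖x.1‖ = 1) :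
    (K x).2 = 0 ∧ (K x).1 ∈ inclRange (m + q) (m + M) := by
  rcases (snd_nonneg hx).eq_or_lt with h0 | h0
  · have h2 : K x = L (x.1, 0) := by
      have e1 : hemi x.1 = (x.1, 0) := by
        rw [hemi, h1]
        norm_num
      rw [← e1, ← h.zero x.1 hx.1, h0]
    rw [h2]
    exact ⟨h.height _, h.mem _⟩
  · rw [h.eq_divided hx h0]
    constructor
    · rw [Prod.smul_snd, Prod.snd_sub, h.origin_height, sub_zero,
        h.slice.flat_height _ (cone_mem hx) (cone_side h1), smul_zero]
    · exact Submodule.smul_mem _ _ (Submodule.sub_mem _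
        (h.slice.flat_mem _ (cone_mem hx) (cone_side h1)) h.origin_mem)

theorem divided_height_nonneg (h : SliceOrigin m q M a w H V K L P Q d) {x : Eucl m × ℝ}
    (hx : x ∈ cylinder m) : 0 ≤ (K x).2 := by
  rcases (mem_disk.1 hx.1).lt_or_eq with h1 | h1
  · exact (h.divided_height_pos hx h1).le
  · exact (h.divided_side hx h1).1.ge

theorem gauge_pos (h : SliceOrigin m q M a w H V K L P Q d) {x : Eucl m × ℝ} (hx : x ∈ cylinder m) :
    0 < ballGauge (H 0, K x) :=
  ballGauge_pos h.origin_lt (h.ne_zero hx)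

theorem radius_lt (h : SliceOrigin m q M a w H V K L P Q d) {x : Eucl m × ℝ} (hx : x ∈ cylinder m)
    (h1 : x.2 < 1) : x.2 * ballGauge (H 0, K x) < 1 := by
  rcases (snd_nonneg hx).eq_or_lt with h0 | h0
  · rw [← h0, zero_mul]
    exact one_pos
  · rw [← ballGauge_smul h0.le, ballGauge_lt_iff h.origin_lt (smul_ne_zero h0.ne' (h.ne_zero hx))
      one_pos, inv_one, one_smul, ← h.eq x hx]
    exact h.slice.nrm_lt _ (cone_mem hx) (by rwa [nrm_cone h0.le])

theorem divided_one (h : SliceOrigin m q M a w H V K L P Q d) {x : Eucl m} (hx : x ∈ disk m) :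
    H 0 + K (x, 1) = hemi (a x) := by
  have h1 := h.eq (x, 1) ⟨hx, right_mem_Icc.2 zero_le_one⟩
  have e1 : cone (x, (1 : ℝ)) = hemi x := one_smul ℝ _
  have e2 : (x, (1 : ℝ)).2 • K (x, 1) = K (x, 1) := one_smul ℝ _
  rw [e1, e2, h.slice.map_round x hx] at h1
  exact h1.symm

theorem gauge_one (h : SliceOrigin m q M a w H V K L P Q d) {x : Eucl m} (hx : x ∈ disk m) :
    ballGauge (H 0, K (x, 1)) = 1 := by
  have hx1 : (x, (1 : ℝ)) ∈ cylinder m := ⟨hx, right_mem_Icc.2 zero_le_one⟩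
  have h0 := h.ne_zero hx1
  rw [ballGauge_eq_iff h.origin_lt h0 one_pos, inv_one, one_smul, h.divided_one hx, nrm_hemi]

theorem radius_le (h : SliceOrigin m q M a w H V K L P Q d) {x : Eucl m × ℝ} (hx : x ∈ cylinder m) :
    x.2 * ballGauge (H 0, K x) ≤ 1 := by
  rcases hx.2.2.lt_or_eq with h1 | h1
  · exact (h.radius_lt hx h1).le
  · have h2 : x = (x.1, 1) := Prod.ext rfl h1
    rw [h1, one_mul, h2, h.gauge_one hx.1]

theorem radius_nonneg (h : SliceOrigin m q M a w H V K L P Q d) {x : Eucl m × ℝ}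
    (hx : x ∈ cylinder m) : 0 ≤ x.2 * ballGauge (H 0, K x) :=
  mul_nonneg (snd_nonneg hx) (h.gauge_pos hx).le

theorem nrm_shrink (h : SliceOrigin m q M a w H V K L P Q d) {x : Eucl m × ℝ}
    (hx : x ∈ cylinder m) : nrm ((1 - x.2 * ballGauge (H 0, K x)) • H 0) < 1 := by
  have h1 := h.radius_le hx
  have h2 := h.radius_nonneg hx
  rw [nrm_smul (by linarith)]
  have h3 := nrm_nonneg (H 0)
  have h4 := h.origin_lt
  nlinarith

/-- Otherwise the point where the ray from `H 0` along `K x` leaves the ball would be a multiple of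
`H 0` of norm less than one. -/
theorem shifted_ne_zero (h : SliceOrigin m q M a w H V K L P Q d) {x : Eucl m × ℝ}
    (hx : x ∈ cylinder m) : K x + (x.2 * ballGauge (H 0, K x) ^ 2) • H 0 ≠ 0 := by
  intro h0
  have hμ := h.gauge_pos hx
  have h1 := (ballGauge_eq_iff h.origin_lt (h.ne_zero hx) hμ).1 rfl
  set r := ballGauge (H 0, K x)
  have h2 : H 0 + r⁻¹ • K x = (1 - x.2 * r) • H 0 := by
    rw [eq_neg_of_add_eq_zero_left h0, smul_neg, smul_smul,
      show r⁻¹ * (x.2 * r ^ 2) = x.2 * r by field_simp]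
    module
  have h3 := h.nrm_shrink hx
  rw [← h2, h1] at h3
  exact lt_irrefl _ h3

theorem core_ne_zero (h : SliceOrigin m q M a w H V K L P Q d) {x : Eucl m × ℝ}
    (hx : x ∈ cylinder m) : blowCore (H 0) P (K x, x.2) ≠ 0 := fun h0 => by
  refine h.shifted_ne_zero hx ?_
  rw [← h.straight.left_inv (x.2 * ballGauge (H 0, K x)) (K x + _)]
  exact (congrArg _ h0).trans (map_zero _)

theorem core_snd (h : SliceOrigin m q M a w H V K L P Q d) (x : Eucl m × ℝ) :
    ∃ c : ℝ, 0 < c ∧ (blowCore (H 0) P (K x, x.2)).2 = c * (K x).2 := by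
  obtain ⟨c, hc, h1⟩ := h.straight.height (x.2 * ballGauge (H 0, K x))
  refine ⟨c, hc, ?_⟩
  rw [blowCore, h1, Prod.snd_add, Prod.smul_snd, h.origin_height, smul_zero, add_zero]

theorem core_pos (h : SliceOrigin m q M a w H V K L P Q d) {x : Eucl m × ℝ} (hx : x ∈ cylinder m) :
    0 < nrm (blowCore (H 0) P (K x, x.2)) + (blowCore (H 0) P (K x, x.2)).2 := by
  obtain ⟨c, hc, h1⟩ := h.core_snd x
  refine nrm_add_snd_pos (h.core_ne_zero hx) ?_
  rw [h1]
  exact mul_nonneg hc.le (h.divided_height_nonneg hx)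

/-- The concordance obtained from a slice disk, up to a reflection at the end. -/
def track (H K : Eucl m × ℝ → Eucl (m + M) × ℝ)
    (P : ℝ → Eucl (m + M) × ℝ →L[ℝ] Eucl (m + M) × ℝ) (x : Eucl m × ℝ) : Eucl (m + M) × ℝ :=
  blowUp (H 0) P (K x, x.2)

/-- The framing of `track H K P`. -/
def trackFrame (H K : Eucl m × ℝ → Eucl (m + M) × ℝ) (V : Fin M → Eucl m × ℝ → Eucl (m + M) × ℝ)
    (P : ℝ → Eucl (m + M) × ℝ →L[ℝ] Eucl (m + M) × ℝ) (i : Fin M) (x : Eucl m × ℝ) :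
    Eucl (m + M) × ℝ :=
  (nrm (blowCore (H 0) P (K x, x.2)) + (blowCore (H 0) P (K x, x.2)).2) •
    fderiv ℝ (blowUp (H 0) P) (K x, x.2) (V i (cone x), 0)

theorem contDiffOn_track (h : SliceOrigin m q M a w H V K L P Q d) :
    ContDiffOn ℝ ∞ (track H K P) (cylinder m) := fun x hx => by
  have h1 : ContDiffWithinAt ℝ ∞ (fun x => (K x, x.2)) (cylinder m) x :=
    (h.smooth x hx).prodMk contDiffWithinAt_snd
  exact (contDiffAt_blowUp h.straight.contDiff h.origin_lt (h.ne_zero hx)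
    (h.core_pos hx)).comp_contDiffWithinAt x h1

theorem contDiffOn_trackFrame (h : SliceOrigin m q M a w H V K L P Q d) (i : Fin M) :
    ContDiffOn ℝ ∞ (trackFrame H K V P i) (cylinder m) := fun x hx => by
  have h1 : ContDiffWithinAt ℝ ∞ (fun x => (K x, x.2)) (cylinder m) x :=
    (h.smooth x hx).prodMk contDiffWithinAt_snd
  have h2 : ContDiffWithinAt ℝ ∞ (fun x => blowCore (H 0) P (K x, x.2)) (cylinder m) x :=
    ContDiffAt.comp_contDiffWithinAt (g := blowCore (H 0) P) (f := fun x => (K x, x.2)) x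
      (contDiffAt_blowCore h.straight.contDiff h.origin_lt (h.ne_zero hx)) h1
  have h3 : ContDiffWithinAt ℝ ∞ (fun x => nrm (blowCore (H 0) P (K x, x.2))) (cylinder m) x :=
    ContDiffAt.comp_contDiffWithinAt (g := nrm) (f := fun x => blowCore (H 0) P (K x, x.2)) x
      (contDiffAt_nrm (h.core_ne_zero hx)) h2
  have h4 : ContDiffWithinAt ℝ ∞ (fun x => (blowCore (H 0) P (K x, x.2)).2) (cylinder m) x :=
    contDiffAt_snd.comp_contDiffWithinAt x h2
  have h5 : ContDiffAt ℝ ∞ (fderiv ℝ (blowUp (H 0) P)) (K x, x.2) :=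
    (contDiffAt_blowUp h.straight.contDiff h.origin_lt (h.ne_zero hx)
      (h.core_pos hx)).fderiv_right (by simp)
  have h6 : ContDiffWithinAt ℝ ∞ (fun x => V i (cone x)) (cylinder m) x :=
    (h.slice.emb.smooth_frame i (cone x) (cone_mem hx)).comp x
      contDiff_cone.contDiffAt.contDiffWithinAt fun x hx => cone_mem hx
  exact (h3.add h4).smul ((h5.comp_contDiffWithinAt x h1).clm_apply (h6.prodMk contDiffWithinAt_const))

/-- Away from the bottom the track is the blow up of the slice disk. -/
theorem isFramedEmbedding_track_inter (h : SliceOrigin m q M a w H V K L P Q d) :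
    InjOn (track H K P) (cylinder m ∩ {x | 0 < x.2}) ∧ ∀ x ∈ cylinder m ∩ {x | 0 < x.2},
      Function.Bijective (fun p : (Eucl m × ℝ) × (Fin M → ℝ) =>
        fderivWithin ℝ (track H K P) (cylinder m) x p.1 + ∑ i, p.2 i • trackFrame H K V P i x) := by
  have hop : IsOpen {x : Eucl m × ℝ | 0 < x.2} := isOpen_lt continuous_const continuous_snd
  have hv : ∀ x ∈ cylinder m ∩ {x | 0 < x.2}, H (cone x) - H 0 = x.2 • K x := fun x hx => by
    rw [h.eq x hx.1, add_sub_cancel_left]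
  have htr : ∀ x ∈ cylinder m ∩ {x | 0 < x.2},
      blowUp (H 0) P (H (cone x) - H 0, 1) = track H K P x := fun x hx => by
    rw [hv x hx, blowUp_smul hx.2, track]
  have hne : ∀ x ∈ cylinder m ∩ {x | 0 < x.2}, H (cone x) - H 0 ≠ 0 := fun x hx => by
    rw [hv x hx]
    exact smul_ne_zero (ne_of_gt hx.2) (h.ne_zero hx.1)
  have hcore : ∀ x ∈ cylinder m ∩ {x | 0 < x.2}, 0 < nrm (blowCore (H 0) P (H (cone x) - H 0, 1)) +
      (blowCore (H 0) P (H (cone x) - H 0, 1)).2 := fun x hx => by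
    rw [hv x hx]
    exact blowCore_smul_pos hx.2 (h.core_pos hx.1)
  have hga : ∀ x ∈ cylinder m ∩ {x | 0 < x.2}, ballGauge (H 0, H (cone x) - H 0) =
      x.2 * ballGauge (H 0, K x) := fun x hx => by
    rw [hv x hx, ballGauge_smul (le_of_lt hx.2)]
  have hsub : ∀ z, ContDiffAt ℝ ∞ (fun z : Eucl (m + M) × ℝ => (z - H 0, (1 : ℝ))) z := fun z =>
    (contDiffAt_id.sub contDiffAt_const).prodMk contDiffAt_const
  have hP := h.straight.contDiff
  have hc : ContDiffOn ℝ ∞ (fun x : Eucl m × ℝ => (nrm (blowCore (H 0) P (K x, x.2)) +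
      (blowCore (H 0) P (K x, x.2)).2) * x.2) (cylinder m ∩ {x | 0 < x.2}) := by
    intro x hx
    have h1 : ContDiffWithinAt ℝ ∞ (fun x => (K x, x.2)) (cylinder m ∩ {x | 0 < x.2}) x :=
      ((h.smooth x hx.1).mono inter_subset_left).prodMk contDiffWithinAt_snd
    have h2 := (contDiffAt_blowCore (ρ := x.2) hP h.origin_lt
      (h.ne_zero hx.1)).comp_contDiffWithinAt x h1
    exact (((contDiffAt_nrm (h.core_ne_zero hx.1)).comp_contDiffWithinAt x h2).add
      (contDiffAt_snd.comp_contDiffWithinAt x h2)).mul contDiffWithinAt_snd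
  -- At positive heights the track is `H`, preceded by `cone` and followed by blow-up coordinates.
  -- The extra `x.2` in the factor is the `ρ` from `fderiv_blowUp_smul`.
  have key := h.slice.emb.push (uniqueDiffOn_cylinder.inter hop) (Φ := cone) (Φi := polar)
    (Ψ := fun z => blowUp (H 0) P (z - H 0, 1)) (Ψi := fun y => H 0 + blowInv (H 0) Q y)
    (c := fun x => (nrm (blowCore (H 0) P (K x, x.2)) + (blowCore (H 0) P (K x, x.2)).2) * x.2)
    (fun x hx => cone_mem hx.1) (fun _ _ => contDiff_cone.contDiffAt)
    (fun x hx => (contDiffAt_polar (by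
      rw [cone]
      exact nrm_add_snd_smul_pos (nrm_add_snd_hemi_pos _) hx.2)).differentiableAt (by simp))
    (fun x hx => by filter_upwards [hop.mem_nhds hx.2] with y hy using polar_cone hy)
    (fun x hx => ContDiffAt.comp (g := blowUp (H 0) P) (f := fun z => (z - H 0, (1 : ℝ))) _
      (contDiffAt_blowUp hP h.origin_lt (hne x hx) (hcore x hx)) (hsub _))
    (fun x hx => by
      refine (differentiableAt_blowInv h.straight.contDiff_inv ?_ ?_).const_add _
      · have h1 := hcore x hx
        have h2 : blowCore (H 0) P (H (cone x) - H 0, 1) ≠ 0 := fun h0 => by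
          simp [h0, nrm] at h1
        simp only [blowUp, hemi_dir h1, map_smul]
        refine smul_ne_zero (inv_ne_zero (nrm_pos.2 h2).ne') ?_
        rw [blowCore, h.straight.left_inv]
        intro h0
        exact h2 (by rw [blowCore, h0, map_zero])
      · have h1 := h.nrm_shrink hx.1
        rw [← hga x hx] at h1
        simpa only [blowUp, one_mul] using h1)
    (fun x hx => by
      have h1 := h.nrm_shrink hx.1
      rw [← hga x hx] at h1
      have h2 := eventually_blowInv_blowUp hP h.straight.left_inv h.origin_lt (hne x hx) (hcore x hx) h1
      have h3 : Tendsto (fun z => z - H 0) (𝓝 (H (cone x))) (𝓝 (H (cone x) - H 0)) :=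
        (continuous_id.sub continuous_const).continuousAt
      filter_upwards [h3.eventually h2] with z hz
      rw [hz, add_sub_cancel])
    hc (fun x hx => mul_ne_zero (h.core_pos hx.1).ne' (ne_of_gt hx.2))
  refine ⟨key.injOn.congr htr, fun x hx => key.complement_congr hop (fun x hx => (htr x hx).symm)
    (fun x hx i => ?_) hx⟩
  rw [trackFrame, fderiv_blowUp_smul hP h.origin_lt (h.ne_zero hx.1) hx.2 (h.core_pos hx.1)
    (h.eq x hx.1), smul_smul]

end SliceOrigin

end Blown

/-! ### Sign changes of coordinates -/

section SignChange

variable {b : ℕ} {d : Fin b → ℝ}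

/-- The diagonal operator with entries `d`. -/
def diagOp (d : Fin b → ℝ) : Eucl b →L[ℝ] Eucl b :=
  Matrix.toEuclideanCLM (𝕜 := ℝ) (Matrix.diagonal d)

theorem diagOp_apply (d : Fin b → ℝ) (y : Eucl b) (j : Fin b) : diagOp d y j = d j * y j :=
  toEuclideanCLM_diagonal d y j

theorem diagOp_one (y : Eucl b) : diagOp 1 y = y := by
  ext j
  rw [diagOp_apply, Pi.one_apply, one_mul]

theorem norm_diagOp (hd : ∀ j, d j ^ 2 = 1) (y : Eucl b) : ‖diagOp d y‖ = ‖y‖ := by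
  rw [← sq_eq_sq₀ (norm_nonneg _) (norm_nonneg _), EuclideanSpace.real_norm_sq_eq,
    EuclideanSpace.real_norm_sq_eq]
  simp only [diagOp_apply, mul_pow, hd, one_mul]

theorem hemi_diagOp (hd : ∀ j, d j ^ 2 = 1) (y : Eucl b) :
    hemi (diagOp d y) = (diagOp d (hemi y).1, (hemi y).2) := by
  simp only [hemi, norm_diagOp hd, map_smul]

theorem fderiv_hemi_diagOp (hd : ∀ j, d j ^ 2 = 1) (y v : Eucl b) :
    fderiv ℝ hemi (diagOp d y) (diagOp d v) =
      (diagOp d (fderiv ℝ hemi y v).1, (fderiv ℝ hemi y v).2) := by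
  have h1 : HasFDerivAt (fun y => hemi (diagOp d y)) ((fderiv ℝ hemi (diagOp d y)).comp (diagOp d)) y :=
    (hasFDerivAt_hemi (diagOp d y)).comp y (diagOp d).hasFDerivAt
  have h2 : HasFDerivAt (fun y => (diagOp d (hemi y).1, (hemi y).2))
      (((diagOp d).prodMap (ContinuousLinearMap.id ℝ ℝ)).comp (fderiv ℝ hemi y)) y :=
    (((diagOp d).prodMap (ContinuousLinearMap.id ℝ ℝ)).hasFDerivAt (x := hemi y)).comp y
      (hasFDerivAt_hemi y)
  have h3 : (fun y => hemi (diagOp d y)) = fun y => (diagOp d (hemi y).1, (hemi y).2) :=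
    funext (hemi_diagOp hd)
  rw [h3] at h1
  exact DFunLike.congr_fun (h1.unique h2) v

theorem fderiv_dir_hemi (y v : Eucl b) : fderiv ℝ dir (hemi y) (fderiv ℝ hemi y v) = v := by
  have h1 : HasFDerivAt dir (fderiv ℝ dir (hemi y)) (hemi y) :=
    ((contDiffAt_dir (nrm_add_snd_hemi_pos y)).differentiableAt (by simp)).hasFDerivAt
  have h2 := (h1.comp y (hasFDerivAt_hemi y)).congr_of_eventuallyEq
    (f₁ := id) (Eventually.of_forall fun y => (dir_hemi y).symm)
  exact DFunLike.congr_fun (h2.unique (hasFDerivAt_id y)) v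

end SignChange

/-! ### The concordance obtained by blowing up -/

section Blown

variable {m q M : ℕ} {a : Eucl m → Eucl (m + M)} {w : Fin M → Eucl m → Eucl (m + M)}
  {H : Eucl m × ℝ → Eucl (m + M) × ℝ} {V : Fin M → Eucl m × ℝ → Eucl (m + M) × ℝ}
  {K : Eucl m × ℝ → Eucl (m + M) × ℝ} {L : Eucl m × ℝ →L[ℝ] Eucl (m + M) × ℝ}
  {P Q : ℝ → Eucl (m + M) × ℝ →L[ℝ] Eucl (m + M) × ℝ} {d : Fin (m + M) → ℝ}

namespace SliceOrigin

theorem core_zero (h : SliceOrigin m q M a w H V K L P Q d) {x : Eucl m} (hx : x ∈ disk m) :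
    blowCore (H 0) P (K (x, 0), 0) = hemi (incl m (m + M) x) := by
  rw [blowCore]
  simp only [zero_mul, zero_smul, add_zero]
  rw [h.zero x hx, h.straight.zero_map, hemi_incl]
  rfl

theorem track_zero (h : SliceOrigin m q M a w H V K L P Q d) {x : Eucl m} (hx : x ∈ disk m) :
    track H K P (x, 0) = (incl m (m + M) x, 0) := by
  rw [track, blowUp, h.core_zero hx, dir_hemi, zero_mul]

/-- The factor in `trackFrame` is the inverse of the one by which `dir` scales horizontal vectors
orthogonal to the position. -/
theorem trackFrame_orthogonal (h : SliceOrigin m q M a w H V K L P Q d) {x : Eucl m × ℝ}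
    (hx : x ∈ cylinder m) {i : Fin M}
    (he : x.2 = 0 ∨ ip (H 0) (V i (cone x)) * ballGauge (H 0, K x) + ip (K x) (V i (cone x)) = 0)
    {v : Eucl (m + M)} (hv : P (x.2 * ballGauge (H 0, K x)) (V i (cone x)) = (v, 0))
    (h1 : inner ℝ (blowCore (H 0) P (K x, x.2)).1 v = 0) :
    trackFrame H K V P i x = (v, 0) := by
  rw [trackFrame, fderiv_blowUp h.straight.contDiff h.origin_lt (h.ne_zero hx) (h.core_pos hx) he, hv,
    fderiv_dir_orthogonal (h.core_pos hx) h1, Prod.smul_mk, smul_zero, smul_smul,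
    mul_inv_cancel₀ (h.core_pos hx).ne', one_smul]

theorem trackFrame_zero (h : SliceOrigin m q M a w H V K L P Q d) {x : Eucl m} (hx : x ∈ disk m)
    (i : Fin M) : trackFrame H K V P i (x, 0) = (stdVec m M i, 0) := by
  have hx0 : (x, (0 : ℝ)) ∈ cylinder m := ⟨hx, left_mem_Icc.2 zero_le_one⟩
  have hc : cone (x, (0 : ℝ)) = 0 := zero_smul ℝ _
  refine h.trackFrame_orthogonal hx0 (Or.inl rfl) ?_ ?_
  · rw [hc, zero_mul]
    exact h.straight.zero_frame i
  · rw [h.core_zero hx]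
    simp only [hemi, inner_smul_left, inner_incl_stdVec, mul_zero]

theorem straight_one (h : SliceOrigin m q M a w H V K L P Q d) (z : Eucl (m + M) × ℝ) :
    P 1 z = (diagOp d z.1, z.2) := by
  refine Prod.ext ?_ (h.straight.one_snd z)
  ext j
  rw [h.straight.one_fst, diagOp_apply]

/-- At radius one the shift by `H 0` completes `K (x, 1)` to the actual point `hemi (a x)`, so the
choice of the centre leaves no trace at the top. -/
theorem core_one (h : SliceOrigin m q M a w H V K L P Q d) (hd : ∀ j, d j ^ 2 = 1) {x : Eucl m}
    (hx : x ∈ disk m) : blowCore (H 0) P (K (x, 1), 1) = hemi (diagOp d (a x)) := by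
  rw [blowCore]
  simp only [h.gauge_one hx, one_pow, mul_one, one_smul]
  rw [add_comm (K (x, 1)), h.divided_one hx, h.straight_one, hemi_diagOp hd]

theorem track_one (h : SliceOrigin m q M a w H V K L P Q d) (hd : ∀ j, d j ^ 2 = 1) {x : Eucl m}
    (hx : x ∈ disk m) : track H K P (x, 1) = (diagOp d (a x), 1) := by
  rw [track, blowUp, h.core_one hd hx, dir_hemi]
  simp only [h.gauge_one hx, mul_one]

/-- On the round face the frame is tangent to the unit sphere, a level set of the gauge, so the
radius is stationary. The factor `2 / (1 + ‖a x‖ ^ 2)` of `trackFrame` there is inverse to the one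
in `frame_round`. -/
theorem trackFrame_one (h : SliceOrigin m q M a w H V K L P Q d) (hd : ∀ j, d j ^ 2 = 1)
    {x : Eucl m} (hx : x ∈ disk m) (i : Fin M) :
    trackFrame H K V P i (x, 1) = (diagOp d (w i x), 0) := by
  have hx1 : (x, (1 : ℝ)) ∈ cylinder m := ⟨hx, right_mem_Icc.2 zero_le_one⟩
  have hV : V i (cone (x, (1 : ℝ))) = ((1 + ‖a x‖ ^ 2) / 2) • fderiv ℝ hemi (a x) (w i x) := by
    rw [← h.slice.frame_round x hx i]
    exact congrArg (V i) (one_smul ℝ _)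
  have h1 : ip (H 0) (V i (cone (x, (1 : ℝ)))) * ballGauge (H 0, K (x, 1)) +
      ip (K (x, 1)) (V i (cone (x, (1 : ℝ)))) = 0 := by
    rw [h.gauge_one hx, mul_one, ← ip_add_left, h.divided_one hx, hV, ip_smul_right, ip_comm,
      ip_fderiv_eq_zero (hasFDerivAt_hemi _).differentiableAt fun t => nrm_hemi _, mul_zero]
  have h2 := fderiv_blowUp h.straight.contDiff h.origin_lt (h.ne_zero hx1) (h.core_pos hx1) (Or.inr h1)
  simp only [h.gauge_one hx, mul_one, h.core_one hd hx] at h2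
  rw [trackFrame, h2, h.straight_one, hV, Prod.smul_fst, Prod.smul_snd, map_smul, ← Prod.smul_mk,
    ← fderiv_hemi_diagOp hd, map_smul, fderiv_dir_hemi, h.core_one hd hx, nrm_hemi,
    one_add_hemi_snd, norm_diagOp hd, Prod.smul_mk, smul_zero, smul_smul]
  have h3 : 1 + ‖a x‖ ^ 2 ≠ 0 := by positivity
  congr 1
  convert one_smul ℝ _
  field_simp

theorem track_height_pos (h : SliceOrigin m q M a w H V K L P Q d) {x : Eucl m × ℝ}
    (hx : x ∈ cylinder m) (h0 : 0 < x.2) : 0 < (track H K P x).2 :=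
  mul_pos h0 (h.gauge_pos hx)

/-- At the bottom the track is standard and its height is `x.2` times the positive gauge, so
`bijective_frame_standard` applies; above it the track is a pushed slice disk. -/
theorem isFramedEmbedding_track (h : SliceOrigin m q M a w H V K L P Q d) :
    IsFramedEmbedding (cylinder m) (track H K P) (trackFrame H K V P) := by
  have hzero : ∀ x : Eucl m × ℝ, x.2 = 0 → x = (x.1, 0) := fun x hx => Prod.ext rfl hx
  refine ⟨h.contDiffOn_track, fun x hx y hy hxy => ?_, h.contDiffOn_trackFrame, fun x hx => ?_⟩
  · rcases (snd_nonneg hx).eq_or_lt with h0 | h0 <;> rcases (snd_nonneg hy).eq_or_lt with h1 | h1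
    · rw [hzero x h0.symm, hzero y h1.symm] at hxy ⊢
      rw [h.track_zero hx.1, h.track_zero hy.1] at hxy
      have h2 := congrArg (fun z => incl (m + M) m z.1) hxy
      simp only [incl_truncate (Nat.le_add_right m M)] at h2
      rw [h2]
    · have h2 := h.track_height_pos hy h1
      rw [← hxy, hzero x h0.symm, h.track_zero hx.1] at h2
      exact absurd h2 (lt_irrefl _)
    · have h2 := h.track_height_pos hx h0
      rw [hxy, hzero y h1.symm, h.track_zero hy.1] at h2
      exact absurd h2 (lt_irrefl _)
    · exact h.isFramedEmbedding_track_inter.1 ⟨hx, h0⟩ ⟨hy, h1⟩ hxy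
  · rcases (snd_nonneg hx).eq_or_lt with h0 | h0
    · obtain ⟨x, s⟩ := x
      simp only at h0
      subst h0
      have hdiff := h.contDiffOn_track.differentiableOn (by simp)
      have hβ : ContinuousOn (fun x => ballGauge (H 0, K x)) (cylinder m) := fun x hx =>
        ContinuousAt.comp_continuousWithinAt (g := fun k => ballGauge (H 0, k)) (f := K)
          (contDiffAt_ballGauge_right h.origin_lt (h.ne_zero hx)).continuousAt
          (h.smooth.continuousOn x hx)
      have h2 := fderivWithin_height hdiff hβ (fun _ _ => rfl) hx.1
      exact bijective_frame_standard (v := fun i => trackFrame H K V P i (x, 0))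
        (fderivWithin_standard_end hdiff (fun x hx => h.track_zero hx) hx.1)
        (by rw [h2]; exact (h.gauge_pos hx).ne') (h.trackFrame_zero hx.1)
    · exact h.isFramedEmbedding_track_inter.2 x ⟨hx, h0⟩

theorem core_side (h : SliceOrigin m q M a w H V K L P Q d) (ρ : ℝ) {k : Eucl (m + M) × ℝ}
    (hk : k.2 = 0) : (blowCore (H 0) P (k, ρ)).2 = 0 := by
  obtain ⟨c, hc, h1⟩ := h.straight.height (ρ * ballGauge (H 0, k))
  rw [blowCore, h1, Prod.snd_add, Prod.smul_snd, h.origin_height, hk, smul_zero, add_zero, mul_zero]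

theorem core_side_mem (h : SliceOrigin m q M a w H V K L P Q d) (ρ : ℝ) {k : Eucl (m + M) × ℝ}
    (hk : k.2 = 0) (hkm : k.1 ∈ inclRange (m + q) (m + M)) :
    (blowCore (H 0) P (k, ρ)).1 ∈ inclRange (m + q) (m + M) := by
  refine h.straight.mem _ _ ?_ (Submodule.add_mem _ hkm (Submodule.smul_mem _ _ h.origin_mem))
  simp [hk, h.origin_height]

/-- Moving `K x` in the direction of the frame keeps `blowCore` at height zero, where `dir` has norm
one; so the velocity is tangent to the unit sphere. -/
theorem track_side_tangent (h : SliceOrigin m q M a w H V K L P Q d) {x : Eucl m × ℝ}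
    (hx : x ∈ cylinder m) (h1 : ‖x.1‖ = 1) (i : Fin M) :
    inner ℝ (trackFrame H K V P i x).1 (track H K P x).1 = 0 := by
  set e := V i (cone x) with he
  have he2 : e.2 = 0 := h.slice.flat_frame_height _ (cone_mem hx) (cone_side h1) i
  have hd := ((contDiffAt_blowUp h.straight.contDiff h.origin_lt (h.ne_zero hx)
    (h.core_pos hx)).differentiableAt (by simp)).hasFDerivAt
  have hl : HasDerivAt (fun t : ℝ => (K x, x.2) + t • (e, (0 : ℝ))) (e, 0) 0 := by
    simpa using ((hasDerivAt_id (0 : ℝ)).smul_const (e, (0 : ℝ))).const_add (K x, x.2)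
  have hd' : HasFDerivAt (blowUp (H 0) P) (fderiv ℝ (blowUp (H 0) P) (K x, x.2))
      ((K x, x.2) + (0 : ℝ) • (e, (0 : ℝ))) := by simpa using hd
  have h2 := (hasDerivAt_fst_comp (hd'.comp_hasDerivAt (0 : ℝ) hl)).norm_sq
  have hcont : ContinuousAt (fun t : ℝ => blowCore (H 0) P ((K x, x.2) + t • (e, (0 : ℝ)))) 0 := by
    refine ContinuousAt.comp (g := blowCore (H 0) P)
      (f := fun t : ℝ => (K x, x.2) + t • (e, (0 : ℝ))) ?_ hl.continuousAt
    rw [zero_smul, add_zero]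
    exact (contDiffAt_blowCore h.straight.contDiff h.origin_lt (h.ne_zero hx)).continuousAt
  have hne : ∀ᶠ t : ℝ in 𝓝 0, blowCore (H 0) P ((K x, x.2) + t • (e, (0 : ℝ))) ≠ 0 :=
    hcont.eventually_ne (by rw [zero_smul, add_zero]; exact h.core_ne_zero hx)
  have h3 := h2.unique ((hasDerivAt_const (0 : ℝ) (1 : ℝ)).congr_of_eventuallyEq (by
    filter_upwards [hne] with t ht
    have e1 : (K x, x.2) + t • (e, (0 : ℝ)) = (K x + t • e, x.2) := by simp
    rw [e1] at ht
    have e2 : ‖dir (blowCore (H 0) P (K x + t • e, x.2))‖ = 1 :=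
      norm_dir_eq_one ht (h.core_side _ (by simp [he2, (h.divided_side hx h1).1]))
    simp only [Function.comp_apply, e1, blowUp, e2, one_pow]))
  simp only [Function.comp_apply, zero_smul, add_zero] at h3
  have h4 : inner ℝ (blowUp (H 0) P (K x, x.2)).1
      (fderiv ℝ (blowUp (H 0) P) (K x, x.2) (e, 0)).1 = 0 := by linarith
  rw [trackFrame, Prod.smul_fst, inner_smul_left, real_inner_comm, track, h4, mul_zero]

theorem trackFrame_side_mem (h : SliceOrigin m q M a w H V K L P Q d) {x : Eucl m × ℝ}
    (hx : x ∈ cylinder m) (h1 : ‖x.1‖ = 1) {i : Fin M} (hi : i.1 < q) :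
    (trackFrame H K V P i x).1 ∈ inclRange (m + q) (m + M) := by
  refine Submodule.smul_mem _ _ (fderiv_fst_mem ((contDiffAt_blowUp h.straight.contDiff h.origin_lt
    (h.ne_zero hx) (h.core_pos hx)).differentiableAt (by simp)) fun t => ?_)
  have h2 := h.slice.flat_frame_height _ (cone_mem hx) (cone_side h1) i
  have h3 := h.slice.flat_frame_mem _ (cone_mem hx) (cone_side h1) i hi
  have h4 := h.divided_side hx h1
  have e1 : (K x, x.2) + t • (V i (cone x), (0 : ℝ)) = (K x + t • V i (cone x), x.2) := by simp
  rw [e1]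
  exact Submodule.smul_mem _ _ (h.core_side_mem _ (by simp [h2, h4.1])
    (Submodule.add_mem _ h4.2 (Submodule.smul_mem _ _ h3)))

/-- The appended vectors are orthogonal to both `H 0` and `K x`, which makes the gauge stationary,
and every `P t` fixes them. -/
theorem trackFrame_side_std (h : SliceOrigin m q M a w H V K L P Q d) {x : Eucl m × ℝ}
    (hx : x ∈ cylinder m) (h1 : ‖x.1‖ = 1) {i : Fin M} (hi : q ≤ i.1) :
    trackFrame H K V P i x = (stdVec m M i, 0) := by
  have hV := h.slice.flat_frame_std _ (cone_mem hx) (cone_side h1) i hi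
  have h4 := h.divided_side hx h1
  refine h.trackFrame_orthogonal hx (Or.inr ?_) ?_ ?_
  · simp [hV, ip, inner_stdVec h.origin_mem hi, inner_stdVec h4.2 hi]
  · rw [hV, h.straight.std _ i hi]
  · exact inner_stdVec (h.core_side_mem _ h4.1 h4.2) hi

/-- A slice disk blows up to a concordance, up to a reflection at the end. -/
theorem revConc (h : SliceOrigin m q M a w H V K L P Q d) (hd : ∀ j, d j ^ 2 = 1) :
    RevConc m q M (fun x => diagOp d (a x)) (fun i x => diagOp d (w i x)) (track H K P)
      (trackFrame H K V P) where
  emb := h.isFramedEmbedding_track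
  norm_lt x hx h1 := by
    obtain ⟨c, hc, h2⟩ := h.core_snd x
    exact norm_dir_lt_one (by rw [h2]; exact mul_pos hc (h.divided_height_pos hx h1))
  height_mem x hx h1 := ⟨h.track_height_pos hx h1.1, h.radius_lt hx h1.2⟩
  map_zero _ hx := h.track_zero hx
  frame_zero _ hx i := h.trackFrame_zero hx i
  map_one _ hx := h.track_one hd hx
  frame_one _ hx i := h.trackFrame_one hd hx i
  side_norm x hx h1 := norm_dir_eq_one (h.core_ne_zero hx) (h.core_side _ (h.divided_side hx h1).1)
  side_mem x hx h1 := Submodule.smul_mem _ _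
    (h.core_side_mem _ (h.divided_side hx h1).1 (h.divided_side hx h1).2)
  side_tangent _ hx h1 i := h.track_side_tangent hx h1 i
  side_frame_mem _ hx h1 _ hi := h.trackFrame_side_mem hx h1 hi
  side_frame_std _ hx h1 _ hi := h.trackFrame_side_std hx h1 hi

end SliceOrigin

end Blown

/-! ### Orientations under suspension and sign changes -/

section Suspension

variable {m N M : ℕ}

/-- After reindexing, suspension adds an identity block on the diagonal. -/
theorem det_frameMatrix_susp (hNM : N ≤ M) {a : Eucl m → Eucl (m + N)}
    (v : Fin N → Eucl m → Eucl (m + N)) (ha : DifferentiableOn ℝ a (disk m)) {x : Eucl m}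
    (hx : x ∈ disk m) : (frameMatrix (fun x => incl (m + N) (m + M) (a x)) (suspFrame m N M v) x).det =
      (frameMatrix a v x).det := by
  obtain ⟨c, rfl⟩ := Nat.exists_eq_add_of_le hNM
  let e : Fin (m + N) ⊕ Fin c ≃ Fin (m + (N + c)) :=
    finSumFinEquiv.trans (finCongr (Nat.add_assoc m N c))
  have e1 : ∀ j, (e (Sum.inl j)).1 = j.1 := fun j => by simp [e]
  have e2 : ∀ i, (e (Sum.inr i)).1 = m + N + i.1 := fun i => by simp [e]
  have hd : fderivWithin ℝ (fun x => incl (m + N) (m + (N + c)) (a x)) (disk m) x =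
      (incl (m + N) (m + (N + c))).comp (fderivWithin ℝ a (disk m) x) :=
    ((incl (m + N) (m + (N + c))).hasFDerivAt.comp_hasFDerivWithinAt x
      (ha x hx).hasFDerivWithinAt).fderivWithin (uniqueDiffOn_disk m x hx)
  have hl : ∀ j i, frameMatrix (fun x => incl (m + N) (m + (N + c)) (a x)) (suspFrame m N (N + c) v) x
      i (e (Sum.inl j)) = incl (m + N) (m + (N + c))
        (WithLp.toLp 2 fun i => frameMatrix a v x i j) i := by
    intro j i
    refine Fin.addCases (fun k => ?_) (fun k => ?_) j
    · have h1 : e (Sum.inl (Fin.castAdd N k)) = Fin.castAdd (N + c) k := Fin.ext (e1 _)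
      simp only [frameMatrix, Matrix.of_apply, h1, Fin.append_left, hd]
      rfl
    · have h1 : e (Sum.inl (Fin.natAdd m k)) = Fin.natAdd m (Fin.castAdd c k) := Fin.ext (e1 _)
      have h2 : (Fin.castAdd c k).1 < N := k.2
      simp only [frameMatrix, Matrix.of_apply, h1, Fin.append_right, suspFrame, dif_pos h2]
      rfl
  have hr : ∀ j i, frameMatrix (fun x => incl (m + N) (m + (N + c)) (a x)) (suspFrame m N (N + c) v) x
      i (e (Sum.inr j)) = if i.1 = m + N + j.1 then 1 else 0 := by
    intro j i
    have h1 : e (Sum.inr j) = Fin.natAdd m (Fin.natAdd N j) := Fin.ext (by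
      rw [e2, Fin.val_natAdd, Fin.val_natAdd, Nat.add_assoc])
    have h2 : ¬ (Fin.natAdd N j).1 < N := by simp
    have h3 : suspFrame m N (N + c) v (Fin.natAdd N j) x = stdVec m (N + c) (Fin.natAdd N j) :=
      dif_neg h2
    rw [frameMatrix, Matrix.of_apply, h1, Fin.append_right, h3]
    simp only [stdVec, PiLp.single_apply, Fin.ext_iff, Fin.val_natAdd, Nat.add_assoc]
  rw [← Matrix.det_submatrix_equiv_self e, ← mul_one (frameMatrix a v x).det,
    ← Matrix.det_one (n := Fin c), ← Matrix.det_fromBlocks_zero₂₁ (frameMatrix a v x) 0 1]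
  congr 1
  ext i j
  rcases i with i | i <;> rcases j with j | j
  · rw [Matrix.submatrix_apply, hl, incl_apply, dif_pos (by rw [e1]; exact i.2)]
    simp only [e1]
    rfl
  · rw [Matrix.submatrix_apply, hr, e1, if_neg (by have := i.2; omega)]
    rfl
  · rw [Matrix.submatrix_apply, hl, incl_apply, dif_neg (by rw [e2]; omega)]
    rfl
  · rw [Matrix.submatrix_apply, hr, e2, Matrix.fromBlocks_apply₂₂, Matrix.one_apply]
    simp only [Nat.add_left_cancel_iff, Fin.ext_iff]

theorem frameMatrix_diagOp (d : Fin (m + M) → ℝ) {a : Eucl m → Eucl (m + M)}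
    (w : Fin M → Eucl m → Eucl (m + M)) (ha : DifferentiableOn ℝ a (disk m)) {x : Eucl m}
    (hx : x ∈ disk m) : frameMatrix (fun x => diagOp d (a x)) (fun i x => diagOp d (w i x)) x =
      Matrix.diagonal d * frameMatrix a w x := by
  have hd : fderivWithin ℝ (fun x => diagOp d (a x)) (disk m) x =
      (diagOp d).comp (fderivWithin ℝ a (disk m) x) :=
    ((diagOp d).hasFDerivAt.comp_hasFDerivWithinAt x
      (ha x hx).hasFDerivWithinAt).fderivWithin (uniqueDiffOn_disk m x hx)
  ext i j
  rw [Matrix.diagonal_mul]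
  refine Fin.addCases (fun k => ?_) (fun k => ?_) j
  · simp only [frameMatrix, Matrix.of_apply, Fin.append_left, hd, ContinuousLinearMap.comp_apply,
      diagOp_apply]
  · simp only [frameMatrix, Matrix.of_apply, Fin.append_right, diagOp_apply]

end Suspension

/-! ### Invariance of the orientation along a concordance -/

section Orientation

variable {m q M : ℕ} {a : Eucl m → Eucl (m + M)} {w : Fin M → Eucl m → Eucl (m + M)}
  {F : Eucl m × ℝ → Eucl (m + M) × ℝ} {V : Fin M → Eucl m × ℝ → Eucl (m + M) × ℝ}

/-- The columns are the partial derivatives of `F` along the disk, the framing, and the vertical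
derivative of `F`. -/
def trackMatrix (F : Eucl m × ℝ → Eucl (m + M) × ℝ) (V : Fin M → Eucl m × ℝ → Eucl (m + M) × ℝ)
    (p : Eucl m × ℝ) : Matrix (Fin (m + M) ⊕ Unit) (Fin (m + M) ⊕ Unit) ℝ :=
  Matrix.of fun i j => Sum.elim
    (fun i => (Sum.elim (Fin.append
      (fun k => fderivWithin ℝ F (cylinder m) p (EuclideanSpace.single k 1, 0)) (fun k => V k p))
      (fun _ => fderivWithin ℝ F (cylinder m) p (0, 1)) j).1 i)
    (fun _ => (Sum.elim (Fin.append
      (fun k => fderivWithin ℝ F (cylinder m) p (EuclideanSpace.single k 1, 0)) (fun k => V k p))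
      (fun _ => fderivWithin ℝ F (cylinder m) p (0, 1)) j).2) i

theorem trackMatrix_mulVec (F : Eucl m × ℝ → Eucl (m + M) × ℝ)
    (V : Fin M → Eucl m × ℝ → Eucl (m + M) × ℝ) (p : Eucl m × ℝ) (c : Fin (m + M) ⊕ Unit → ℝ) :
    (∀ i, (trackMatrix F V p).mulVec c (Sum.inl i) = (fderivWithin ℝ F (cylinder m) p
      (WithLp.toLp 2 fun k => c (Sum.inl (Fin.castAdd M k)), c (Sum.inr ())) +
        ∑ k, c (Sum.inl (Fin.natAdd m k)) • V k p).1 i) ∧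
    (trackMatrix F V p).mulVec c (Sum.inr ()) = (fderivWithin ℝ F (cylinder m) p
      (WithLp.toLp 2 fun k => c (Sum.inl (Fin.castAdd M k)), c (Sum.inr ())) +
        ∑ k, c (Sum.inl (Fin.natAdd m k)) • V k p).2 := by
  set D := fderivWithin ℝ F (cylinder m) p
  have h1 : D (WithLp.toLp 2 fun k => c (Sum.inl (Fin.castAdd M k)), c (Sum.inr ())) =
      ∑ k, c (Sum.inl (Fin.castAdd M k)) • D (EuclideanSpace.single k 1, 0) +
        c (Sum.inr ()) • D (0, 1) := by
    simp only [← map_smul, ← map_sum, ← map_add]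
    congr 1
    refine Prod.ext ?_ ?_
    · ext j
      simp [Prod.fst_sum, Pi.single_apply]
    · simp [Prod.snd_sum]
  rw [h1]
  constructor
  · intro i
    simp [Matrix.mulVec, dotProduct, trackMatrix, Fin.sum_univ_add, Prod.fst_sum, D, mul_comm]
    ring
  · simp [Matrix.mulVec, dotProduct, trackMatrix, Fin.sum_univ_add, Prod.snd_sum, D, mul_comm]
    ring

/-- A kernel vector consists of a tangent vector and frame coefficients whose combination vanishes,
which the complement condition forbids. -/
theorem det_trackMatrix_ne_zero (h : IsFramedEmbedding (cylinder m) F V) {p : Eucl m × ℝ}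
    (hp : p ∈ cylinder m) : (trackMatrix F V p).det ≠ 0 := by
  intro h0
  obtain ⟨c, hc, h1⟩ := Matrix.exists_mulVec_eq_zero_iff.2 h0
  obtain ⟨h2, h3⟩ := trackMatrix_mulVec F V p c
  rw [h1] at h2 h3
  have h4 := @(h.complement p hp).1 ((WithLp.toLp 2 fun k => c (Sum.inl (Fin.castAdd M k)),
    c (Sum.inr ())), fun k => c (Sum.inl (Fin.natAdd m k))) 0 (by
      simp only [Prod.fst_zero, map_zero, Prod.snd_zero, Pi.zero_apply, zero_smul,
        Finset.sum_const_zero, add_zero]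
      refine Prod.ext ?_ h3.symm
      ext i
      exact (h2 i).symm)
  refine hc (funext fun j => ?_)
  rcases j with j | j
  · refine Fin.addCases (fun k => ?_) (fun k => ?_) j
    · exact congrArg (fun z => z.1.1 k) h4
    · exact congrFun (congrArg Prod.snd h4) k
  · exact congrArg (fun z => z.1.2) h4

theorem continuousOn_det_trackMatrix (h : IsFramedEmbedding (cylinder m) F V) :
    ContinuousOn (fun p => (trackMatrix F V p).det) (cylinder m) := by
  have hD : ContinuousOn (fderivWithin ℝ F (cylinder m)) (cylinder m) :=
    h.smooth.continuousOn_fderivWithin uniqueDiffOn_cylinder (by simp)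
  have hcol : ∀ j : Fin (m + M) ⊕ Unit, ContinuousOn (fun p => Sum.elim (Fin.append
      (fun k => fderivWithin ℝ F (cylinder m) p (EuclideanSpace.single k 1, 0)) (fun k => V k p))
      (fun _ => fderivWithin ℝ F (cylinder m) p (0, 1)) j) (cylinder m) := by
    rintro (j | j)
    · refine Fin.addCases (fun k => ?_) (fun k => ?_) j
      · simpa using hD.clm_apply continuousOn_const
      · simpa using (h.smooth_frame k).continuousOn
    · exact hD.clm_apply continuousOn_const
  refine (Continuous.matrix_det continuous_id).comp_continuousOn ?_
  refine continuousOn_pi.2 fun i => continuousOn_pi.2 fun j => ?_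
  rcases i with i | i
  · exact (EuclideanSpace.proj i : Eucl (m + M) →L[ℝ] ℝ).continuous.comp_continuousOn
      (continuous_fst.comp_continuousOn (hcol j))
  · exact continuous_snd.comp_continuousOn (hcol j)

/-- At an end the horizontal derivatives and the frame have no vertical component, so the matrix is
block triangular. -/
theorem det_trackMatrix_end (h : IsFramedEmbedding (cylinder m) F V) {r s : ℝ}
    (hr : r ∈ Icc (0 : ℝ) 1) (hF : ∀ x ∈ disk m, F (x, r) = (a x, s))
    (hV : ∀ x ∈ disk m, ∀ i, V i (x, r) = (w i x, 0)) {x : Eucl m} (hx : x ∈ disk m) :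
    (trackMatrix F V (x, r)).det = (frameMatrix a w x).det *
      (fderivWithin ℝ F (cylinder m) (x, r) (0, 1)).2 := by
  have hdiff := h.smooth.differentiableOn (by simp)
  have ha : DifferentiableOn ℝ a (disk m) := by
    have h1 : DifferentiableOn ℝ (fun x => (F (x, r)).1) (disk m) :=
      differentiable_fst.comp_differentiableOn
        (hdiff.comp (by fun_prop) fun x hx => ⟨hx, hr⟩)
    exact h1.congr fun x hx => by rw [hF x hx]
  have h1 : trackMatrix F V (x, r) = Matrix.fromBlocks (frameMatrix a w x)
      (Matrix.of fun i _ => (fderivWithin ℝ F (cylinder m) (x, r) (0, 1)).1 i) 0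
      (Matrix.of fun _ _ => (fderivWithin ℝ F (cylinder m) (x, r) (0, 1)).2) := by
    ext i j
    rcases j with j | j
    · refine Fin.addCases (fun k => ?_) (fun k => ?_) j <;> rcases i with i | i
      · simp [trackMatrix, frameMatrix, fderivWithin_end hr hdiff hF ha hx]
      · simp [trackMatrix, fderivWithin_end hr hdiff hF ha hx]
      · simp [trackMatrix, frameMatrix, hV x hx]
      · simp [trackMatrix, hV x hx]
    · rcases i with i | i
      · simp [trackMatrix]
      · simp [trackMatrix]
  rw [h1, Matrix.det_fromBlocks_zero₂₁, Matrix.det_unique (n := Unit)]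
  rfl

/-- A concordance starting at the standard disk preserves orientations. -/
theorem RevConc.det_pos (h : RevConc m q M a w F V) {x : Eucl m} (hx : x ∈ disk m) :
    0 < (frameMatrix a w x).det := by
  have h0 : (0 : ℝ) ∈ Icc (0 : ℝ) 1 := left_mem_Icc.2 zero_le_one
  have h1 : (1 : ℝ) ∈ Icc (0 : ℝ) 1 := right_mem_Icc.2 zero_le_one
  have hdiff := h.emb.smooth.differentiableOn (by simp)
  have hstart : 0 < (trackMatrix F V (x, 0)).det := by
    obtain ⟨β, hβ, hF, hpos⟩ := h.exists_factor
    rw [det_trackMatrix_end (w := fun i _ => stdVec m M i) h.emb h0 h.map_zero h.frame_zero hx,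
      frameMatrix_incl m M x hx, Matrix.det_one, one_mul,
      fderivWithin_height hdiff hβ.continuousOn hF hx]
    exact hpos _ ⟨hx, h0⟩
  -- The determinant is continuous without zeros on the connected cylinder, so its sign at the
  -- bottom persists to the top.
  have hend : 0 < (trackMatrix F V (x, 1)).det := by
    by_contra hneg
    obtain ⟨p, hp, hp0⟩ := convex_cylinder.isPreconnected.intermediate_value
      (show (x, (1 : ℝ)) ∈ cylinder m from ⟨hx, h1⟩) (show (x, (0 : ℝ)) ∈ cylinder m from ⟨hx, h0⟩)
      (continuousOn_det_trackMatrix h.emb) ⟨not_lt.1 hneg, hstart.le⟩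
    exact det_trackMatrix_ne_zero h.emb hp hp0
  rw [det_trackMatrix_end h.emb h1 h.map_one h.frame_one hx] at hend
  -- It remains to see that the vertical derivative at the top is nonnegative, which holds because
  -- heights never exceed one.
  refine pos_of_mul_pos_left hend ?_
  have hm : MapsTo (fun t : ℝ => (x, t)) (Icc 0 1) (cylinder m) := fun t ht => ⟨hx, ht⟩
  have h2 : HasDerivWithinAt (fun t : ℝ => F (x, t))
      (fderivWithin ℝ F (cylinder m) (x, 1) (0, 1)) (Icc 0 1) 1 :=
    (hdiff (x, 1) (hm h1)).hasFDerivWithinAt.comp_hasDerivWithinAt (1 : ℝ)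
      (f := fun t : ℝ => (x, t))
      ((hasDerivWithinAt_const _ _ _).prodMk (hasDerivWithinAt_id _ _)) hm
  have h3 : HasDerivWithinAt (fun t : ℝ => (F (x, t)).2)
      (fderivWithin ℝ F (cylinder m) (x, 1) (0, 1)).2 (Ico 0 1) 1 :=
    have hs : HasFDerivAt (Prod.snd : Eucl (m + M) × ℝ → ℝ) (ContinuousLinearMap.snd ℝ _ ℝ)
        (F (x, 1)) := hasFDerivAt_snd
    HasDerivWithinAt.mono (HasFDerivAt.comp_hasDerivWithinAt (f := fun t : ℝ => F (x, t)) (1 : ℝ) hs h2)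
      Ico_subset_Icc_self
  rw [hasDerivWithinAt_iff_tendsto_slope' (fun h => lt_irrefl _ h.2)] at h3
  have : (𝓝[Ico (0 : ℝ) 1] 1).NeBot := by
    rw [nhdsWithin_Ico_eq_nhdsLT zero_lt_one]
    infer_instance
  refine ge_of_tendsto h3 (eventually_mem_nhdsWithin.mono fun t ht => ?_)
  rw [slope_def_field]
  have h4 := h.height_le_one (hm ⟨ht.1, ht.2.le⟩)
  refine div_nonneg_of_nonpos ?_ (by linarith [ht.2])
  rw [h.map_one x hx]
  simpa using h4

end Orientation

/-- The blow-up ends at `a` or at its mirror image in the first coordinate. In the second case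
`RevConc.det_pos` would make the determinant of the mirror image positive, hence that of `a`
negative, as suspension does not change it. -/
theorem SwapSlice.exists_revConc {m q M N : ℕ} (hm : 0 < m) (hq : q ≤ M) (hN : N ≤ M)
    {a : Eucl m → Eucl (m + N)} {v : Fin N → Eucl m → Eucl (m + N)}
    (ha : DifferentiableOn ℝ a (disk m)) (hpos : ∀ x ∈ disk m, 0 < (frameMatrix a v x).det)
    {H : Eucl m × ℝ → Eucl (m + M) × ℝ} {V : Fin M → Eucl m × ℝ → Eucl (m + M) × ℝ}
    (h : SwapSlice m q M (fun x => incl (m + N) (m + M) (a x)) (suspFrame m N M v) H V) :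
    ∃ F V', RevConc m q M (fun x => incl (m + N) (m + M) (a x)) (suspFrame m N M v) F V' := by
  obtain ⟨K, L, P, Q, d, hS, hd⟩ := h.exists_sliceOrigin hm hq
  have hd2 : ∀ j, d j ^ 2 = 1 := fun j => by
    rcases hd with rfl | rfl
    · simp
    · by_cases hj : j = ⟨0, Nat.add_pos_left hm M⟩
      · rw [hj, Function.update_self]
        norm_num
      · rw [Function.update_of_ne hj]
        simp
  have hR := hS.revConc hd2
  rcases hd with rfl | rfl
  · simp only [diagOp_one] at hR
    exact ⟨_, _, hR⟩
  · have h0 : (0 : Eucl m) ∈ disk m := mem_disk.2 (by simp)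
    have h1 := hR.det_pos h0
    have ha' : DifferentiableOn ℝ (fun x => incl (m + N) (m + M) (a x)) (disk m) :=
      (incl (m + N) (m + M)).differentiable.comp_differentiableOn ha
    rw [frameMatrix_diagOp _ _ ha' h0,
      Matrix.det_mul, det_diagonal_update, det_frameMatrix_susp hN v ha h0] at h1
    linarith [hpos 0 h0]

end DiskedEmbedding

end

theorem mainTheorem6 (n q N : ℕ) (hq : 3 ≤ q) (hN : q ≤ N)
    (A : DiskedEmbedding.FramedDisked n q N) :
    DiskedEmbedding.Concordant A (DiskedEmbedding.trivialDisked n q N) ↔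
      DiskedEmbedding.IsSlice A := by
  rw [DiskedEmbedding.concordant_iff_revConc hN, DiskedEmbedding.isSlice_iff_swapSlice hN]
  -- Blowing down and blowing up both keep the ambient dimension, so the two sides are compared for
  -- each `M` separately.
  refine exists_congr fun M => and_congr_right fun hM => ⟨fun ⟨F, V, h⟩ => h.exists_swapSlice,
    fun ⟨H, V, h⟩ => h.exists_revConc (Nat.succ_pos n) (hN.trans hM) hM
      (A.isFramedEmbedding.smooth.differentiableOn (by simp)) A.oriented⟩
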